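/- **Setting.** Let $\mathring\gamma$ be the unit round metric on the sphere $\mathbb S^2$ and let $r=2$; $S_2$ denotes $\mathbb S^2$ with the round metric $r^2\mathring\gamma$. All operators below are those of the unit metric $\mathring\gamma$ (taken weakly), which also raises and lowers indices; $\epsilon$ is its area form, and equalities hold almost everywhere. Write $d$ for the gradient of functions, $\operatorname{div}X=\nabla^AX_A$, $(\operatorname{div}V)_A=\nabla^BV_{BA}$, $\Delta=\operatorname{div}d$, $({}^\star X)_A=\epsilon_{AB}X^B$, and $$\mathcal D_1^*(f_1,f_2)=-df_1+{}^\star df_2,\qquad (\mathcal D_2^*X)_{AB}=-\tfrac12\big(\nabla_AX_B+\nabla_BX_A-(\operatorname{div}X)\mathring\gamma_{AB}\big).$$ For tensor fields $T$ on the sphere, $\|T\|^2_{H^m}=\sum_{i=0}^m\|\nabla^iT\|^2_{L^2}$; in $H^m(S_2)$ lengths, area and $\nabla$ are taken with respect to $r^2\mathring\gamma$, in $H^m(\mathbb S^2)$ with respect to $\mathring\gamma$. Let $Y$ and $Z$ range over the real spherical harmonics of degree $l$. Functions have modes spanned by the $Y$ ($l\ge0$), 1-forms have modes spanned by the $\mathcal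 D_1^*(Y,Z)$ ($l\ge1$), symmetric tracefree 2-tensors have modes spanned by the $\mathcal D_2^*\mathcal D_1^*(Y,Z)$ ($l\ge2$). The superscripts $[l]$, $[\le l]$, $[\ge l]$ denote the $L^2$-orthogonal projections to the closed span of the modes of the indicated degrees. The electric part $V_\psi$ of a symmetric tracefree 2-tensor $V$ is its $L^2$-orthogonal projection to the closed span of all $\mathcal D_2^*\mathcal D_1^*(Y,0)$, $l\ge2$. **Linearized sphere data** are tuples $$\dot x=\big(\dot\Omega,\dot\phi,\dot g_c,\dot{(\Omega\mathrm{tr}\chi)},\dot{\hat\chi},\dot{(\Omega\mathrm{tr}\underline\chi)},\dot{\hat{\underline\chi}},\dot\eta,\dot\omega,\dot{D\omega},\dot{\underline\omega},\dot{\underline D\underline\omega},\dot\alpha,\dot{\underline\alpha}\big),$$ where $\dot\eta$ is a 1-form, $\dot g_c,\dot{\hat\chi},\dot{\hat{\underline\chi}},\dot\alpha,\dot{\underline\alpha}$ are symmetric tracefree 2-tensors, and the other entries are functions. The linearized induced metric is $\dot g=2r\dot\phi\mathring\gamma+r^2\dot g_c$. The norm $\|\dot x\|_{\mathcal X(S_2)}$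 is the sum of the $H^6(S_2)$-norms of $\dot\Omega,\dot g,\dot{(\Omega\mathrm{tr}\chi)},\dot{\hat\chi},\dot\omega,\dot{D\omega},\dot\alpha$, the $H^5(S_2)$-norm of $\dot\eta$, the $H^4(S_2)$-norms of $\dot{(\Omega\mathrm{tr}\underline\chi)},\dot{\hat{\underline\chi}},\dot{\underline\omega}$, and the $H^2(S_2)$-norms of $\dot{\underline D\underline\omega},\dot{\underline\alpha}$. **Charges.** With $\dot K=\frac1{2r^2}\operatorname{div}\operatorname{div}\dot g_c-\frac1{r^3}(\Delta+2)\dot\phi$ and $\dot B=\dot{(\Omega\mathrm{tr}\chi)}-\frac4r\dot\Omega$, put $$\begin{aligned} \mathcal Q_0&=r^2\dot\eta^{[1]}+\tfrac{r^3}2d\,\dot B^{[1]},\qquad \mathcal Q_1=\tfrac r2\dot B+\tfrac1r\dot\phi,\\ \mathcal Q_2&=r^2\dot{(\Omega\mathrm{tr}\underline\chi)}-\tfrac2r\operatorname{div}\big(r^2\dot\eta+\tfrac{r^3}2d\dot B\big)-r^2\dot B+2r^3\dot K,\\ \mathcal Q_3&=\tfrac1r\dot{\hat{\underline\chi}}-\tfrac12(\mathcal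 D_2^*\operatorname{div}+1)\dot g_c+\mathcal D_2^*\big(\dot\eta+\tfrac r2d\dot B\big)-r\,\mathcal D_2^*d\dot B,\\ \mathcal Q_4&=\tfrac1r\dot{\underline\alpha}_\psi+2\Big(\mathcal D_2^*\big(\tfrac1{r^2}\operatorname{div}\dot{\hat{\underline\chi}}-\tfrac1r\dot\eta-\tfrac12d\,\dot{(\Omega\mathrm{tr}\underline\chi)}+\mathcal D_1^*(\dot{\underline\omega},0)\big)\Big)_\psi,\\ \mathcal Q_5&=\dot{\underline\omega}^{[\le1]}+\tfrac1{4r^2}\mathcal Q_2^{[\le1]}+\tfrac1{3r^3}\operatorname{div}\mathcal Q_0,\\ \mathcal Q_6&=\dot{\underline D\underline\omega}^{[\le1]}-\tfrac1{6r^3}(\Delta-3)\mathcal Q_2^{[\le1]}+\tfrac1{r^4}\operatorname{div}\mathcal Q_0,\\ \mathcal Q_7&=\dot{\underline D\underline\omega}^{[2]}+\tfrac3{2r^3}\mathcal Q_2^{[2]}+\tfrac1{2r^2}\operatorname{div}\operatorname{div}\mathcal Q_3^{[2]}-\tfrac{12}{r^2}\mathcal Q_1^{[2]}+\tfrac3{2r^2}\Big(\operatorname{div}\big(\dot\eta+\tfrac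 r2d\dot B\big)\Big)^{[2]}-\tfrac3{4r^2}\big(\operatorname{div}\operatorname{div}\dot g_c\big)^{[2]}. \end{aligned}$$ **Linearized perturbations at Minkowski.** A transversal perturbation function is a tuple $\dot f=(f,f_u,f_{uu},f_{uuu})$ of functions (standing for $f$ and its $u$-derivatives at $u=0$) with finite norm $$\|\dot f\|_{\mathcal Y_f}=\|f\|_{H^8(\mathbb S^2)}+\|f_u\|_{H^6(\mathbb S^2)}+\|f_{uu}\|_{H^4(\mathbb S^2)}+\|f_{uuu}\|_{H^2(\mathbb S^2)}.$$ The nonzero entries of $\dot{\mathcal P}_f(\dot f)$ are, with $h=\frac1rf_u+\frac1{r^2}f$, $$\dot\Omega=\tfrac12f_u,\quad\dot\phi=-f,\quad\dot\eta=r\,dh,\quad\dot{\hat\chi}=-2\mathcal D_2^*df,\quad\dot{(\Omega\mathrm{tr}\underline\chi)}=-2h,\quad\dot{(\Omega\mathrm{tr}\chi)}=\tfrac2{r^2}(\Delta+1)f,\quad\dot{\underline\omega}=\tfrac12f_{uu},\quad\dot{\underline D\underline\omega}=\tfrac12f_{uuu}.$$ An angular perturbation is a tangential vector field $\dot j$ with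 finite norm $\|\dot j\|_{\mathcal Y_j}=\|\dot j\|_{H^7(\mathbb S^2)}$. The nonzero entries of $\dot{\mathcal P}_j(\dot j)$ are $\dot\phi=\frac r2\operatorname{div}\dot j$ and $\dot g_c=-2\mathcal D_2^*\dot j$ (that is, $\dot\phi=\frac r2\Delta q_1$ and $\dot g_c=2\mathcal D_2^*\mathcal D_1^*(q_1,q_2)$ if $\dot j=-\mathcal D_1^*(q_1,q_2)$). **Proposition.** 1. *Gauge-invariant charges.* For all perturbation functions $\dot f$ and $\dot j$ of finite norm, $$\mathcal Q_0\big(\dot{\mathcal P}_f(\dot f)+\dot{\mathcal P}_j(\dot j)\big)=0,\qquad \mathcal Q_2^{[\le1]}\big(\dot{\mathcal P}_f(\dot f)+\dot{\mathcal P}_j(\dot j)\big)=0,$$ that is, the 10-dimensional space of charges $\mathcal Q_0$ and $\mathcal Q_2^{[\le1]}$ is invariant under linearized perturbations. Here $10=6+4$: the 1-forms of degree $1$, in which $\mathcal Q_0$ takes its values, form a space of dimension $6$, and the functions of degree $\le1$ form a space of dimension $4$. 2. *Gauge-dependent charges.* There is a universal constant $C$ such that the following holds. Let $(\mathcal Q_1)_0,(\mathcal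 Q_2)_0,(\mathcal Q_5)_0,(\mathcal Q_6)_0,(\mathcal Q_7)_0$ be functions and $(\mathcal Q_3)_0,(\mathcal Q_4)_0$ symmetric tracefree 2-tensors on $S_2$ with $$(\mathcal Q_2)_0^{[\le1]}=0,\quad(\mathcal Q_5)_0^{[\ge2]}=0,\quad(\mathcal Q_6)_0^{[\ge2]}=0,\quad(\mathcal Q_7)_0=(\mathcal Q_7)_0^{[2]},\quad(\mathcal Q_4)_0=\big((\mathcal Q_4)_0\big)_\psi,$$ such that $$\begin{aligned}N:={}&\|(\mathcal Q_1)_0\|_{H^6(S_2)}+\|(\mathcal Q_2)_0\|_{H^4(S_2)}+\|(\mathcal Q_3)_0\|_{H^4(S_2)}+\|(\mathcal Q_4)_0\|_{H^2(S_2)}\\&+\|(\mathcal Q_5)_0\|_{H^4(S_2)}+\|(\mathcal Q_6)_0\|_{H^2(S_2)}+\|(\mathcal Q_7)_0\|_{H^2(S_2)}<\infty.\end{aligned}$$ Then there exist $\dot f$ and $\dot j$ with $$\mathcal Q_i\big(\dot{\mathcal P}_f(\dot f)+\dot{\mathcal P}_j(\dot j)\big)=(\mathcal Q_i)_0\quad\text{for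 }1\le i\le7,$$ $$\|\dot f\|_{\mathcal Y_f}+\|\dot j\|_{\mathcal Y_j}+\|\dot{\mathcal P}_f(\dot f)\|_{\mathcal X(S_2)}+\|\dot{\mathcal P}_j(\dot j)\|_{\mathcal X(S_2)}\le C\,N.$$ -/

import Mathlib

open MeasureTheory Filter Topology
open scoped ENNReal NNReal

noncomputable section

namespace CharGluing

/-! ## The unit round sphere and tensor fields on it

A covariant tensor of rank `k` at `x ∈ 𝕊² ⊂ ℝ³` is represented by its components in `ℝ³`; it is an
honest tensor of `T_x 𝕊²` when contracting any of its slots with the normal `x` gives zero. Indices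
are raised and lowered with the unit round metric, so vector fields and 1-forms are identified. -/

/-- Euclidean 3-space. -/
abbrev E3 := EuclideanSpace ℝ (Fin 3)

/-- The unit sphere in `ℝ³`. -/
abbrev S2 := Metric.sphere (0 : E3) 1

/-- The surface measure of the unit sphere (of total mass `4π`). -/
def σ : Measure S2 := (volume : Measure E3).toSphere

/-- Rank-`k` tensors on `ℝ³`, with the Euclidean (Hilbert-Schmidt) norm. -/
abbrev Tens (k : ℕ) := EuclideanSpace ℝ (Fin k → Fin 3)

/-- Rank-`k` tensor fields along the sphere; `k = 0` gives the scalar functions. -/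
abbrev TField (k : ℕ) := S2 → Tens k

/-- `t` is tangential to the sphere at `x`. -/
def IsTangent {k : ℕ} (x : S2) (t : Tens k) : Prop :=
  ∀ (a : Fin k) (I : Fin k → Fin 3), ∑ j, (x : E3) j * t (Function.update I a j) = 0

/-- Components of the orthogonal projection `ℝ³ → T_x 𝕊²`; equivalently, of the unit round metric. -/
def proj (x : S2) (i j : Fin 3) : ℝ := (if i = j then 1 else 0) - (x : E3) i * (x : E3) j

/-- Projection of all slots of a tensor to the tangent plane at `x`. -/
def projTens {k : ℕ} (x : S2) (t : Tens k) : Tens k :=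
  WithLp.toLp 2 fun I => ∑ J : Fin k → Fin 3, (∏ a, proj x (I a) (J a)) * t J

/-- Extension of a field on the sphere to `ℝ³ \ {0}`, constant along rays. -/
def radialExt {k : ℕ} (T : TField k) : E3 → Tens k := fun y =>
  if h : y = 0 then 0 else T ⟨‖y‖⁻¹ • y, by
    simp [norm_smul, inv_mul_cancel₀ (norm_ne_zero_iff.mpr h)]⟩

/-- Smooth fields on the sphere. -/
def IsSmooth {k : ℕ} (T : TField k) : Prop := ContDiffOn ℝ ((⊤ : ℕ∞) : WithTop ℕ∞) (radialExt T) {0}ᶜ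

/-- Covariant derivative of a smooth tangential field: the tangential projection of the ambient
derivative. The first slot of `∇ T` is the slot of the derivative. -/
def classicalCov {k : ℕ} (T : TField k) : TField (k + 1) := fun x =>
  projTens x (WithLp.toLp 2 fun I =>
    (fderiv ℝ (radialExt T) (x : E3) (EuclideanSpace.single (I 0) 1)) (Fin.tail I))

/-- Contraction of the first two slots. -/
def tr {k : ℕ} (t : Tens (k + 2)) : Tens k :=
  WithLp.toLp 2 fun I => ∑ i : Fin 3, t (Fin.cons i (Fin.cons i I))

/-! ## Weak covariant derivatives and Sobolev norms -/

/-- `S ∈ L²` is the weak covariant derivative of `T ∈ L²`: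
`∫ ⟨S, W⟩ = - ∫ ⟨T, div W⟩` for all smooth tangential test fields `W`. -/
def IsWeakCov {k : ℕ} (T : TField k) (S : TField (k + 1)) : Prop :=
  MemLp T 2 σ ∧ MemLp S 2 σ ∧ (∀ᵐ x ∂σ, IsTangent x (S x)) ∧
    ∀ W : TField (k + 1), IsSmooth W → (∀ x, IsTangent x (W x)) →
      ∫ x, inner ℝ (S x) (W x) ∂σ = - ∫ x, inner ℝ (T x) (tr (classicalCov W x)) ∂σ

open Classical in
/-- The weak covariant derivative `∇ T` (unique up to null sets), and `0` if there is none. -/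
def cov {k : ℕ} (T : TField k) : TField (k + 1) :=
  if h : ∃ S, IsWeakCov T S then h.choose else 0

/-- The iterated weak covariant derivative `∇ⁱ T`. -/
def covIter {k : ℕ} (T : TField k) : (i : ℕ) → TField (k + i)
  | 0 => T
  | i + 1 => cov (covIter T i)

/-- The Sobolev space `H^m` of tangential tensor fields. -/
def MemSob {k : ℕ} (m : ℕ) (T : TField k) : Prop :=
  MemLp T 2 σ ∧ (∀ᵐ x ∂σ, IsTangent x (T x)) ∧ ∀ i < m, ∃ S, IsWeakCov (covIter T i) S

open Classical in
/-- The norm `(∑_{0 ≤ i ≤ m} ‖∇ⁱ T‖²_{L²})^{1/2}` of `H^m`, where lengths and the area are taken with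
respect to the round metric `r² γ` of radius `r` (so that `|∇ⁱ T|²` scales like `r^{-2(k+i)}` and the
area like `r²`); it is `∞` outside `H^m`. -/
def sobNorm {k : ℕ} (r : ℝ) (m : ℕ) (T : TField k) : ℝ≥0∞ :=
  if MemSob m T then
    (∑ i ∈ Finset.range (m + 1),
      ENNReal.ofReal (r ^ (2 - 2 * ((k : ℤ) + i))) * eLpNorm (covIter T i) 2 σ ^ 2) ^ (1 / 2 : ℝ)
  else ⊤

/-! ## Differential operators of the unit round sphere -/

/-- The exterior derivative `d f` of a scalar function. -/
def grad (f : TField 0) : TField 1 := cov f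

/-- The divergence of a 1-form: `∇^A X_A`. -/
def div1 (X : TField 1) : TField 0 := fun x => tr (cov X x)

/-- The divergence of a 2-tensor: `∇^B V_{BA}`. -/
def div2 (V : TField 2) : TField 1 := fun x => tr (cov V x)

/-- The Laplace-Beltrami operator. -/
def lap (f : TField 0) : TField 0 := div1 (grad f)

/-- The Hodge dual `(⋆X)_A = ε_{AB} X^B`, which is the cross product of `X` with the outer unit
normal. -/
def star (X : TField 1) : TField 1 := fun x => WithLp.toLp 2 fun I =>
  X x ![I 0 + 1] * (x : E3) (I 0 + 2) - X x ![I 0 + 2] * (x : E3) (I 0 + 1)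

/-- `D₁⋆ (f₁, f₂) = - d f₁ + ⋆ d f₂`. -/
def D1s (f₁ f₂ : TField 0) : TField 1 := - grad f₁ + star (grad f₂)

/-- `(D₂⋆ X)_{AB} = - (1/2) (∇_A X_B + ∇_B X_A - (div X) γ_{AB})`. -/
def D2s (X : TField 1) : TField 2 := fun x => WithLp.toLp 2 fun I =>
  -(1 / 2 : ℝ) * (cov X x ![I 0, I 1] + cov X x ![I 1, I 0] - div1 X x ![] * proj x (I 0) (I 1))

/-- The product `φ γ` of a scalar function with the unit round metric. -/
def mulMetric (φ : TField 0) : TField 2 := fun x => WithLp.toLp 2 fun I =>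
  φ x ![] * proj x (I 0) (I 1)

/-- (Tangential) symmetric 2-tensor fields that are trace-free with respect to the round metric. -/
def IsSTF (V : TField 2) : Prop :=
  ∀ᵐ x ∂σ, IsTangent x (V x) ∧ (∀ i j, V x ![i, j] = V x ![j, i]) ∧ ∑ i, V x ![i, i] = 0

/-! ## Spherical harmonics and mode projections -/

/-- Scalar spherical harmonics of degree `l`, that is the span of the `Y^{(lm)}`, `-l ≤ m ≤ l`: the
restrictions to the sphere of the harmonic homogeneous polynomials of degree `l`. -/
def harm (l : ℕ) : Set (TField 0) :=
  {Y | ∃ p : MvPolynomial (Fin 3) ℝ, p.IsHomogeneous l ∧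
    ∑ i, MvPolynomial.pderiv i (MvPolynomial.pderiv i p) = 0 ∧
    ∀ x I, Y x I = MvPolynomial.eval (fun i => (x : E3) i) p}

/-- Scalar harmonics with degree in `s`. -/
def scalarHarm (s : Set ℕ) : Set (TField 0) := {Y | ∃ l ∈ s, Y ∈ harm l}

/-- 1-form harmonics with degree `l ≥ 1` in `s`, that is the span of the electric
`E^{(lm)} ∼ D₁⋆ (Y^{(lm)}, 0)` and of the magnetic `H^{(lm)} ∼ D₁⋆ (0, Y^{(lm)})`. -/
def formHarm (s : Set ℕ) : Set (TField 1) :=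
  {X | ∃ l ∈ s, 1 ≤ l ∧ ∃ Y ∈ harm l, ∃ Z ∈ harm l, X = D1s Y Z}

/-- Tensor harmonics with degree `l ≥ 2` in `s`, that is the span of the electric
`ψ^{(lm)} ∼ D₂⋆ E^{(lm)}` and of the magnetic `φ^{(lm)} ∼ D₂⋆ H^{(lm)}`. -/
def tensHarm (s : Set ℕ) : Set (TField 2) :=
  {V | ∃ l ∈ s, 2 ≤ l ∧ ∃ Y ∈ harm l, ∃ Z ∈ harm l, V = D2s (D1s Y Z)}

/-- The electric tensor harmonics (multiples and sums of the `ψ^{(lm)}` of one degree `l ≥ 2`). -/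
def elecHarm : Set (TField 2) := {V | ∃ l, 2 ≤ l ∧ ∃ Y ∈ harm l, V = D2s (D1s Y 0)}

/-- The closed linear span in `L²` of a set of fields. -/
def modeSpace {k : ℕ} (A : Set (TField k)) : Submodule ℝ (Lp (Tens k) 2 σ) :=
  (Submodule.span ℝ {F : Lp (Tens k) 2 σ | ∃ W ∈ A, F =ᵐ[σ] W}).topologicalClosure

instance {k : ℕ} (A : Set (TField k)) : CompleteSpace (modeSpace A) :=
  (Submodule.isClosed_topologicalClosure _).completeSpace_coe

open Classical in
/-- The `L²`-orthogonal projection of an `L²` field to the closed linear span of `A`, that is the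
`L²`-convergent sum of its components along an orthonormal basis of that span. -/
def modeProj {k : ℕ} (A : Set (TField k)) (T : TField k) : TField k :=
  if h : MemLp T 2 σ then ⇑((modeSpace A).starProjection (h.toLp T)) else 0

/-- `f^{[s]}`: the part of a scalar function with modes `l ∈ s`. -/
def modes (s : Set ℕ) (f : TField 0) : TField 0 := modeProj (scalarHarm s) f

/-- `X^{[s]}` for a 1-form. -/
def modes1 (s : Set ℕ) (X : TField 1) : TField 1 := modeProj (formHarm s) X

/-- `V^{[s]}` for a symmetric trace-free 2-tensor. -/
def modes2 (s : Set ℕ) (V : TField 2) : TField 2 := modeProj (tensHarm s) V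

/-- The electric part `V_ψ` of a symmetric trace-free 2-tensor. -/
def elec (V : TField 2) : TField 2 := modeProj elecHarm V

/-! ## Linearized sphere data and their charges -/

/-- Linearized sphere data
`(Ω, φ, g_c, (Ω tr χ), χ̂, (Ω tr χ̲), χ̲̂, η, ω, D ω, ω̲, D̲ ω̲, α, α̲)` (all dotted), where the
linearized metric is `2 r φ γ + r² g_c`, with `g_c` trace-free. -/
structure LinData where
  Om : TField 0
  phi : TField 0
  gc : TField 2
  trX : TField 0
  chih : TField 2
  trXb : TField 0
  chibh : TField 2
  eta : TField 1
  om : TField 0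
  Dom : TField 0
  omb : TField 0
  Dbomb : TField 0
  al : TField 2
  alb : TField 2

instance : Add LinData where
  add x y :=
    { Om := x.Om + y.Om
      phi := x.phi + y.phi
      gc := x.gc + y.gc
      trX := x.trX + y.trX
      chih := x.chih + y.chih
      trXb := x.trXb + y.trXb
      chibh := x.chibh + y.chibh
      eta := x.eta + y.eta
      om := x.om + y.om
      Dom := x.Dom + y.Dom
      omb := x.omb + y.omb
      Dbomb := x.Dbomb + y.Dbomb
      al := x.al + y.al
      alb := x.alb + y.alb }

namespace LinData

/-- The linearization `2 r φ γ + r² g_c` of the induced metric. -/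
def metric (r : ℝ) (x : LinData) : TField 2 := (2 * r) • mulMetric x.phi + r ^ 2 • x.gc

/-- The norm of (linearized) sphere data on the round sphere of radius `r`. -/
def norm (r : ℝ) (x : LinData) : ℝ≥0∞ :=
  sobNorm r 6 x.Om + sobNorm r 6 (x.metric r) + sobNorm r 6 x.trX + sobNorm r 6 x.chih
    + sobNorm r 4 x.trXb + sobNorm r 4 x.chibh + sobNorm r 5 x.eta
    + sobNorm r 6 x.om + sobNorm r 6 x.Dom + sobNorm r 4 x.omb + sobNorm r 2 x.Dbomb
    + sobNorm r 6 x.al + sobNorm r 2 x.alb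

/-- The linearized Gauss curvature `(1/(2r²)) div div g_c - (1/r³) (Δ + 2) φ`. -/
def gaussK (r : ℝ) (x : LinData) : TField 0 :=
  (1 / (2 * r ^ 2)) • div1 (div2 x.gc) - (1 / r ^ 3) • (lap x.phi + (2 : ℝ) • x.phi)

/-- The combination `(Ω tr χ) - (4/r) Ω`. -/
def B (r : ℝ) (x : LinData) : TField 0 := x.trX - (4 / r) • x.Om

def Q0 (r : ℝ) (x : LinData) : TField 1 :=
  r ^ 2 • modes1 {1} x.eta + (r ^ 3 / 2) • grad (modes {1} x.trX - (4 / r) • modes {1} x.Om)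

def Q1 (r : ℝ) (x : LinData) : TField 0 := (r / 2) • x.B r + (1 / r) • x.phi

def Q2 (r : ℝ) (x : LinData) : TField 0 :=
  r ^ 2 • x.trXb - (2 / r) • div1 (r ^ 2 • x.eta + (r ^ 3 / 2) • grad (x.B r))
    - r ^ 2 • x.B r + (2 * r ^ 3) • x.gaussK r

def Q3 (r : ℝ) (x : LinData) : TField 2 :=
  (1 / r) • x.chibh - (1 / 2 : ℝ) • (D2s (div2 x.gc) + x.gc)
    + D2s (x.eta + (r / 2) • grad (x.B r)) - r • D2s (grad (x.B r))

def Q4 (r : ℝ) (x : LinData) : TField 2 :=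
  (1 / r) • elec x.alb
    + (2 : ℝ) • elec (D2s ((1 / r ^ 2) • div2 x.chibh - (1 / r) • x.eta
        - (1 / 2 : ℝ) • grad x.trXb + D1s x.omb 0))

def Q5 (r : ℝ) (x : LinData) : TField 0 :=
  modes {l | l ≤ 1} x.omb + (1 / (4 * r ^ 2)) • modes {l | l ≤ 1} (x.Q2 r)
    + (1 / (3 * r ^ 3)) • div1 (x.Q0 r)

def Q6 (r : ℝ) (x : LinData) : TField 0 :=
  modes {l | l ≤ 1} x.Dbomb
    - (1 / (6 * r ^ 3)) • (lap (modes {l | l ≤ 1} (x.Q2 r)) - (3 : ℝ) • modes {l | l ≤ 1} (x.Q2 r))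
    + (1 / r ^ 4) • div1 (x.Q0 r)

def Q7 (r : ℝ) (x : LinData) : TField 0 :=
  modes {2} x.Dbomb + (3 / (2 * r ^ 3)) • modes {2} (x.Q2 r)
    + (1 / (2 * r ^ 2)) • div1 (div2 (modes2 {2} (x.Q3 r)))
    - (12 / r ^ 2) • modes {2} (x.Q1 r)
    + (3 / (2 * r ^ 2)) • modes {2} (div1 (x.eta + (r / 2) • grad (x.B r)))
    - (3 / (4 * r ^ 2)) • modes {2} (div1 (div2 x.gc))

end LinData

/-! ## Linearized perturbations of sphere data at Minkowski -/

/-- A linearized transversal perturbation function `(f, ∂_u f, ∂_u² f, ∂_u³ f)` at `u = 0`. -/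
structure TransFun where
  f : TField 0
  f_u : TField 0
  f_uu : TField 0
  f_uuu : TField 0

namespace TransFun

/-- The norm of a transversal perturbation function (with respect to the unit round metric). -/
def norm (f : TransFun) : ℝ≥0∞ :=
  sobNorm 1 8 f.f + sobNorm 1 6 f.f_u + sobNorm 1 4 f.f_uu + sobNorm 1 2 f.f_uuu

/-- `∂_u (f / r)`, where `∂_u r = -1`. -/
def duQuot (r : ℝ) (f : TransFun) : TField 0 := (1 / r) • f.f_u + (1 / r ^ 2) • f.f

/-- The linearized transversal perturbation of the Minkowski sphere data of radius `r`. -/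
def pert (r : ℝ) (f : TransFun) : LinData where
  Om := (1 / 2 : ℝ) • f.f_u
  phi := - f.f
  gc := 0
  trX := (2 / r ^ 2) • (lap f.f + f.f)
  chih := (-2 : ℝ) • D2s (grad f.f)
  trXb := (-2 : ℝ) • f.duQuot r
  chibh := 0
  eta := r • grad (f.duQuot r)
  om := 0
  Dom := 0
  omb := (1 / 2 : ℝ) • f.f_uu
  Dbomb := (1 / 2 : ℝ) • f.f_uuu
  al := 0
  alb := 0

end TransFun

/-- The norm of a linearized angular perturbation, a tangential vector field `j = j^A ∂_A` on the unit
sphere. -/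
def angNorm (j : TField 1) : ℝ≥0∞ := sobNorm 1 7 j

/-- The linearized angular perturbation of the Minkowski sphere data of radius `r` along the vector
field `j`, that is the linearization of the change of coordinates `θ^A ↦ θ^A + j^A`: the metric
changes by `r²` times the Lie derivative `(div j) γ - 2 D₂⋆ j` of `γ`, and nothing else changes. In
terms of potentials, `j = - D₁⋆ (q₁, q₂)`, this reads `φ = (r/2) Δ q₁` and
`g_c = 2 D₂⋆ D₁⋆ (q₁, q₂)`. -/
def angPert (r : ℝ) (j : TField 1) : LinData where
  Om := 0
  phi := (r / 2) • div1 j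
  gc := (-2 : ℝ) • D2s j
  trX := 0
  chih := 0
  trXb := 0
  chibh := 0
  eta := 0
  om := 0
  Dom := 0
  omb := 0
  Dbomb := 0
  al := 0
  alb := 0

end CharGluing

end

open CharGluing

noncomputable section

namespace CharGluing

/-! ## The algebra of smooth functions on the sphere -/

/-! In spherical harmonics every operator in the charges acts by multiplication by a function of λ =
l(l+1), so the proposition becomes a small linear system in each degree. Let φ, u, v, w be the modes
of f, f_u, f_uu, f_uuu, and write j = D₁⋆(a, b). For r = 2, `PertModes.hm_Q0` to `PertModes.hm_Q7`
give: Q0 = 0, Q2 = -2λ(λ-2)φ, Q1 = (λ/2)(a-φ) - u, Q3 = D₂⋆D₁⋆((λ/2)(a-φ) - 2u, (λ/2)b), Q4 =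
D₂⋆D₁⋆(v, 0); in degrees at most 1, Q5 = v/2 and Q6 = w/2; in degree 2, Q7 is w/2 plus terms in φ,
u, a. The factor λ(λ-2) vanishes exactly in degrees 0 and 1, which is the invariance of Q2 there. In
degrees at least 2 the system is triangular: Q2 fixes φ, then Q1 and Q3 fix u, a, b, and Q4 fixes v.
Degrees 0 and 1 of u, v, w come from Q1, Q5, Q6, and degree 2 of w from Q7. The remaining modes are
set to zero. Dividing by λ(λ-2) gains four derivatives, dividing by λ gains two, and the potentials
of a 2-tensor are two derivatives smoother than the tensor. These gains match the orders in the
norms.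

The operators are weak, so this calculus has to be justified on L². The tool is the Casimir operator
`cas`, minus the sum of the rough Laplacian and the square of the right-angle rotation `J`. It
commutes with covariant differentiation (`cas_covA`), with traces and with `J`, so all operators
preserve its eigenspaces `E k l`. Eigentensors of different degree are orthogonal, and ‖∇T‖² + ‖JT‖²
= λ‖T‖² on `E k l`. Hence weak derivatives act termwise on expansions (`HasModes.of_isWeakCov`), and
the H^m norm is equivalent to the weighted sum `energy` (`exists_sobNorm_le`, `exists_energy_le`).

Completeness comes from polynomials. Polynomial functions on the sphere are sums of harmonics;
polynomial 1-forms and symmetric tracefree 2-tensors are sums of D₁⋆ and D₂⋆D₁⋆ of harmonics, by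
explicit potentials (`smul_dX_mem`, `mem_iSup_tensA`). Stone-Weierstrass then gives density in L²,
so every field of finite norm has an expansion of the required form. -/

lemma norm_inv_smul_mem {y : E3} (h : y ≠ 0) : ‖y‖⁻¹ • y ∈ Metric.sphere (0 : E3) 1 := by
  simp [norm_smul, inv_mul_cancel₀ (norm_ne_zero_iff.mpr h)]

/-- Extension of a function on the sphere, constant along rays. -/
def ext (f : S2 → ℝ) : E3 → ℝ := fun y =>
  if h : y = 0 then 0 else f ⟨‖y‖⁻¹ • y, norm_inv_smul_mem h⟩

lemma ext_of_ne {f : S2 → ℝ} {y : E3} (h : y ≠ 0) :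
    ext f y = f ⟨‖y‖⁻¹ • y, norm_inv_smul_mem h⟩ := dif_neg h

lemma sphere_ne_zero (x : S2) : (x : E3) ≠ 0 := by
  intro h
  have := x.2
  simp [h] at this

lemma sphere_norm (x : S2) : ‖(x : E3)‖ = 1 := by simp

lemma ext_coe (f : S2 → ℝ) (x : S2) : ext f x = f x := by
  rw [ext_of_ne (sphere_ne_zero x)]
  congr
  simp

lemma ext_smul (f : S2 → ℝ) {c : ℝ} (hc : 0 < c) (y : E3) : ext f (c • y) = ext f y := by
  by_cases h : y = 0
  · simp [h]
  · have h' : c • y ≠ 0 := smul_ne_zero hc.ne' h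
    rw [ext_of_ne h, ext_of_ne h']
    congr 2
    rw [norm_smul, Real.norm_of_nonneg hc.le, smul_smul]
    congr 1
    field_simp

lemma ext_add (f g : S2 → ℝ) : ext (f + g) = ext f + ext g := by
  ext y; by_cases h : y = 0 <;> simp [ext, h]

lemma ext_mul (f g : S2 → ℝ) : ext (f * g) = ext f * ext g := by
  ext y; by_cases h : y = 0 <;> simp [ext, h]

lemma isOpen_punctured : IsOpen ({0}ᶜ : Set E3) := isOpen_compl_singleton

/-- The smooth functions on the sphere. -/
def smoothFn : Subalgebra ℝ (S2 → ℝ) where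
  carrier := {f | ContDiffOn ℝ ((⊤ : ℕ∞) : WithTop ℕ∞) (ext f) {0}ᶜ}
  mul_mem' {f g} hf hg := by
    simp only [Set.mem_ofPred_eq, ext_mul] at *
    exact ContDiffOn.mul hf hg
  add_mem' {f g} hf hg := by
    simp only [Set.mem_ofPred_eq, ext_add] at *
    exact ContDiffOn.add hf hg
  algebraMap_mem' c := by
    refine (contDiffOn_const (c := c)).congr fun y hy => ?_
    rw [ext_of_ne hy]; rfl

/-- Smooth functions, as a ring. -/
def SF : Type := ↥smoothFn

namespace SF

instance : CommRing SF := inferInstanceAs (CommRing ↥smoothFn)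
instance : Algebra ℝ SF := inferInstanceAs (Algebra ℝ ↥smoothFn)

@[ext] lemma ext_val {f g : SF} (h : ∀ x, f.1 x = g.1 x) : f = g := Subtype.ext (funext h)

@[simp] lemma val_add (f g : SF) : (f + g).1 = f.1 + g.1 := rfl
@[simp] lemma val_sub (f g : SF) : (f - g).1 = f.1 - g.1 := rfl
@[simp] lemma val_mul (f g : SF) : (f * g).1 = f.1 * g.1 := rfl
@[simp] lemma val_neg (f : SF) : (-f).1 = -f.1 := rfl
@[simp] lemma val_smul (c : ℝ) (f : SF) : (c • f).1 = c • f.1 := rfl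
@[simp] lemma val_zero : (0 : SF).1 = 0 := rfl
@[simp] lemma val_one : (1 : SF).1 = 1 := rfl

@[simp] lemma val_sum {ι : Type*} (s : Finset ι) (f : ι → SF) :
    (∑ i ∈ s, f i).1 = ∑ i ∈ s, (f i).1 :=
  map_sum (smoothFn.val) f s

end SF

lemma SF.contDiffOn (f : SF) : ContDiffOn ℝ ((⊤ : ℕ∞) : WithTop ℕ∞) (ext f.1) {0}ᶜ := f.2

lemma SF.contDiffAt (f : SF) {y : E3} (hy : y ≠ 0) :
    ContDiffAt ℝ ((⊤ : ℕ∞) : WithTop ℕ∞) (ext f.1) y :=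
  f.contDiffOn.contDiffAt (isOpen_punctured.mem_nhds hy)

lemma SF.differentiableAt (f : SF) {y : E3} (hy : y ≠ 0) : DifferentiableAt ℝ (ext f.1) y :=
  (f.contDiffAt hy).differentiableAt (by simp)

lemma fderiv_ext_smul (f : S2 → ℝ) {c : ℝ} (hc : 0 < c) (y : E3) :
    fderiv ℝ (ext f) y = c • fderiv ℝ (ext f) (c • y) := by
  have h := fderiv_comp_smul (𝕜 := ℝ) (f := ext f) (x := y) c
  rw [← h]
  congr 1
  ext z
  exact (ext_smul f hc z).symm

/-- The standard basis vectors. -/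
abbrev e3 (i : Fin 3) : E3 := EuclideanSpace.single i 1

/-- The function underlying the tangential derivative in direction `i`. -/
def Dfun (i : Fin 3) (f : S2 → ℝ) : S2 → ℝ := fun x => fderiv ℝ (ext f) (x : E3) (e3 i)

/-- The extension is homogeneous of degree 0, so its derivative has degree -1, and the factor ‖y‖
restores degree 0. This factor gives smoothness of `Dfun i f` and is the source of the first-order
terms in `D_comm`. -/
lemma ext_Dfun (i : Fin 3) (f : S2 → ℝ) {y : E3} (hy : y ≠ 0) :
    ext (Dfun i f) y = ‖y‖ * fderiv ℝ (ext f) y (e3 i) := by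
  have hn : 0 < ‖y‖ := norm_pos_iff.mpr hy
  rw [ext_of_ne hy, Dfun, fderiv_ext_smul f (inv_pos.mpr hn) y]
  simp only [smul_apply, smul_eq_mul]
  rw [← mul_assoc, mul_inv_cancel₀ hn.ne', one_mul]

lemma contDiffOn_fderiv_ext (f : SF) (v : E3) :
    ContDiffOn ℝ ((⊤ : ℕ∞) : WithTop ℕ∞) (fun y => fderiv ℝ (ext f.1) y v) {0}ᶜ :=
  (f.contDiffOn.fderiv_of_isOpen isOpen_punctured (by simp)).clm_apply contDiffOn_const

lemma contDiffOn_norm_punctured :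
    ContDiffOn ℝ ((⊤ : ℕ∞) : WithTop ℕ∞) (fun y : E3 => ‖y‖) {0}ᶜ :=
  fun _ hy => (contDiffAt_norm ℝ hy).contDiffWithinAt

lemma Dfun_mem (i : Fin 3) (f : SF) : Dfun i f.1 ∈ smoothFn := by
  refine (contDiffOn_norm_punctured.mul (contDiffOn_fderiv_ext f (e3 i))).congr fun y hy => ?_
  exact ext_Dfun i f.1 hy

lemma Dfun_mul (i : Fin 3) (f g : SF) :
    Dfun i (f.1 * g.1) = f.1 * Dfun i g.1 + g.1 * Dfun i f.1 := by
  ext x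
  have hx := sphere_ne_zero x
  simp only [Dfun, ext_mul, Pi.add_apply, Pi.mul_apply]
  rw [fderiv_mul (f.differentiableAt hx) (g.differentiableAt hx)]
  simp [ext_coe]

/-- The tangential derivative in direction `i`, as a derivation of the smooth functions. -/
def D (i : Fin 3) : Derivation ℝ SF SF := Derivation.mk'
  { toFun := fun f => ⟨Dfun i f.1, Dfun_mem i f⟩
    map_add' := fun f g => by
      ext x
      have hx := sphere_ne_zero x
      simp only [Dfun, SF.val_add]
      rw [ext_add, fderiv_add (f.differentiableAt hx) (g.differentiableAt hx)]
      rfl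
    map_smul' := fun c f => by
      ext x
      have hx := sphere_ne_zero x
      have : ext (c • f.1) = c • ext f.1 := by
        ext y; by_cases h : y = 0 <;> simp [ext, h]
      simp only [Dfun, SF.val_smul, RingHom.id_apply]
      rw [this, fderiv_const_smul (f.differentiableAt hx)]
      rfl }
  (fun f g => by
    ext x
    exact congrFun (Dfun_mul i f g) x)

lemma D_apply (i : Fin 3) (f : SF) (x : S2) :
    (D i f).1 x = fderiv ℝ (ext f.1) (x : E3) (e3 i) := rfl

/-- The coordinate functions. -/
def X (i : Fin 3) : SF := ⟨fun x => (x : E3) i, by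
  refine (ContDiffOn.mul (f := fun y : E3 => ‖y‖⁻¹) (g := fun y : E3 => y i)
    (contDiffOn_norm_punctured.inv fun y hy => norm_ne_zero_iff.mpr hy)
    ?_).congr fun y hy => ?_
  · fun_prop
  · rw [ext_of_ne hy]; simp⟩

@[simp] lemma X_apply (i : Fin 3) (x : S2) : (X i).1 x = (x : E3) i := rfl

lemma sum_X_sq : ∑ i, X i * X i = 1 := by
  ext x
  have h := sphere_norm x
  rw [EuclideanSpace.norm_eq, Real.sqrt_eq_one] at h
  simp only [Real.norm_eq_abs, sq_abs, Fin.sum_univ_three] at h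
  simp [Fin.sum_univ_three]
  nlinarith [h]

lemma fderiv_ext_self (f : SF) (x : S2) : fderiv ℝ (ext f.1) (x : E3) (x : E3) = 0 := by
  have hx := sphere_ne_zero x
  have h1 : HasDerivAt (fun t : ℝ => ext f.1 (t • (x : E3)))
      (fderiv ℝ (ext f.1) (x : E3) (x : E3)) 1 := by
    have := (f.differentiableAt hx).hasFDerivAt
    have h2 : HasDerivAt (fun t : ℝ => t • (x : E3)) (x : E3) 1 := by
      simpa using (hasDerivAt_id (1 : ℝ)).smul_const (x : E3)
    have h3 : HasFDerivAt (ext f.1) (fderiv ℝ (ext f.1) (x : E3)) ((1 : ℝ) • (x : E3)) := by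
      simpa using this
    exact h3.comp_hasDerivAt 1 h2
  have h2 : HasDerivAt (fun t : ℝ => ext f.1 (t • (x : E3))) 0 1 := by
    refine (hasDerivAt_const (1 : ℝ) (ext f.1 x)).congr_of_eventuallyEq ?_
    filter_upwards [lt_mem_nhds (zero_lt_one' ℝ)] with t ht
    exact ext_smul f.1 ht _
  exact h1.unique h2

lemma fderiv_apply_eq_sum (f : S2 → ℝ) (y v : E3) :
    fderiv ℝ (ext f) y v = ∑ i, v i * fderiv ℝ (ext f) y (e3 i) := by
  conv_lhs => rw [show v = ∑ i, v i • e3 i from by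
    ext j; simp [Finset.sum_apply, Pi.single_apply]]
  simp [map_sum]

lemma sum_X_D (f : SF) : ∑ i, X i * D i f = 0 := by
  ext x
  have := fderiv_apply_eq_sum f.1 x x
  rw [fderiv_ext_self] at this
  simp only [Fin.sum_univ_three] at this ⊢
  simpa [D_apply] using this.symm

/-- The components of the projection to the tangent plane. -/
def P (i j : Fin 3) : SF := (if i = j then 1 else 0) - X i * X j

lemma hasFDerivAt_norm_sphere (x : S2) :
    HasFDerivAt (fun y : E3 => ‖y‖) (innerSL ℝ (x : E3)) (x : E3) := by
  have h3 : HasFDerivAt (fun y : E3 => Real.sqrt (‖y‖ ^ 2))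
      ((1 / (2 * Real.sqrt (‖(x : E3)‖ ^ 2))) • (2 • (innerSL ℝ (x : E3)))) (x : E3) :=
    (hasStrictFDerivAt_norm_sq (x : E3)).hasFDerivAt.sqrt (by simp)
  simp only [Real.sqrt_sq (norm_nonneg _), sphere_norm] at h3
  convert! h3 using 1
  ext v
  simp

lemma D_X (i j : Fin 3) : D i (X j) = P i j := by
  ext x
  have hx := sphere_ne_zero x
  rw [D_apply]
  have h1 : HasFDerivAt (fun y : E3 => ‖y‖⁻¹ * y j)
      (‖(x : E3)‖⁻¹ • (EuclideanSpace.proj j : E3 →L[ℝ] ℝ)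
        + (x : E3) j • (-(innerSL ℝ (x : E3)))) (x : E3) := by
    have hn : HasFDerivAt (fun y : E3 => ‖y‖⁻¹) (-(innerSL ℝ (x : E3))) (x : E3) := by
      have h4 := (hasDerivAt_inv (x := ‖(x : E3)‖) (by simp)).comp_hasFDerivAt (x : E3)
        (hasFDerivAt_norm_sphere x)
      convert! h4 using 1
      simp
    exact hn.mul (EuclideanSpace.proj j : E3 →L[ℝ] ℝ).hasFDerivAt
  have h2 : ext (X j).1 =ᶠ[𝓝 (x : E3)] fun y : E3 => ‖y‖⁻¹ * y j := by
    filter_upwards [isOpen_punctured.mem_nhds hx] with y hy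
    rw [ext_of_ne hy]; simp
  rw [h2.fderiv_eq, h1.fderiv]
  by_cases h : i = j
  · subst h; simp [P, EuclideanSpace.inner_single_right, sub_eq_add_neg]
  · simp [P, h, Ne.symm h, EuclideanSpace.inner_single_right, mul_comm]

/-- Differentiating ‖y‖ ∂_j f at a unit vector gives X_i D_j f plus the Euclidean Hessian of the
extension. The Hessian is symmetric, so only the derivative of the norm survives in the commutator.
-/
lemma D_comm (i j : Fin 3) (f : SF) :
    D i (D j f) - D j (D i f) = X i * D j f - X j * D i f := by
  have key : ∀ (i j : Fin 3) (x : S2), (D i (D j f)).1 x = (x : E3) i * (D j f).1 x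
      + fderiv ℝ (fderiv ℝ (ext f.1)) (x : E3) (e3 i) (e3 j) := by
    intro i j x
    have hx := sphere_ne_zero x
    rw [D_apply]
    have h2 : ext (D j f).1 =ᶠ[𝓝 (x : E3)]
        fun y : E3 => ‖y‖ * fderiv ℝ (ext f.1) y (e3 j) := by
      filter_upwards [isOpen_punctured.mem_nhds hx] with y hy
      exact ext_Dfun j f.1 hy
    have h4 : DifferentiableAt ℝ (fderiv ℝ (ext f.1)) (x : E3) :=
      ((f.contDiffAt hx).fderiv_right (m := 1) (by norm_cast)).differentiableAt (by simp)
    have h5 := (hasFDerivAt_norm_sphere x).fun_mul (h4.hasFDerivAt.clm_apply (hasFDerivAt_const (e3 j) (x : E3)))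
    rw [h2.fderiv_eq, h5.fderiv]
    simp [EuclideanSpace.inner_single_right, D_apply]
    ring
  ext x
  have hsym : fderiv ℝ (fderiv ℝ (ext f.1)) (x : E3) (e3 i) (e3 j)
      = fderiv ℝ (fderiv ℝ (ext f.1)) (x : E3) (e3 j) (e3 i) :=
    ((f.contDiffAt (sphere_ne_zero x)).isSymmSndFDerivAt (by simp; norm_cast)).eq _ _
  have h1 := key i j x
  have h2 := key j i x
  simp at h1 h2 ⊢
  rw [h1, h2, hsym]
  ring

/-! ## Integration over the sphere -/

instance : IsFiniteMeasure σ := inferInstanceAs (IsFiniteMeasure (volume : Measure E3).toSphere)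

instance : σ.IsOpenPosMeasure :=
  inferInstanceAs ((volume : Measure E3).toSphere).IsOpenPosMeasure

lemma SF.continuous (f : SF) : Continuous f.1 := by
  have h : f.1 = fun x : S2 => ext f.1 (x : E3) := by
    ext x; exact (ext_coe f.1 x).symm
  rw [h]
  exact f.contDiffOn.continuousOn.comp_continuous continuous_subtype_val
    fun x => sphere_ne_zero x

lemma SF.integrable (f : SF) : Integrable f.1 σ :=
  f.continuous.integrable_of_hasCompactSupport (HasCompactSupport.of_compactSpace _)

lemma SF.exists_bound (f : SF) : ∃ c : ℝ, 0 ≤ c ∧ ∀ x, |f.1 x| ≤ c := by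
  obtain ⟨c, hc⟩ := isCompact_univ.exists_bound_of_continuousOn f.continuous.continuousOn
  exact ⟨|c|, abs_nonneg _, fun x => (hc x trivial).trans (le_abs_self c)⟩

/-- Integration of smooth functions. -/
def integ : SF →ₗ[ℝ] ℝ where
  toFun f := ∫ x, f.1 x ∂σ
  map_add' f g := integral_add f.integrable g.integrable
  map_smul' c _ := integral_const_mul c _

lemma integ_apply (f : SF) : integ f = ∫ x, f.1 x ∂σ := rfl

/-- The action of a linear isometry on the sphere. -/
def sphereMap (g : E3 ≃ₗᵢ[ℝ] E3) (x : S2) : S2 := ⟨g x, by simp⟩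

lemma continuous_sphereMap (g : E3 ≃ₗᵢ[ℝ] E3) : Continuous (sphereMap g) :=
  (g.continuous.comp continuous_subtype_val).subtype_mk _

-- The surface measure of a set is, up to a constant factor, the volume of the cone over it. A
-- linear isometry commutes with coning and preserves volume.
open scoped Pointwise in
lemma measurePreserving_sphereMap (g : E3 ≃ₗᵢ[ℝ] E3) : MeasurePreserving (sphereMap g) σ σ := by
  refine ⟨(continuous_sphereMap g).measurable, ?_⟩
  ext s hs
  rw [Measure.map_apply (continuous_sphereMap g).measurable hs, σ,
    Measure.toSphere_apply' _ ((continuous_sphereMap g).measurable hs),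
    Measure.toSphere_apply' _ hs]
  congr 1
  rw [← g.symm.measurePreserving.measure_preimage_equiv (f := g.symm.toMeasurableEquiv)]
  congr 1
  ext y
  simp only [Set.mem_smul, Set.mem_image, Set.mem_preimage]
  constructor
  · rintro ⟨c, hc, z, ⟨x, hx, rfl⟩, h⟩
    refine ⟨c, hc, g x, ⟨_, hx, rfl⟩, ?_⟩
    rw [← g.map_smul, h]
    exact g.apply_symm_apply y
  · rintro ⟨c, hc, z, ⟨x, hx, rfl⟩, rfl⟩
    refine ⟨c, hc, g.symm x, ⟨⟨g.symm x, by simp⟩, ?_, rfl⟩, ?_⟩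
    · simpa [sphereMap] using hx
    · exact (g.symm.map_smul c _).symm

/-- The rotation by the angle `t` in a coordinate plane, as a linear map. -/
def rotLin (i j : Fin 3) (t : ℝ) : E3 →ₗ[ℝ] E3 where
  toFun y := y + ((Real.cos t - 1) * y i - Real.sin t * y j) • e3 i
    + (Real.sin t * y i + (Real.cos t - 1) * y j) • e3 j
  map_add' y z := by ext k; simp; split_ifs <;> ring
  map_smul' c y := by ext k; simp; split_ifs <;> ring

lemma norm_rotLin {i j : Fin 3} (hij : i ≠ j) (t : ℝ) (y : E3) : ‖rotLin i j t y‖ = ‖y‖ := by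
  rw [EuclideanSpace.norm_eq, EuclideanSpace.norm_eq]
  congr 1
  simp only [Real.norm_eq_abs, sq_abs, Fin.sum_univ_three]
  have := Real.sin_sq_add_cos_sq t
  fin_cases i <;> fin_cases j <;> simp [rotLin] at hij ⊢ <;>
    first
    | linear_combination (y 0 ^ 2 + y 1 ^ 2) * this
    | linear_combination (y 1 ^ 2 + y 2 ^ 2) * this
    | linear_combination (y 0 ^ 2 + y 2 ^ 2) * this

/-- The rotation by the angle `t` in a coordinate plane. -/
def rot {i j : Fin 3} (hij : i ≠ j) (t : ℝ) : E3 ≃ₗᵢ[ℝ] E3 :=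
  LinearIsometry.toLinearIsometryEquiv ⟨rotLin i j t, norm_rotLin hij t⟩ rfl

lemma rot_apply {i j : Fin 3} (hij : i ≠ j) (t : ℝ) (y : E3) :
    rot hij t y = y + ((Real.cos t - 1) * y i - Real.sin t * y j) • e3 i
    + (Real.sin t * y i + (Real.cos t - 1) * y j) • e3 j := rfl

lemma hasDerivAt_rot {i j : Fin 3} (hij : i ≠ j) (t : ℝ) (y : E3) :
    HasDerivAt (fun t => rot hij t y)
      ((- (rot hij t y) j) • e3 i + ((rot hij t y) i) • e3 j) t := by
  have h1 : HasDerivAt (fun t => (Real.cos t - 1) * y i - Real.sin t * y j)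
      (- (rot hij t y) j) t := by
    have := (((Real.hasDerivAt_cos t).sub_const 1).mul_const (y i)).sub
      ((Real.hasDerivAt_sin t).mul_const (y j))
    convert! this using 1
    rw [rot_apply]
    simp [hij.symm]
    ring
  have h2 : HasDerivAt (fun t => Real.sin t * y i + (Real.cos t - 1) * y j)
      ((rot hij t y) i) t := by
    have := ((Real.hasDerivAt_sin t).mul_const (y i)).add
      (((Real.hasDerivAt_cos t).sub_const 1).mul_const (y j))
    convert! this using 1
    rw [rot_apply]
    simp [hij]
    ring
  have h3 := ((hasDerivAt_const t y).add (h1.smul_const (e3 i))).add (h2.smul_const (e3 j))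
  convert! h3 using 1
  simp

/-- The integrand is the derivative of f along the rotations of the (i, j)-plane. The integral of f
composed with a rotation does not depend on the angle, and it may be differentiated under the
integral sign. -/
lemma integ_rotation {i j : Fin 3} (hij : i ≠ j) (f : SF) :
    integ (X i * D j f - X j * D i f) = 0 := by
  set R := X i * D j f - X j * D i f with hR
  have hder : ∀ (t : ℝ) (x : S2), HasDerivAt (fun t => f.1 (sphereMap (rot hij t) x))
      (R.1 (sphereMap (rot hij t) x)) t := by
    intro t x
    set y := sphereMap (rot hij t) x with hy
    have h1 := (f.differentiableAt (sphere_ne_zero y)).hasFDerivAt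
    have h2 := h1.comp_hasDerivAt t (hasDerivAt_rot hij t x)
    have h3 : (fun t => f.1 (sphereMap (rot hij t) x)) = ext f.1 ∘ fun t => rot hij t x := by
      ext s
      exact (ext_coe f.1 _).symm
    rw [h3]
    convert! h2 using 1
    simp only [hR, map_add, map_smul]
    simp [D_apply, hy, sphereMap]
    ring
  obtain ⟨c, hc, hb⟩ := R.exists_bound
  have key := hasDerivAt_integral_of_dominated_loc_of_deriv_le (μ := σ) (𝕜 := ℝ)
    (F := fun t x => f.1 (sphereMap (rot hij t) x))
    (F' := fun t x => R.1 (sphereMap (rot hij t) x)) (x₀ := 0) (s := Set.univ)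
    (bound := fun _ => c) Filter.univ_mem
    (Eventually.of_forall fun t =>
      (f.continuous.comp (continuous_sphereMap _)).aestronglyMeasurable)
    (((f.continuous.comp (continuous_sphereMap _))).integrable_of_hasCompactSupport
      (HasCompactSupport.of_compactSpace _))
    ((R.continuous.comp (continuous_sphereMap _)).aestronglyMeasurable)
    (Eventually.of_forall fun x t _ => by simpa using hb _)
    (integrable_const c)
    (Eventually.of_forall fun x t _ => hder t x)
  have hinv : ∀ (g : SF) (t : ℝ), ∫ x, g.1 (sphereMap (rot hij t) x) ∂σ = ∫ x, g.1 x ∂σ := by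
    intro g t
    have hm := measurePreserving_sphereMap (rot hij t)
    have := integral_map (μ := σ) hm.measurable.aemeasurable (f := g.1)
      (g.continuous.aestronglyMeasurable)
    rw [hm.map_eq] at this
    exact this.symm
  have h1 := key.2
  simp only [hinv] at h1
  rw [integ_apply]
  exact h1.unique (hasDerivAt_const _ _)

/-- Rotation invariance is applied to X_j f and summed over j. Since ∑ X_j² = 1 and ∑ X_j D_j = 0,
the fields X_j(X_j D_i - X_i D_j) add up to D_i; differentiating the weights X_j leaves the mean
curvature term 2 X_i. -/
lemma integ_D (i : Fin 3) (f : SF) : integ (D i f) = 2 * integ (X i * f) := by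
  have h0 : ∀ j, integ (X j * D i (X j * f) - X i * D j (X j * f)) = 0 := by
    intro j
    by_cases h : j = i
    · subst h; simp
    · exact integ_rotation h _
  have h1 : ∑ j, (X j * D i (X j * f) - X i * D j (X j * f)) = D i f - 2 * (X i * f) := by
    have h2 : ∀ j, X j * D i (X j * f) - X i * D j (X j * f)
        = (X j * X j) * D i f - X i * X j * D j f + (X j * P i j - X i * P j j) * f := by
      intro j
      simp only [Derivation.leibniz, D_X, smul_eq_mul]
      ring
    rw [Finset.sum_congr rfl fun j _ => h2 j, Finset.sum_add_distrib, Finset.sum_sub_distrib,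
      ← Finset.sum_mul, ← Finset.sum_mul, sum_X_sq]
    have h3 : ∑ j, X i * X j * D j f = 0 := by
      simp only [mul_assoc, ← Finset.mul_sum, sum_X_D, mul_zero]
    have h4 : ∑ j, (X j * P i j - X i * P j j) = - 2 * X i := by
      have h5 : ∀ j, X j * P i j - X i * P j j = (if i = j then X j else 0) - X i := by
        intro j
        rw [P, P, if_pos rfl]
        split_ifs <;> ring
      rw [Finset.sum_congr rfl fun j _ => h5 j]
      simp [Finset.sum_sub_distrib]
      ring
    rw [h3, h4]
    ring
  have h2 := congrArg integ h1
  rw [map_sum, Finset.sum_eq_zero fun j _ => h0 j, map_sub] at h2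
  have h3 : integ (2 * (X i * f)) = 2 * integ (X i * f) := by
    rw [two_mul, map_add]; ring
  rw [h3] at h2
  linarith

section

/-! ## The calculus of smooth tensors -/

/-- Smooth tensors on the sphere with components in `ℝ³`. -/
abbrev Tn (k : ℕ) := (Fin k → Fin 3) → SF

/-- The components of the area form. -/
def eps (i j : Fin 3) : SF :=
  if j = i + 1 then X (i + 2) else if j = i + 2 then - X (i + 1) else 0

section GenericIdentities

variable {R : Type*} [CommRing R] (x : Fin 3 → R)

/-- The cross product matrix of a vector. -/
def crossMat (i j : Fin 3) : R :=
  if j = i + 1 then x (i + 2) else if j = i + 2 then - x (i + 1) else 0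

/-- The complement of the dyadic square of a vector. -/
def complMat (i j : Fin 3) : R := (if i = j then 1 else 0) - x i * x j

lemma crossMat_anti (i j : Fin 3) : crossMat x j i = - crossMat x i j := by
  fin_cases i <;> fin_cases j <;> simp [crossMat]

lemma crossMat_self (i : Fin 3) : crossMat x i i = 0 := by
  fin_cases i <;> simp [crossMat]

lemma sum_crossMat_mul (i : Fin 3) : ∑ j, crossMat x i j * x j = 0 := by
  fin_cases i <;> simp [crossMat, Fin.sum_univ_three] <;> ring

variable {x}

/-- This is the determinant identity for the area form of the plane orthogonal to a unit vector.
Over an arbitrary commutative ring it is a polynomial identity in three entries modulo ∑ x_i² = 1,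
checked entry by entry. -/
lemma crossMat_mul_crossMat  (h : ∑ i, x i * x i = 1) (i j m n : Fin 3) : crossMat x i j * crossMat x m n
    = complMat x i m * complMat x j n - complMat x i n * complMat x j m := by
  rw [Fin.sum_univ_three] at h
  fin_cases i <;> fin_cases j <;> fin_cases m <;> fin_cases n <;>
    simp [crossMat, complMat] <;> grind

lemma sum_crossMat_crossMat  (h : ∑ i, x i * x i = 1) (i j : Fin 3) :
    ∑ m, crossMat x i m * crossMat x m j = - complMat x i j := by
  rw [Fin.sum_univ_three] at h
  fin_cases i <;> fin_cases j <;> simp [crossMat, complMat, Fin.sum_univ_three] <;> grind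

lemma crossMat_parallel  (h : ∑ i, x i * x i = 1) (i j k : Fin 3) :
    (if k = j + 1 then complMat x i (j + 2) else if k = j + 2 then - complMat x i (j + 1) else 0)
      = - (x j * crossMat x i k) - x k * crossMat x j i := by
  rw [Fin.sum_univ_three] at h
  fin_cases i <;> fin_cases j <;> fin_cases k <;> simp [crossMat, complMat] <;> grind

end GenericIdentities

lemma eps_anti (i j : Fin 3) : eps j i = - eps i j := crossMat_anti X i j

lemma eps_self (i : Fin 3) : eps i i = 0 := crossMat_self X i

lemma sum_eps_X (i : Fin 3) : ∑ j, eps i j * X j = 0 := sum_crossMat_mul X i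

lemma eps_mul_eps (i j m n : Fin 3) :
    eps i j * eps m n = P i m * P j n - P i n * P j m := crossMat_mul_crossMat sum_X_sq i j m n

lemma sum_eps_eps (i j : Fin 3) : ∑ m, eps i m * eps m j = - P i j :=
  sum_crossMat_crossMat sum_X_sq i j

/-- The area form is parallel: the right-hand side is minus the two correction terms that `cd i`
would add. -/
lemma D_eps (i j k : Fin 3) : D i (eps j k) = - (X j * eps i k) - X k * eps j i := by
  refine Eq.trans ?_ (crossMat_parallel sum_X_sq i j k)
  rw [eps]
  split_ifs
  · exact D_X i _
  · rw [map_neg, D_X]; rfl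
  · exact map_zero _

lemma P_symm (i j : Fin 3) : P i j = P j i := by
  simp only [P, eq_comm, mul_comm]

lemma sum_P_X (i : Fin 3) : ∑ j, P i j * X j = 0 := by
  have : ∀ j, P i j * X j = (if i = j then X j else 0) - X i * (X j * X j) := by
    intro j; rw [P]; split_ifs <;> ring
  rw [Finset.sum_congr rfl fun j _ => this j]
  simp [Finset.sum_sub_distrib, ← Finset.mul_sum, sum_X_sq]

end

/-! ### Tangential tensors, covariant differentiation and the Ricci identity -/

/-- The component of a tensor with a given first index. -/
def slice {k : ℕ} (j : Fin 3) : Tn (k + 1) →ₗ[SF] Tn k where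
  toFun U I := U (Fin.cons j I)
  map_add' _ _ := rfl
  map_smul' _ _ := rfl

lemma slice_apply {k : ℕ} (j : Fin 3) (U : Tn (k + 1)) (I : Fin k → Fin 3) :
    slice j U I = U (Fin.cons j I) := rfl

lemma ext_slice {k : ℕ} {U V : Tn (k + 1)} (h : ∀ j, slice j U = slice j V) : U = V := by
  funext I
  have := congrFun (h (I 0)) (Fin.tail I)
  simpa [slice_apply] using this

/-- The tangential tensors. -/
def Tan : (k : ℕ) → Submodule SF (Tn k)
  | 0 => ⊤
  | k + 1 =>
    -- Recursion on the first slot is what makes induction on the rank possible;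
    -- `mem_Tan_iff_slotTangent` recovers the condition on every slot.
    LinearMap.ker (∑ j, X j • slice (k := k) j) ⊓ ⨅ j, (Tan k).comap (slice j)

lemma mem_Tan_zero (T : Tn 0) : T ∈ Tan 0 := Submodule.mem_top

lemma mem_Tan_succ {k : ℕ} {U : Tn (k + 1)} :
    U ∈ Tan (k + 1) ↔ ∑ j, X j • slice j U = 0 ∧ ∀ j, slice j U ∈ Tan k := by
  simp [Tan]

/-- Covariant differentiation in direction `i` of tangential tensors. -/
def cd {k : ℕ} (i : Fin 3) : Tn k →ₗ[ℝ] Tn k where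
  -- Projecting slot a of the componentwise derivative to the tangent plane produces the extra term:
  -- X^j T_j = 0 and D_i X_j = P_ij give X^j D_i T_j = -T_i. `projA_D` proves that this is the
  -- projected derivative.
  toFun T I := D i (T I) + ∑ a, X (I a) * T (Function.update I a i)
  map_add' T U := by
    funext I
    simp [mul_add, Finset.sum_add_distrib]
    abel
  map_smul' c T := by
    funext I
    simp [Finset.smul_sum]

lemma cd_apply {k : ℕ} (i : Fin 3) (T : Tn k) (I : Fin k → Fin 3) :
    cd i T I = D i (T I) + ∑ a, X (I a) * T (Function.update I a i) := rfl

lemma cd_zero_apply (i : Fin 3) (T : Tn 0) (I : Fin 0 → Fin 3) : cd i T I = D i (T I) := by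
  simp [cd_apply]

lemma cd_smul {k : ℕ} (i : Fin 3) (f : SF) (T : Tn k) :
    cd i (f • T) = D i f • T + f • cd i T := by
  funext I
  simp only [cd_apply, Pi.smul_apply, Pi.add_apply, smul_eq_mul, Derivation.leibniz, mul_add,
    Finset.mul_sum]
  have : ∀ a, X (I a) * (f * T (Function.update I a i))
      = f * (X (I a) * T (Function.update I a i)) := fun a => by ring
  simp only [this]
  ring

/-- Splitting off the first slot isolates its own correction term. Together with `slice_J` this
reduces the tensor identities below to rank zero by induction. -/
lemma slice_cd {k : ℕ} (i j : Fin 3) (U : Tn (k + 1)) :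
    slice j (cd i U) = cd i (slice j U) + X j • slice i U := by
  funext I
  simp only [slice_apply, cd_apply, Pi.add_apply, Pi.smul_apply, smul_eq_mul, Fin.sum_univ_succ,
    Fin.cons_zero, Fin.cons_succ, Fin.update_cons_zero, ← Fin.cons_update]
  ring

/-- Rotation by a right angle, as a derivation acting on all slots. -/
def J {k : ℕ} : Tn k →ₗ[SF] Tn k where
  toFun T I := ∑ s, ∑ m, eps (I s) m * T (Function.update I s m)
  map_add' T U := by
    funext I
    simp [mul_add, Finset.sum_add_distrib]
  map_smul' c T := by
    funext I
    simp only [Pi.smul_apply, smul_eq_mul, RingHom.id_apply, Finset.mul_sum]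
    exact Finset.sum_congr rfl fun _ _ => Finset.sum_congr rfl fun _ _ => by ring

lemma J_apply {k : ℕ} (T : Tn k) (I : Fin k → Fin 3) :
    J T I = ∑ s, ∑ m, eps (I s) m * T (Function.update I s m) := rfl

@[simp] lemma J_zero_rank (T : Tn 0) : J T = 0 := by
  funext I; simp [J_apply]

lemma slice_J {k : ℕ} (j : Fin 3) (U : Tn (k + 1)) :
    slice j (J U) = J (slice j U) + ∑ m, eps j m • slice m U := by
  funext I
  simp only [slice_apply, J_apply, Pi.add_apply, Finset.sum_apply, Pi.smul_apply, smul_eq_mul,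
    Fin.sum_univ_succ (n := k), Fin.cons_zero, Fin.cons_succ, Fin.update_cons_zero,
    ← Fin.cons_update]
  ring

lemma sum_P_slice {k : ℕ} (i : Fin 3) (U : Tn (k + 1)) (h : ∑ j, X j • slice j U = 0) :
    ∑ j, P i j • slice j U = slice i U := by
  have : ∀ j, P i j • slice j U
      = (if i = j then slice j U else 0) - X i • (X j • slice j U) := by
    intro j
    rw [P, sub_smul, mul_smul]
    split_ifs <;> simp
  rw [Finset.sum_congr rfl fun j _ => this j, Finset.sum_sub_distrib, ← Finset.smul_sum, h]
  simp

lemma cd_sum_X_slice {k : ℕ} (i : Fin 3) (U : Tn (k + 1)) (h : ∑ j, X j • slice j U = 0) :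
    ∑ j, X j • cd i (slice j U) = - slice i U := by
  have h1 := congrArg (cd i) h
  rw [map_sum, map_zero] at h1
  simp only [cd_smul, D_X, Finset.sum_add_distrib] at h1
  rw [sum_P_slice i U h] at h1
  exact eq_neg_of_add_eq_zero_right h1

lemma cd_mem {k : ℕ} (i : Fin 3) {T : Tn k} (hT : T ∈ Tan k) : cd i T ∈ Tan k := by
  induction k with
  | zero => exact mem_Tan_zero _
  | succ k ih =>
    rw [mem_Tan_succ] at hT ⊢
    refine ⟨?_, fun j => ?_⟩
    · simp only [slice_cd, smul_add, Finset.sum_add_distrib, cd_sum_X_slice i T hT.1, smul_smul]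
      rw [← Finset.sum_smul, sum_X_sq]
      simp
    · rw [slice_cd]
      exact (Tan k).add_mem (ih (hT.2 j)) ((Tan k).smul_mem _ (hT.2 i))

lemma J_mem {k : ℕ} {T : Tn k} (hT : T ∈ Tan k) : J T ∈ Tan k := by
  induction k with
  | zero => exact mem_Tan_zero _
  | succ k ih =>
    rw [mem_Tan_succ] at hT ⊢
    refine ⟨?_, fun j => ?_⟩
    · simp only [slice_J, smul_add, Finset.sum_add_distrib, Finset.smul_sum, smul_smul]
      rw [Finset.sum_comm]
      simp only [← Finset.sum_smul]
      have h1 : ∀ m, ∑ j, X j * eps j m = 0 := by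
        intro m
        rw [← neg_eq_zero, ← Finset.sum_neg_distrib, ← sum_eps_X m]
        exact Finset.sum_congr rfl fun j _ => by rw [eps_anti m j]; ring
      have h2 : ∑ j, X j • J (slice j T) = 0 := by
        have := congrArg J hT.1
        rw [map_sum, map_zero] at this
        simpa only [map_smul] using this
      simp [h1, h2]
    · rw [slice_J]
      exact (Tan k).add_mem (ih (hT.2 j))
        ((Tan k).sum_mem fun m _ => (Tan k).smul_mem _ (hT.2 m))

lemma sum_X_cd {k : ℕ} {T : Tn k} (hT : T ∈ Tan k) : ∑ i, X i • cd i T = 0 := by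
  induction k with
  | zero =>
    funext I
    simpa [cd_zero_apply] using sum_X_D (T I)
  | succ k ih =>
    rw [mem_Tan_succ] at hT
    refine ext_slice fun j => ?_
    simp only [map_sum, map_smul, slice_cd, smul_add, Finset.sum_add_distrib, ih (hT.2 j),
      smul_comm _ (X j), ← Finset.smul_sum, hT.1]
    simp

/-- The area form is parallel. The terms of `D_eps` along the normal are either absorbed by the
correction term of the first slot or killed by tangency. -/
lemma cd_J {k : ℕ} (i : Fin 3) {T : Tn k} (hT : T ∈ Tan k) : cd i (J T) = J (cd i T) := by
  induction k with
  | zero => simp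
  | succ k ih =>
    rw [mem_Tan_succ] at hT
    refine ext_slice fun j => ?_
    have h1 : ∑ m, D i (eps j m) • slice m T = - (X j • ∑ m, eps i m • slice m T) := by
      have : ∀ m, D i (eps j m) • slice m T
          = -(X j • eps i m • slice m T) - eps j i • (X m • slice m T) := by
        intro m; rw [D_eps]; module
      simp only [this, Finset.sum_sub_distrib, ← Finset.smul_sum, hT.1, Finset.sum_neg_distrib]
      simp
    have h2 : ∑ m, eps j m • X m • slice i T = 0 := by
      simp only [smul_smul, ← Finset.sum_smul, sum_eps_X, zero_smul]
    simp only [slice_cd, slice_J, map_add, map_sum, cd_smul, ih (hT.2 j), smul_add, map_smul,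
      Finset.sum_add_distrib, h1, h2]
    module

/-- The Ricci identity. -/
lemma cd_comm {k : ℕ} (i j : Fin 3) {T : Tn k} (hT : T ∈ Tan k) :
    cd i (cd j T) - cd j (cd i T) = X i • cd j T - X j • cd i T + eps i j • J T := by
  induction k with
  | zero =>
    funext I
    simpa [cd_zero_apply] using D_comm i j (T I)
  | succ k ih =>
    rw [mem_Tan_succ] at hT
    refine ext_slice fun l => ?_
    have h1 := ih (hT.2 l)
    -- Curvature one enters here: the slot split off contributes P_il T_j - P_jl T_i, which
    -- `eps_mul_eps` turns into the first-slot part of eps_ij J T.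
    have h2 : P i l • slice j T - P j l • slice i T
        = eps i j • ∑ m, eps l m • slice m T := by
      rw [Finset.smul_sum]
      simp only [smul_smul, eps_mul_eps, sub_smul, Finset.sum_sub_distrib]
      simp only [mul_smul, ← Finset.smul_sum]
      simp only [sum_P_slice _ T hT.1, smul_comm (P i _) (P j l)]
      rw [← Finset.smul_sum, sum_P_slice _ T hT.1]
    simp only [map_sub, map_add, map_smul, slice_cd, cd_smul, slice_J, smul_add, D_X]
    linear_combination (norm := module) h1 + h2

/-- The covariant derivative of a smooth tangential tensor. -/
def covA {k : ℕ} : Tn k →ₗ[ℝ] Tn (k + 1) where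
  toFun T I := cd (I 0) T (Fin.tail I)
  map_add' T U := by funext I; simp
  map_smul' c T := by funext I; simp

@[simp] lemma slice_covA {k : ℕ} (j : Fin 3) (T : Tn k) : slice j (covA T) = cd j T := by
  funext I
  simp [slice_apply, covA]

lemma covA_mem {k : ℕ} {T : Tn k} (hT : T ∈ Tan k) : covA T ∈ Tan (k + 1) := by
  rw [mem_Tan_succ]
  simp only [slice_covA]
  exact ⟨sum_X_cd hT, fun j => cd_mem j hT⟩

/-- The contraction of the first two slots. -/
def trA {k : ℕ} : Tn (k + 2) →ₗ[SF] Tn k := ∑ i, slice i ∘ₗ slice i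

lemma trA_apply {k : ℕ} (S : Tn (k + 2)) : trA S = ∑ i, slice i (slice i S) := by
  simp [trA]

/-- The divergence of a tangential tensor. -/
def divA {k : ℕ} : Tn (k + 1) →ₗ[ℝ] Tn k := (trA.restrictScalars ℝ) ∘ₗ covA

lemma divA_apply {k : ℕ} {U : Tn (k + 1)} (hU : U ∈ Tan (k + 1)) :
    divA U = ∑ i, cd i (slice i U) := by
  have h := (mem_Tan_succ.mp hU).1
  simp [divA, trA_apply, slice_cd, Finset.sum_add_distrib, h]

lemma trA_mem {k : ℕ} {S : Tn (k + 2)} (hS : S ∈ Tan (k + 2)) : trA S ∈ Tan k := by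
  rw [trA_apply]
  exact (Tan k).sum_mem fun i _ => (mem_Tan_succ.mp ((mem_Tan_succ.mp hS).2 i)).2 i

/-! ### The rough Laplacian and the Casimir operator -/

/-- The rough Laplacian. -/
def lapA {k : ℕ} : Tn k →ₗ[ℝ] Tn k := ∑ i, cd i ∘ₗ cd i

lemma lapA_apply {k : ℕ} (T : Tn k) : lapA T = ∑ i, cd i (cd i T) := by
  simp [lapA]

lemma divA_covA {k : ℕ} {T : Tn k} (hT : T ∈ Tan k) : divA (covA T) = lapA T := by
  rw [divA_apply (covA_mem hT), lapA_apply]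
  simp

/-- The Casimir operator of the rotation group. -/
def cas {k : ℕ} : Tn k →ₗ[ℝ] Tn k :=
  - (lapA + (J.restrictScalars ℝ) ∘ₗ (J.restrictScalars ℝ))

lemma cas_apply {k : ℕ} (T : Tn k) : cas T = - (lapA T + J (J T)) := rfl

lemma sum_P_diag : ∑ i, P i i = 2 := by
  simp only [P, if_true, Finset.sum_sub_distrib, sum_X_sq]
  norm_num

/-- Two applications of the Ricci identity leave exactly these terms. In `cas_covA` the X_b term
cancels against the one in `slice_lapA`, and the eps term against the one in `slice_J_J`. -/
lemma lapA_cd {k : ℕ} (b : Fin 3) {T : Tn k} (hT : T ∈ Tan k) :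
    lapA (cd b T) - cd b (lapA T)
      = - (2 * X b) • lapA T - (2 : SF) • ∑ m, eps b m • J (cd m T) := by
  have key : ∀ i, cd i (cd i (cd b T)) - cd b (cd i (cd i T))
      = P i i • cd b T + X i • cd i (cd b T) - P b i • cd i T - (2 * X b) • cd i (cd i T)
        - (X i * eps i b) • J T - (2 : SF) • eps b i • J (cd i T)
        + (cd b (X i • cd i T) - P b i • cd i T) := by
    intro i
    have h1 := congrArg (cd i) (cd_comm i b hT)
    have h2 := cd_comm i b (cd_mem i hT)
    simp only [map_add, map_sub, cd_smul, D_X, D_eps, cd_J i hT, eps_self] at h1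
    rw [cd_smul, D_X]
    have h3 := eps_anti b i
    rw [h3] at h1 h2 ⊢
    rw [P_symm i b] at h1
    linear_combination (norm := module) h1 + h2
  have hP : ∑ i, P b i • cd i T = cd b T := by
    have := sum_P_slice b (covA T) (by simpa using sum_X_cd hT)
    simpa using this
  have hX : ∑ i, X i • cd i (cd b T) = 0 := sum_X_cd (cd_mem b hT)
  have hXe : ∑ i, (X i * eps i b) • J T = 0 := by
    have : ∑ i, X i * eps i b = 0 := by
      rw [← neg_eq_zero, ← Finset.sum_neg_distrib, ← sum_eps_X b]
      exact Finset.sum_congr rfl fun j _ => by rw [eps_anti b j]; ring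
    rw [← Finset.sum_smul, this, zero_smul]
  have hc : ∑ i, cd b (X i • cd i T) = 0 := by
    rw [← map_sum, sum_X_cd hT, map_zero]
  rw [lapA_apply, lapA_apply, map_sum, ← Finset.sum_sub_distrib,
    Finset.sum_congr rfl fun i _ => key i]
  simp only [Finset.sum_add_distrib, Finset.sum_sub_distrib, hP, hX, hXe, hc,
    ← Finset.sum_smul, sum_P_diag, ← Finset.smul_sum]
  module

lemma slice_lapA {k : ℕ} (b : Fin 3) {U : Tn (k + 1)} (hU : U ∈ Tan (k + 1)) :
    slice b (lapA U) = lapA (slice b U) + slice b U + (2 * X b) • divA U := by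
  have h := (mem_Tan_succ.mp hU).1
  have hP := sum_P_slice b U h
  rw [divA_apply hU, lapA_apply, lapA_apply, map_sum]
  have key : ∀ i, slice b (cd i (cd i U)) = cd i (cd i (slice b U)) + P b i • slice i U
      + (2 * X b) • cd i (slice i U) + X b • (X i • slice i U) := by
    intro i
    simp only [slice_cd, map_add, cd_smul, D_X, P_symm i b]
    module
  rw [Finset.sum_congr rfl fun i _ => key i]
  simp only [Finset.sum_add_distrib, hP, ← Finset.smul_sum, h]
  module

lemma slice_J_J {k : ℕ} (b : Fin 3) {U : Tn (k + 1)} (hU : U ∈ Tan (k + 1)) :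
    slice b (J (J U)) = J (J (slice b U)) + (2 : SF) • ∑ m, eps b m • J (slice m U)
      - slice b U := by
  have h := (mem_Tan_succ.mp hU).1
  have h2 : ∑ m, eps b m • ∑ n, eps m n • slice n U = - slice b U := by
    simp only [Finset.smul_sum, smul_smul]
    rw [Finset.sum_comm]
    simp only [← Finset.sum_smul, sum_eps_eps, neg_smul, Finset.sum_neg_distrib,
      sum_P_slice b U h]
  simp only [slice_J, map_add, map_sum, map_smul, smul_add, Finset.sum_add_distrib, h2]
  module

/-- The Casimir operator commutes with covariant differentiation. -/
lemma cas_covA {k : ℕ} {T : Tn k} (hT : T ∈ Tan k) : cas (covA T) = covA (cas T) := by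
  refine ext_slice fun b => ?_
  have h1 := slice_lapA b (covA_mem hT)
  have h2 := slice_J_J b (covA_mem hT)
  have h3 := lapA_cd b hT
  rw [divA_covA hT] at h1
  simp only [slice_covA] at h1 h2
  rw [slice_covA, cas_apply, cas_apply, map_neg, map_add, map_neg, map_add, h1, h2,
    cd_J b (J_mem hT), cd_J b hT]
  -- The zeroth-order terms of `slice_lapA` and `slice_J_J` have opposite signs and cancel; the rest
  -- is `lapA_cd`.
  linear_combination (norm := module) -h3

lemma cas_J {k : ℕ} {T : Tn k} (hT : T ∈ Tan k) : cas (J T) = J (cas T) := by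
  rw [cas_apply, cas_apply, lapA_apply, lapA_apply]
  simp only [map_neg, map_add, map_sum]
  simp only [cd_J _ hT, cd_J _ (cd_mem _ hT)]

lemma trA_cd {k : ℕ} (i : Fin 3) {S : Tn (k + 2)} (hS : S ∈ Tan (k + 2)) :
    trA (cd i S) = cd i (trA S) := by
  obtain ⟨h1, h2⟩ := mem_Tan_succ.mp hS
  have h3 : ∑ j, X j • slice j (slice i S) = 0 := (mem_Tan_succ.mp (h2 i)).1
  have h4 : ∑ j, X j • slice i (slice j S) = 0 := by
    simpa using congrArg (slice i) h1
  simp only [trA_apply, slice_cd, map_add, map_smul, Finset.sum_add_distrib, map_sum, h3, h4,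
    add_zero]

/-- `J` acts on the two traced slots through the antisymmetric eps, whose contraction with a
symmetric expression vanishes. -/
lemma trA_J {k : ℕ} (S : Tn (k + 2)) : trA (J S) = J (trA S) := by
  have h : ∑ i, ∑ m, eps i m • (slice m (slice i S) + slice i (slice m S)) = 0 := by
    have h1 : ∑ i, ∑ m, eps i m • (slice m (slice i S) + slice i (slice m S))
        = - ∑ i, ∑ m, eps i m • (slice m (slice i S) + slice i (slice m S)) := by
      conv_lhs => rw [Finset.sum_comm]
      simp only [← Finset.sum_neg_distrib]
      refine Finset.sum_congr rfl fun i _ => Finset.sum_congr rfl fun m _ => ?_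
      rw [eps_anti i m]
      module
    linear_combination (norm := module) (1 / 2 : ℝ) • h1
  simp only [trA_apply, slice_J, map_add, map_sum, map_smul, Finset.sum_add_distrib] at h ⊢
  simp only [smul_add, Finset.sum_add_distrib] at h
  linear_combination (norm := module) h

lemma cas_trA {k : ℕ} {S : Tn (k + 2)} (hS : S ∈ Tan (k + 2)) : cas (trA S) = trA (cas S) := by
  rw [cas_apply, cas_apply, lapA_apply, lapA_apply]
  simp only [map_neg, map_add, map_sum, trA_J, trA_cd _ (cd_mem _ hS), trA_cd _ hS]

/-! ## The `L²` pairing of smooth tensors -/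

/-- The pointwise inner product. -/
def ip {k : ℕ} (T U : Tn k) : SF := ∑ I, T I * U I

lemma ip_succ {k : ℕ} (U V : Tn (k + 1)) : ip U V = ∑ j, ip (slice j U) (slice j V) := by
  simp only [ip, slice_apply]
  rw [← Fintype.sum_prod_type' (f := fun (j : Fin 3) (I : Fin k → Fin 3) =>
    U (Fin.cons j I) * V (Fin.cons j I))]
  exact (Fintype.sum_equiv (Fin.consEquiv fun _ : Fin (k + 1) => Fin 3) _ _ fun _ => rfl).symm

lemma ip_comm {k : ℕ} (T U : Tn k) : ip T U = ip U T := by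
  simp only [ip, mul_comm]

lemma ip_add_left {k : ℕ} (T U V : Tn k) : ip (T + U) V = ip T V + ip U V := by
  simp [ip, add_mul, Finset.sum_add_distrib]

lemma ip_add_right {k : ℕ} (T U V : Tn k) : ip V (T + U) = ip V T + ip V U := by
  simp [ip, mul_add, Finset.sum_add_distrib]

lemma ip_smul_left {k : ℕ} (f : SF) (T U : Tn k) : ip (f • T) U = f * ip T U := by
  simp [ip, Finset.mul_sum, mul_assoc]

lemma ip_smul_right {k : ℕ} (f : SF) (T U : Tn k) : ip T (f • U) = f * ip T U := by
  rw [ip_comm, ip_smul_left, ip_comm]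

lemma ip_sum_left {k : ℕ} {ι : Type*} (s : Finset ι) (T : ι → Tn k) (U : Tn k) :
    ip (∑ i ∈ s, T i) U = ∑ i ∈ s, ip (T i) U := by
  simp only [ip, Finset.sum_apply, Finset.sum_mul]
  exact Finset.sum_comm

lemma ip_sum_right {k : ℕ} {ι : Type*} (s : Finset ι) (T : ι → Tn k) (U : Tn k) :
    ip U (∑ i ∈ s, T i) = ∑ i ∈ s, ip U (T i) := by
  rw [ip_comm, ip_sum_left]
  simp only [ip_comm]

lemma D_ip {k : ℕ} (i : Fin 3) {T U : Tn k} (hT : T ∈ Tan k) (hU : U ∈ Tan k) :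
    D i (ip T U) = ip (cd i T) U + ip T (cd i U) := by
  induction k with
  | zero => simp [ip, cd_zero_apply, Derivation.leibniz]; ring
  | succ k ih =>
    obtain ⟨hT1, hT2⟩ := mem_Tan_succ.mp hT
    obtain ⟨hU1, hU2⟩ := mem_Tan_succ.mp hU
    have h1 : ∑ j, X j * ip (slice i T) (slice j U) = 0 := by
      simp only [← ip_smul_right, ← ip_sum_right, hU1]
      simp [ip]
    have h2 : ∑ j, X j * ip (slice j T) (slice i U) = 0 := by
      simp only [← ip_smul_left, ← ip_sum_left, hT1]
      simp [ip]
    simp only [ip_succ, map_sum, ih (hT2 _) (hU2 _), slice_cd, ip_add_left, ip_add_right,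
      ip_smul_left, ip_smul_right, Finset.sum_add_distrib, h1, h2, add_zero]

lemma ip_J {k : ℕ} (T U : Tn k) : ip (J T) U = - ip T (J U) := by
  induction k with
  | zero => simp [ip]
  | succ k ih =>
    have h : ∑ j, ∑ m, eps j m * ip (slice m T) (slice j U)
        = - ∑ j, ∑ m, eps j m * ip (slice j T) (slice m U) := by
      rw [Finset.sum_comm]
      simp only [← Finset.sum_neg_distrib]
      refine Finset.sum_congr rfl fun i _ => Finset.sum_congr rfl fun m _ => ?_
      rw [eps_anti i m, neg_mul]
    simp only [ip_succ, slice_J, ip_add_left, ip_add_right, ip_sum_left, ip_sum_right,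
      ip_smul_left, ip_smul_right, Finset.sum_add_distrib, h, ih, Finset.sum_neg_distrib]
    ring

/-- The `L²` inner product. -/
def pair {k : ℕ} (T U : Tn k) : ℝ := integ (ip T U)

/-- Integration by parts. -/
lemma pair_covA {k : ℕ} {T : Tn k} {U : Tn (k + 1)} (hT : T ∈ Tan k) (hU : U ∈ Tan (k + 1)) :
    pair (covA T) U = - pair T (divA U) := by
  obtain ⟨hU1, hU2⟩ := mem_Tan_succ.mp hU
  have h1 : ip (covA T) U + ip T (divA U) = ∑ i, D i (ip T (slice i U)) := by
    simp only [ip_succ (covA T), slice_covA, divA_apply hU, ip_sum_right, D_ip _ hT (hU2 _),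
      Finset.sum_add_distrib]
  -- By `integ_D` the integral of this ambient divergence is twice that of the normal component of
  -- the vector field, which is zero by tangency of `U`.
  have h2 : integ (∑ i, D i (ip T (slice i U))) = 0 := by
    rw [map_sum]
    simp only [integ_D]
    rw [← Finset.mul_sum, ← map_sum]
    simp only [← ip_smul_right, ← ip_sum_right, hU1]
    simp [ip]
  rw [← h1, map_add] at h2
  exact eq_neg_of_add_eq_zero_left h2

/-- The pairing as a bilinear form. -/
def pairB {k : ℕ} : Tn k →ₗ[ℝ] Tn k →ₗ[ℝ] ℝ :=
  LinearMap.mk₂ ℝ pair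
    (fun T U V => by simp [pair, ip_add_left])
    (fun c T U => by
      rw [pair, pair, ← integ.map_smul]; congr 1; simp [ip, Finset.smul_sum])
    (fun T U V => by simp [pair, ip_add_right])
    (fun c T U => by
      rw [pair, pair, ← integ.map_smul]; congr 1; simp [ip, Finset.smul_sum])

lemma pairB_apply {k : ℕ} (T U : Tn k) : pairB T U = pair T U := rfl

lemma pair_comm {k : ℕ} (T U : Tn k) : pair T U = pair U T := by rw [pair, ip_comm, pair]

lemma pair_add_left {k : ℕ} (T U V : Tn k) : pair (T + U) V = pair T V + pair U V := by
  simp [pair, ip_add_left]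

lemma pair_add_right {k : ℕ} (T U V : Tn k) : pair V (T + U) = pair V T + pair V U := by
  simp [pair, ip_add_right]

lemma pair_neg_left {k : ℕ} (T U : Tn k) : pair (-T) U = - pair T U := by
  simp only [← pairB_apply, map_neg, LinearMap.neg_apply]

lemma pair_neg_right {k : ℕ} (T U : Tn k) : pair T (-U) = - pair T U := by
  simp only [← pairB_apply, map_neg]

lemma pair_sub_left {k : ℕ} (T U V : Tn k) : pair (T - U) V = pair T V - pair U V := by
  simp only [← pairB_apply, map_sub, LinearMap.sub_apply]

lemma pair_smul_left {k : ℕ} (c : ℝ) (T U : Tn k) : pair (c • T) U = c * pair T U := by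
  simp only [← pairB_apply, map_smul, LinearMap.smul_apply, smul_eq_mul]

lemma pair_smul_right {k : ℕ} (c : ℝ) (T U : Tn k) : pair T (c • U) = c * pair T U := by
  simp only [← pairB_apply, map_smul, smul_eq_mul]

@[simp] lemma pair_zero_left {k : ℕ} (T : Tn k) : pair 0 T = 0 := by
  rw [← pairB_apply, map_zero, LinearMap.zero_apply]

@[simp] lemma pair_zero_right {k : ℕ} (T : Tn k) : pair T 0 = 0 := by
  rw [← pairB_apply, map_zero]

lemma pair_J {k : ℕ} (T U : Tn k) : pair (J T) U = - pair T (J U) := by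
  rw [pair, ip_J, map_neg, pair]

/-- The square of the `L²` norm. -/
def nsq {k : ℕ} (T : Tn k) : ℝ := pair T T

lemma nsq_eq_integral {k : ℕ} (T : Tn k) : nsq T = ∫ x, ∑ I, ((T I).1 x) ^ 2 ∂σ := by
  rw [nsq, pair, integ_apply]
  congr 1
  ext x
  simp [ip, sq]

lemma nsq_nonneg {k : ℕ} (T : Tn k) : 0 ≤ nsq T := by
  rw [nsq_eq_integral]
  exact integral_nonneg fun x => Finset.sum_nonneg fun I _ => sq_nonneg _

@[simp] lemma nsq_zero {k : ℕ} : nsq (0 : Tn k) = 0 := pair_zero_left 0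

lemma nsq_smul {k : ℕ} (c : ℝ) (T : Tn k) : nsq (c • T) = c ^ 2 * nsq T := by
  rw [nsq, pair_smul_left, pair_smul_right, nsq]; ring

lemma nsq_add_le {k : ℕ} (T U : Tn k) : nsq (T + U) ≤ 2 * (nsq T + nsq U) := by
  have h := nsq_nonneg (T - U)
  simp only [nsq, sub_eq_add_neg, pair_add_left, pair_add_right, pair_neg_left,
    pair_neg_right] at h ⊢
  linarith

lemma eq_zero_of_nsq {k : ℕ} {T : Tn k} (h : nsq T = 0) : T = 0 := by
  rw [nsq_eq_integral] at h
  have hc : Continuous fun x => ∑ I, ((T I).1 x) ^ 2 :=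
    continuous_finsetSum _ fun I _ => (T I).continuous.pow 2
  have h2 := (integral_eq_zero_iff_of_nonneg
    (fun x => Finset.sum_nonneg fun I _ => sq_nonneg _)
    (hc.integrable_of_hasCompactSupport (HasCompactSupport.of_compactSpace _))).mp h
  have h3 := (hc.ae_eq_iff_eq σ continuous_const).mp h2
  funext I
  ext x
  have h4 : ∑ I, ((T I).1 x) ^ 2 = 0 := congrFun h3 x
  have := (Finset.sum_eq_zero_iff_of_nonneg fun I _ => sq_nonneg ((T I).1 x)).mp h4 I
    (Finset.mem_univ _)
  simpa using this

/-- Integration by parts and the antisymmetry of `J` exhibit `cas` as ∇⋆∇ + J⋆J. It is therefore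
symmetric, which makes its eigenspaces orthogonal. -/
lemma pair_cas {k : ℕ} {T U : Tn k} (hT : T ∈ Tan k) (hU : U ∈ Tan k) :
    pair (cas T) U = pair (covA T) (covA U) + pair (J T) (J U) := by
  rw [cas_apply, pair_neg_left, pair_add_left, pair_comm (lapA T), ← divA_covA hT,
    pair_J (J T), pair_comm (covA T), pair_covA hU (covA_mem hT)]
  ring

lemma nsq_covA_add {k : ℕ} {T : Tn k} (hT : T ∈ Tan k) :
    nsq (covA T) + nsq (J T) = pair (cas T) T := (pair_cas hT hT).symm

/-! ## Eigenspaces of the Casimir operator -/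

/-- The Casimir eigenvalue of degree `l`. -/
def ev (l : ℕ) : ℝ := l * (l + 1)

lemma ev_nonneg (l : ℕ) : 0 ≤ ev l := by unfold ev; positivity

lemma ev_strictMono : StrictMono ev := by
  intro a b h
  have : (a : ℝ) < b := by exact_mod_cast h
  have ha : (0 : ℝ) ≤ a := by positivity
  unfold ev
  nlinarith

/-- The tangential tensors of degree `l`. -/
def E (k l : ℕ) : Submodule ℝ (Tn k) :=
  (Tan k).restrictScalars ℝ ⊓ LinearMap.ker (cas - ev l • LinearMap.id)

lemma mem_E {k l : ℕ} {T : Tn k} : T ∈ E k l ↔ T ∈ Tan k ∧ cas T = ev l • T := by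
  simp [E, sub_eq_zero]

lemma pair_of_mem_E {k l l' : ℕ} (h : l ≠ l') {T U : Tn k} (hT : T ∈ E k l) (hU : U ∈ E k l') :
    pair T U = 0 := by
  rw [mem_E] at hT hU
  have h1 := pair_cas hT.1 hU.1
  have h2 := pair_cas hU.1 hT.1
  rw [hT.2, pair_smul_left] at h1
  rw [hU.2, pair_smul_left, pair_comm U T, pair_comm (covA U), pair_comm (J U)] at h2
  have h3 : (ev l - ev l') * pair T U = 0 := by linarith
  exact (mul_eq_zero.mp h3).resolve_left
    (sub_ne_zero.mpr (ev_strictMono.injective.ne h))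

lemma covA_mem_E {k l : ℕ} {T : Tn k} (hT : T ∈ E k l) : covA T ∈ E (k + 1) l := by
  rw [mem_E] at hT ⊢
  exact ⟨covA_mem hT.1, by rw [cas_covA hT.1, hT.2, map_smul]⟩

lemma trA_mem_E {k l : ℕ} {T : Tn (k + 2)} (hT : T ∈ E (k + 2) l) : trA T ∈ E k l := by
  rw [mem_E] at hT ⊢
  exact ⟨trA_mem hT.1, by
    rw [cas_trA hT.1, hT.2]; exact (trA.restrictScalars ℝ).map_smul _ _⟩

lemma J_mem_E {k l : ℕ} {T : Tn k} (hT : T ∈ E k l) : J T ∈ E k l := by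
  rw [mem_E] at hT ⊢
  exact ⟨J_mem hT.1, by
    rw [cas_J hT.1, hT.2]; exact (J.restrictScalars ℝ).map_smul _ _⟩

lemma divA_mem_E {k l : ℕ} {T : Tn (k + 1)} (hT : T ∈ E (k + 1) l) : divA T ∈ E k l :=
  trA_mem_E (covA_mem_E hT)

/-- This is the source of all Sobolev estimates: `J` has order zero, so on degree l one derivative
costs √λ up to bounded terms. -/
lemma nsq_covA_add_of_mem_E {k l : ℕ} {T : Tn k} (hT : T ∈ E k l) :
    nsq (covA T) + nsq (J T) = ev l * nsq T := by
  rw [mem_E] at hT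
  rw [nsq_covA_add hT.1, hT.2, pair_smul_left, nsq]

lemma lapA_of_mem_E_zero {l : ℕ} {Y : Tn 0} (hY : Y ∈ E 0 l) : lapA Y = - ev l • Y := by
  have h := (mem_E.mp hY).2
  rw [cas_apply] at h
  simp only [J_zero_rank, add_zero] at h
  rw [neg_smul, ← h, neg_neg]

/-! ## Functions, 1-forms and 2-tensors -/

lemma idx_zero (I : Fin 0 → Fin 3) : I = ![] := Subsingleton.elim _ _

lemma idx_one (I : Fin 1 → Fin 3) : I = ![I 0] := by
  funext s; fin_cases s; rfl

lemma idx_two (I : Fin 2 → Fin 3) : I = ![I 0, I 1] := by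
  funext s; fin_cases s <;> rfl

lemma ext_zero {S T : Tn 0} (h : S ![] = T ![]) : S = T := by
  funext I; rw [idx_zero I, h]

lemma ext_one {S T : Tn 1} (h : ∀ a, S ![a] = T ![a]) : S = T := by
  funext I; rw [idx_one I, h]

lemma ext_two {S T : Tn 2} (h : ∀ a b, S ![a, b] = T ![a, b]) : S = T := by
  funext I; rw [idx_two I, h]

lemma update_one (a b : Fin 3) : Function.update ![a] 0 b = ![b] := by
  funext s; fin_cases s; rfl

lemma update_two_zero (a b c : Fin 3) : Function.update ![a, b] 0 c = ![c, b] := by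
  funext s; fin_cases s <;> rfl

lemma update_two_one (a b c : Fin 3) : Function.update ![a, b] 1 c = ![a, c] := by
  funext s; fin_cases s <;> rfl

lemma slice_one (a : Fin 3) (V : Tn 1) : slice a V ![] = V ![a] := rfl

lemma slice_two (a b : Fin 3) (S : Tn 2) : slice a S ![b] = S ![a, b] := rfl

lemma cd_one (i a : Fin 3) (V : Tn 1) : cd i V ![a] = D i (V ![a]) + X a * V ![i] := by
  simp [cd_apply, update_one]

lemma cd_two (i a b : Fin 3) (S : Tn 2) :
    cd i S ![a, b] = D i (S ![a, b]) + X a * S ![i, b] + X b * S ![a, i] := by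
  simp [cd_apply, Fin.sum_univ_two, update_two_zero, update_two_one, add_assoc]

lemma J_one (a : Fin 3) (V : Tn 1) : J V ![a] = ∑ m, eps a m * V ![m] := by
  simp [J_apply, update_one]

lemma J_two (a b : Fin 3) (S : Tn 2) :
    J S ![a, b] = ∑ m, eps a m * S ![m, b] + ∑ m, eps b m * S ![a, m] := by
  simp [J_apply, Fin.sum_univ_two, update_two_zero, update_two_one]

lemma mem_Tan_one {V : Tn 1} : V ∈ Tan 1 ↔ ∑ a, X a * V ![a] = 0 := by
  rw [mem_Tan_succ]
  constructor
  · intro h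
    simpa [slice_one] using congrFun h.1 ![]
  · intro h
    refine ⟨ext_zero ?_, fun _ => mem_Tan_zero _⟩
    simpa [slice_one] using h

lemma mem_Tan_two {S : Tn 2} : S ∈ Tan 2 ↔
    (∀ b, ∑ a, X a * S ![a, b] = 0) ∧ ∀ a, ∑ b, X b * S ![a, b] = 0 := by
  rw [mem_Tan_succ]
  simp only [mem_Tan_one, slice_two]
  refine and_congr ⟨fun h b => ?_, fun h => ext_one fun b => ?_⟩ Iff.rfl
  · simpa [slice_two] using congrFun h ![b]
  · simpa [slice_two] using h b

lemma covA_zero (a : Fin 3) (f : Tn 0) : covA f ![a] = D a (f ![]) := by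
  have h := congrFun (slice_covA a f) ![]
  rwa [slice_one, cd_zero_apply] at h

lemma covA_one (a b : Fin 3) (V : Tn 1) : covA V ![a, b] = cd a V ![b] :=
  congrFun (slice_covA a V) ![b]

lemma divA_one (V : Tn 1) : divA V ![] = ∑ i, cd i V ![i] := by
  simp [divA, trA_apply, slice_one]

lemma trA_two (S : Tn 2) : trA S ![] = ∑ i, S ![i, i] := by
  simp only [trA_apply, Finset.sum_apply]
  rfl

lemma divA_two {S : Tn 2} (hS : S ∈ Tan 2) (a : Fin 3) :
    divA S ![a] = ∑ i, cd i (slice i S) ![a] := by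
  rw [divA_apply hS, Finset.sum_apply]

/-- Transposition. -/
def swapA : Tn 2 →ₗ[SF] Tn 2 where
  toFun S I := S ![I 1, I 0]
  map_add' _ _ := rfl
  map_smul' _ _ := rfl

@[simp] lemma swapA_apply (S : Tn 2) (a b : Fin 3) : swapA S ![a, b] = S ![b, a] := rfl

/-- The product of a function with the metric. -/
def metA : Tn 0 →ₗ[SF] Tn 2 where
  toFun φ I := φ ![] * P (I 0) (I 1)
  map_add' _ _ := by funext I; simp [add_mul]
  map_smul' _ _ := by funext I; simp [mul_assoc]

@[simp] lemma metA_apply (φ : Tn 0) (a b : Fin 3) : metA φ ![a, b] = φ ![] * P a b := rfl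

lemma swapA_mem {S : Tn 2} (hS : S ∈ Tan 2) : swapA S ∈ Tan 2 := by
  rw [mem_Tan_two] at hS ⊢
  simpa using hS.symm

lemma metA_mem (φ : Tn 0) : metA φ ∈ Tan 2 := by
  rw [mem_Tan_two]
  have h : ∀ a, ∑ b, X b * P a b = 0 := fun a => by
    rw [← sum_P_X a]; exact Finset.sum_congr rfl fun _ _ => mul_comm _ _
  constructor
  · intro b
    simp only [metA_apply, mul_left_comm (X _), ← Finset.mul_sum, P_symm _ b, h, mul_zero]
  · intro b
    simp only [metA_apply, mul_left_comm (X _), ← Finset.mul_sum, h, mul_zero]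

lemma cas_intertwine {k m : ℕ} (F : Tn k →ₗ[SF] Tn m)
    (hcd : ∀ i T, T ∈ Tan k → cd i (F T) = F (cd i T)) (hJ : ∀ T, T ∈ Tan k → J (F T) = F (J T))
    {T : Tn k} (hT : T ∈ Tan k) : cas (F T) = F (cas T) := by
  rw [cas_apply, cas_apply, lapA_apply, lapA_apply]
  simp only [map_neg, map_add, map_sum, hJ _ hT, hJ _ (J_mem hT), hcd _ _ hT,
    hcd _ _ (cd_mem _ hT)]

lemma map_mem_E {k m l : ℕ} (F : Tn k →ₗ[SF] Tn m) (hF : ∀ T, T ∈ Tan k → F T ∈ Tan m)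
    (hcd : ∀ i T, T ∈ Tan k → cd i (F T) = F (cd i T)) (hJ : ∀ T, T ∈ Tan k → J (F T) = F (J T))
    {T : Tn k} (hT : T ∈ E k l) : F T ∈ E m l := by
  rw [mem_E] at hT ⊢
  refine ⟨hF T hT.1, ?_⟩
  rw [cas_intertwine F hcd hJ hT.1, hT.2]
  exact (F.restrictScalars ℝ).map_smul _ _

lemma swapA_mem_E {l : ℕ} {S : Tn 2} (hS : S ∈ E 2 l) : swapA S ∈ E 2 l := by
  refine map_mem_E swapA (fun T hT => swapA_mem hT) (fun i T _ => ext_two fun a b => ?_)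
    (fun T _ => ext_two fun a b => ?_) hS
  · simp only [cd_two, swapA_apply]; ring
  · simp only [J_two, swapA_apply]; ring

lemma D_P (i a b : Fin 3) : D i (P a b) = - (P i a * X b) - X a * P i b := by
  rw [P]
  split_ifs <;> simp [D_X] <;> ring

lemma sum_eps_P (a b : Fin 3) : ∑ m, eps a m * P m b = eps a b := by
  have : ∀ m, eps a m * P m b = (if m = b then eps a m else 0) - (eps a m * X m) * X b := by
    intro m; rw [P]; split_ifs <;> ring
  simp [this, Finset.sum_sub_distrib, ← Finset.sum_mul, sum_eps_X]

lemma metA_mem_E {l : ℕ} {φ : Tn 0} (hφ : φ ∈ E 0 l) : metA φ ∈ E 2 l := by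
  refine map_mem_E metA (fun T _ => metA_mem T) (fun i T _ => ext_two fun a b => ?_)
    (fun T _ => ext_two fun a b => ?_) hφ
  · simp only [cd_two, metA_apply, cd_zero_apply, Derivation.leibniz, D_P, smul_eq_mul,
      P_symm a i]
    ring
  · simp only [J_two, metA_apply, J_zero_rank, mul_left_comm (eps _ _), ← Finset.mul_sum,
      sum_eps_P, P_symm a]
    simp [eps_anti a b]

/-! ### The operators D₁⋆ and D₂⋆ and their divergences -/

/-- The operator `D₁⋆` on smooth functions. -/
def D1A : Tn 0 × Tn 0 →ₗ[ℝ] Tn 1 :=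
  - covA ∘ₗ LinearMap.fst ℝ _ _ + (J.restrictScalars ℝ) ∘ₗ covA ∘ₗ LinearMap.snd ℝ _ _

lemma D1A_apply (Y Z : Tn 0) : D1A (Y, Z) = - covA Y + J (covA Z) := rfl

/-- The operator `D₂⋆` on smooth 1-forms. -/
def D2A : Tn 1 →ₗ[ℝ] Tn 2 :=
  (-(1 / 2) : ℝ) • (covA + (swapA.restrictScalars ℝ) ∘ₗ covA - (metA.restrictScalars ℝ) ∘ₗ divA)

lemma D2A_apply (V : Tn 1) :
    D2A V = (-(1 / 2) : ℝ) • (covA V + swapA (covA V) - metA (divA V)) := rfl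

lemma D1A_mem_E {l : ℕ} {Y Z : Tn 0} (hY : Y ∈ E 0 l) (hZ : Z ∈ E 0 l) :
    D1A (Y, Z) ∈ E 1 l :=
  (E 1 l).add_mem ((E 1 l).neg_mem (covA_mem_E hY)) (J_mem_E (covA_mem_E hZ))

lemma D2A_mem_E {l : ℕ} {V : Tn 1} (hV : V ∈ E 1 l) : D2A V ∈ E 2 l :=
  (E 2 l).smul_mem _ ((E 2 l).sub_mem ((E 2 l).add_mem (covA_mem_E hV)
    (swapA_mem_E (covA_mem_E hV))) (metA_mem_E (divA_mem_E hV)))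

lemma D1A_mem (Y Z : Tn 0) : D1A (Y, Z) ∈ Tan 1 :=
  (Tan 1).add_mem ((Tan 1).neg_mem (covA_mem (mem_Tan_zero Y)))
    (J_mem (covA_mem (mem_Tan_zero Z)))

lemma Tan_smul_real {k : ℕ} (c : ℝ) {T : Tn k} (hT : T ∈ Tan k) : c • T ∈ Tan k :=
  ((Tan k).restrictScalars ℝ).smul_mem c hT

lemma D2A_mem {V : Tn 1} (hV : V ∈ Tan 1) : D2A V ∈ Tan 2 :=
  Tan_smul_real _ ((Tan 2).sub_mem ((Tan 2).add_mem (covA_mem hV)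
    (swapA_mem (covA_mem hV))) (metA_mem _))

lemma J_J_one {V : Tn 1} (hV : V ∈ Tan 1) : J (J V) = - V := by
  refine ext_one fun a => ?_
  simp only [J_one, Finset.mul_sum, ← mul_assoc]
  rw [Finset.sum_comm]
  simp only [← Finset.sum_mul, sum_eps_eps]
  have h := congrFun (sum_P_slice a V (mem_Tan_succ.mp hV).1) ![]
  simp only [Finset.sum_apply, Pi.smul_apply, slice_one, smul_eq_mul] at h
  simp [h]

/-- The curl of a gradient vanishes. By the Ricci identity in rank zero the antisymmetrized second
derivative only contains normal factors X, and eps annihilates them. -/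
lemma divA_J_covA (Z : Tn 0) : divA (J (covA Z)) = 0 := by
  have hZ := mem_Tan_zero Z
  rw [divA_apply (J_mem (covA_mem hZ))]
  simp only [slice_J, slice_covA, J_zero_rank, zero_add, map_sum, cd_smul, D_eps, eps_self]
  have h4 : ∀ m, ∑ i, eps i m * X i = 0 := fun m => by
    refine Eq.trans ?_ (neg_eq_zero.mpr (sum_eps_X m))
    rw [← Finset.sum_neg_distrib]
    exact Finset.sum_congr rfl fun j _ => by rw [eps_anti m j, neg_mul]
  have h1 : ∑ i, ∑ m, eps i m • cd i (cd m Z) = 0 := by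
    have h2 : ∑ i, ∑ m, eps i m • cd i (cd m Z) = - ∑ i, ∑ m, eps i m • cd m (cd i Z) := by
      conv_lhs => rw [Finset.sum_comm]
      simp only [← Finset.sum_neg_distrib]
      refine Finset.sum_congr rfl fun i _ => Finset.sum_congr rfl fun m _ => ?_
      rw [eps_anti i m, neg_smul]
    have h3 : ∑ i, ∑ m, eps i m • cd i (cd m Z) - ∑ i, ∑ m, eps i m • cd m (cd i Z)
        = 0 := by
      have hA : ∑ i, ∑ m, (eps i m * X i) • cd m Z = 0 := by
        rw [Finset.sum_comm]
        simp only [← Finset.sum_smul, h4, zero_smul, Finset.sum_const_zero]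
      have hB : ∑ i, ∑ m, (eps i m * X m) • cd i Z = 0 := by
        simp only [← Finset.sum_smul, sum_eps_X, zero_smul, Finset.sum_const_zero]
      simp only [← Finset.sum_sub_distrib, ← smul_sub]
      simp only [cd_comm _ _ hZ, J_zero_rank, smul_zero, add_zero]
      simp only [smul_sub, smul_smul, Finset.sum_sub_distrib, hA, hB, sub_zero]
    linear_combination (norm := module) (1 / 2 : ℝ) • h2 + (1 / 2 : ℝ) • h3
  have h5 : ∑ i, ∑ m, (-(X i * eps i m) - X m * 0) • cd m Z = 0 := by
    rw [Finset.sum_comm]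
    simp only [mul_zero, sub_zero, neg_smul, Finset.sum_neg_distrib]
    simp only [mul_comm (X _)]
    simp only [← Finset.sum_smul, h4, neg_zero, zero_smul, Finset.sum_const_zero]
  simp only [Finset.sum_add_distrib, h1, h5, add_zero]

lemma divA_D1A {l : ℕ} {Y : Tn 0} (hY : Y ∈ E 0 l) (Z : Tn 0) :
    divA (D1A (Y, Z)) = ev l • Y := by
  rw [D1A_apply, map_add, map_neg, divA_J_covA, divA_covA (mem_Tan_zero Y),
    lapA_of_mem_E_zero hY]
  module

lemma J_D1A (Y Z : Tn 0) : J (D1A (Y, Z)) = D1A (Z, -Y) := by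
  rw [D1A_apply, D1A_apply, map_add, map_neg, J_J_one (covA_mem (mem_Tan_zero Z)), map_neg,
    map_neg, add_comm]

lemma pair_D1A_left (Y Z : Tn 0) {V : Tn 1} (hV : V ∈ Tan 1) :
    pair (D1A (Y, Z)) V = pair Y (divA V) + pair Z (divA (J V)) := by
  rw [D1A_apply, pair_add_left, pair_neg_left, pair_J,
    pair_covA (mem_Tan_zero Y) hV, pair_covA (mem_Tan_zero Z) (J_mem hV)]
  ring

lemma pair_D1A {l : ℕ} (Y' Z' : Tn 0) {Y Z : Tn 0} (hY : Y ∈ E 0 l) (hZ : Z ∈ E 0 l) :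
    pair (D1A (Y', Z')) (D1A (Y, Z)) = ev l * (pair Y' Y + pair Z' Z) := by
  rw [pair_D1A_left _ _ (D1A_mem Y Z), J_D1A, divA_D1A hY, divA_D1A hZ, pair_smul_right,
    pair_smul_right]
  ring

lemma divA_metA (φ : Tn 0) : divA (metA φ) = covA φ := by
  refine ext_one fun a => ?_
  rw [divA_two (metA_mem φ), covA_zero]
  simp only [cd_one, slice_two, metA_apply, Derivation.leibniz, D_P, smul_eq_mul]
  have h1 : ∀ i, φ ![] * (-(P i i * X a) - X i * P i a) + P i a * D i (φ ![])
      + X a * (φ ![] * P i i) = - φ ![] * (P a i * X i) + (if i = a then D i (φ ![]) else 0)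
        - X a * (X i * D i (φ ![])) := by
    intro i
    rw [P_symm a i, P, P]
    split_ifs <;> ring
  rw [Finset.sum_congr rfl fun i _ => h1 i]
  simp [Finset.sum_add_distrib, Finset.sum_sub_distrib, ← Finset.mul_sum, sum_P_X, sum_X_D]

/-- Commuting the two derivatives in ∇^i ∇_a V_i produces the Ricci curvature of the unit sphere,
here in the form -J² V = V. -/
lemma divA_swapA_covA {V : Tn 1} (hV : V ∈ Tan 1) :
    divA (swapA (covA V)) = covA (divA V) + V := by
  refine ext_one fun a => ?_
  rw [divA_two (swapA_mem (covA_mem hV)), Pi.add_apply, covA_zero, divA_one]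
  simp only [cd_one _ _ (slice _ _), slice_two, swapA_apply, covA_one]
  have h1 : ∀ i, D i (cd a V ![i]) + X a * cd i V ![i] = D a (cd i V ![i])
      + X i * cd i V ![a] - eps a i * J V ![i] := by
    intro i
    have h2 := congrFun (cd_comm i a hV) ![i]
    simp only [Pi.sub_apply, Pi.add_apply, Pi.smul_apply, smul_eq_mul,
      cd_one _ _ (cd _ _), eps_anti a i] at h2
    linear_combination h2
  have h3 : ∑ i, eps a i * J V ![i] = - V ![a] := by
    rw [← J_one, J_J_one hV]; rfl
  have h4 : ∑ i, X i * cd i V ![a] = 0 := by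
    simpa using congrFun (sum_X_cd hV) ![a]
  rw [Finset.sum_congr rfl fun i _ => h1 i]
  simp only [Finset.sum_add_distrib, Finset.sum_sub_distrib, h3, h4, map_sum]
  ring

/-- On 1-forms J² = -1, so the Casimir equation reads ΔV = (1 - λ)V for the rough Laplacian. The
gradient of div V cancels between the transposed and the metric term, leaving -½((1 - λ) + 1)V. -/
lemma divA_D2A {l : ℕ} {V : Tn 1} (hV : V ∈ E 1 l) :
    divA (D2A V) = ((ev l - 2) / 2) • V := by
  obtain ⟨h1, h2⟩ := mem_E.mp hV
  rw [cas_apply, J_J_one h1] at h2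
  have h3 : lapA V = - ev l • V + V := by
    linear_combination (norm := module) -h2
  rw [D2A_apply, map_smul, map_sub, map_add, divA_covA h1, divA_swapA_covA h1, divA_metA, h3]
  module

lemma ip_zero (f g : Tn 0) : ip f g = f ![] * g ![] := by
  rw [ip, Finset.univ_unique, Finset.sum_singleton]
  exact congrArg₂ (· * ·) (congrArg f (idx_zero _)) (congrArg g (idx_zero _))

lemma ip_one (U V : Tn 1) : ip U V = ∑ a, U ![a] * V ![a] := by
  simp only [ip_succ, ip_zero, slice_one]

lemma ip_two (S T : Tn 2) : ip S T = ∑ a, ∑ b, S ![a, b] * T ![a, b] := by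
  simp only [ip_succ S, ip_one, slice_two]

lemma pair_swapA (S T : Tn 2) : pair (swapA S) T = pair S (swapA T) := by
  rw [pair, pair, ip_two, ip_two, Finset.sum_comm]
  rfl

lemma pair_metA (φ : Tn 0) {S : Tn 2} (hS : S ∈ Tan 2) : pair (metA φ) S = pair φ (trA S) := by
  have h := mem_Tan_two.mp hS
  have h1 : ∀ a b, φ ![] * P a b * S ![a, b]
      = (if a = b then φ ![] * S ![a, b] else 0) - φ ![] * X a * (X b * S ![a, b]) := by
    intro a b; rw [P]; split_ifs <;> ring
  rw [pair, pair, ip_two, ip_zero, trA_two]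
  simp only [metA_apply, h1, Finset.sum_sub_distrib, ← Finset.mul_sum, h.2]
  simp [Finset.mul_sum]

lemma swapA_swapA (S : Tn 2) : swapA (swapA S) = S := ext_two fun _ _ => rfl

lemma swapA_metA (φ : Tn 0) : swapA (metA φ) = metA φ :=
  ext_two fun a b => by simp [P_symm a b]

lemma swapA_D2A (V : Tn 1) : swapA (D2A V) = D2A V := by
  have : swapA (D2A V)
      = (-(1 / 2) : ℝ) • (swapA (covA V) + swapA (swapA (covA V)) - swapA (metA (divA V))) := rfl
  rw [this, swapA_swapA, swapA_metA, D2A_apply]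
  module

lemma trA_metA (φ : Tn 0) : trA (metA φ) = (2 : ℝ) • φ := by
  refine ext_zero ?_
  rw [trA_two]
  simp only [metA_apply, ← Finset.mul_sum, sum_P_diag]
  simp [two_smul, mul_two]

lemma trA_D2A (V : Tn 1) : trA (D2A V) = 0 := by
  have h : trA (D2A V) = (-(1 / 2) : ℝ) • (trA (covA V) + trA (swapA (covA V))
      - trA (metA (divA V))) := by
    rw [D2A_apply]
    simp only [← map_add, ← map_sub]
    exact (trA.restrictScalars ℝ).map_smul _ _
  have h1 : trA (swapA (covA V)) = trA (covA V) := ext_zero (by simp [trA_two])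
  have h2 : trA (covA V) = divA V := rfl
  rw [h, h1, h2, trA_metA]
  module

lemma pair_D2A_left {V : Tn 1} (hV : V ∈ Tan 1) {S : Tn 2} (hS : S ∈ Tan 2)
    (hsymm : swapA S = S) (htr : trA S = 0) : pair (D2A V) S = pair V (divA S) := by
  rw [D2A_apply, pair_smul_left, pair_sub_left, pair_add_left, pair_swapA, hsymm,
    pair_metA _ hS, htr, pair_covA hV hS, pair_zero_right]
  ring

lemma pair_D2A {l : ℕ} {V' V : Tn 1} (hV' : V' ∈ Tan 1) (hV : V ∈ E 1 l) :
    pair (D2A V') (D2A V) = (ev l - 2) / 2 * pair V' V := by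
  rw [pair_D2A_left hV' (D2A_mem (mem_E.mp hV).1) (swapA_D2A V) (trA_D2A V), divA_D2A hV,
    pair_smul_right]

/-- The factor λ(λ-2)/2 vanishes exactly in degrees 0 and 1, so there are no tensor harmonics there.
In higher degrees it grows like λ², so potentials gain two derivatives, and the electric and
magnetic parts are orthogonal. -/
lemma pair_D2A_D1A {l : ℕ} (Y' Z' : Tn 0) {Y Z : Tn 0} (hY : Y ∈ E 0 l) (hZ : Z ∈ E 0 l) :
    pair (D2A (D1A (Y', Z'))) (D2A (D1A (Y, Z)))
      = (ev l - 2) / 2 * ev l * (pair Y' Y + pair Z' Z) := by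
  rw [pair_D2A (D1A_mem _ _) (D1A_mem_E hY hZ), pair_D1A _ _ hY hZ]
  ring

/-! ## Harmonic polynomials -/

/-- Polynomials on `ℝ³`. -/
abbrev Poly := MvPolynomial (Fin 3) ℝ

/-- The Euclidean Laplacian on polynomials. -/
def polyLap : Poly →ₗ[ℝ] Poly :=
  ∑ i, (MvPolynomial.pderiv i).toLinearMap ∘ₗ (MvPolynomial.pderiv i).toLinearMap

lemma polyLap_apply (p : Poly) :
    polyLap p = ∑ i, MvPolynomial.pderiv i (MvPolynomial.pderiv i p) := by
  simp [polyLap]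

/-- The squared radius. -/
def radSq : Poly := ∑ i, MvPolynomial.X i * MvPolynomial.X i

lemma radSq_isHomogeneous : radSq.IsHomogeneous 2 :=
  MvPolynomial.IsHomogeneous.sum _ _ _ fun i _ =>
    (MvPolynomial.isHomogeneous_X ℝ i).mul (MvPolynomial.isHomogeneous_X ℝ i)

lemma pderiv_radSq (i : Fin 3) : MvPolynomial.pderiv i radSq = 2 * MvPolynomial.X i := by
  have : ∀ j, MvPolynomial.pderiv i (MvPolynomial.X j * MvPolynomial.X j : Poly)
      = if j = i then 2 * MvPolynomial.X j else 0 := by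
    intro j
    rw [Derivation.leibniz, MvPolynomial.pderiv_X]
    by_cases h : j = i
    · subst h; simp [two_mul]
    · simp [h]
  rw [radSq, map_sum, Finset.sum_congr rfl fun j _ => this j]
  simp

lemma polyLap_isHomogeneous {p : Poly} {d : ℕ} (hp : p.IsHomogeneous d) :
    (polyLap p).IsHomogeneous (d - 2) := by
  rw [polyLap_apply]
  exact MvPolynomial.IsHomogeneous.sum _ _ _ fun i _ => hp.pderiv.pderiv

/-- The constant 6 is the Laplacian of the squared radius in three variables; 4d comes from Euler's
identity applied to the cross term. -/
lemma polyLap_radSq_mul {p : Poly} {d : ℕ} (hp : p.IsHomogeneous d) :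
    polyLap (radSq * p) = ((6 + 4 * d : ℕ) : ℝ) • p + radSq * polyLap p := by
  have hE := hp.sum_X_mul_pderiv
  have h1 : ∀ i, MvPolynomial.pderiv i (MvPolynomial.pderiv i (radSq * p))
      = 2 * p + 4 * (MvPolynomial.X i * MvPolynomial.pderiv i p)
        + radSq * MvPolynomial.pderiv i (MvPolynomial.pderiv i p) := by
    intro i
    simp only [Derivation.leibniz, map_add, pderiv_radSq, smul_eq_mul]
    have : MvPolynomial.pderiv i (2 * MvPolynomial.X i : Poly) = 2 := by
      rw [two_mul, map_add, MvPolynomial.pderiv_X_self]; norm_num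
    have h2 : MvPolynomial.pderiv i (2 : Poly) = 0 := by
      exact_mod_cast Derivation.map_natCast (MvPolynomial.pderiv (R := ℝ) i) 2
    simp only [h2, MvPolynomial.pderiv_X_self]
    ring
  rw [polyLap_apply, polyLap_apply, Finset.sum_congr rfl fun i _ => h1 i]
  simp only [Finset.sum_add_distrib, ← Finset.mul_sum, hE]
  simp only [Finset.sum_const, Finset.card_univ, Fintype.card_fin, nsmul_eq_mul, Nat.cast_smul_eq_nsmul]
  push_cast
  ring

/-- The harmonic homogeneous polynomials of degree `l`. -/
def harmPoly (l : ℕ) : Submodule ℝ Poly :=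
  MvPolynomial.homogeneousSubmodule (Fin 3) ℝ l ⊓ LinearMap.ker polyLap

lemma mem_harmPoly {l : ℕ} {p : Poly} :
    p ∈ harmPoly l ↔ p.IsHomogeneous l ∧ polyLap p = 0 := by
  simp [harmPoly]

instance (l : ℕ) : FiniteDimensional ℝ (harmPoly l) := by
  have : FiniteDimensional ℝ (MvPolynomial.homogeneousSubmodule (Fin 3) ℝ l) :=
    Module.Finite.iff_fg.mpr (MvPolynomial.homogeneousSubmodule_fg _ _ l)
  exact Submodule.finiteDimensional_inf_left _ _

/-- Induction on `polyLap_radSq_mul`. Positivity of the constant is what later allows division by it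
when a harmonic component is peeled off. -/
lemma polyLap_radSq_pow_mul {l : ℕ} {h : Poly} (hh : h ∈ harmPoly l) (n : ℕ) :
    ∃ c : ℝ, 0 < c ∧ polyLap (radSq ^ (n + 1) * h) = c • (radSq ^ n * h) := by
  rw [mem_harmPoly] at hh
  induction n with
  | zero =>
    refine ⟨((6 + 4 * l : ℕ) : ℝ), by positivity, ?_⟩
    rw [zero_add, pow_one, polyLap_radSq_mul hh.1, hh.2]
    simp
  | succ n ih =>
    obtain ⟨c, hc, hc'⟩ := ih
    have hd : (radSq ^ (n + 1) * h).IsHomogeneous (2 * (n + 1) + l) :=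
      (radSq_isHomogeneous.pow (n + 1)).mul hh.1
    refine ⟨((6 + 4 * (2 * (n + 1) + l) : ℕ) : ℝ) + c, by positivity, ?_⟩
    rw [pow_succ' radSq (n + 1), mul_assoc, polyLap_radSq_mul hd, hc', add_smul, mul_smul_comm,
      ← mul_assoc, ← pow_succ']

lemma iterate_polyLap_radSq_pow_mul {l : ℕ} {h : Poly} (hh : h ∈ harmPoly l) (n : ℕ) :
    ∃ c : ℝ, 0 < c ∧ (polyLap ^ n) (radSq ^ n * h) = c • h := by
  induction n with
  | zero => exact ⟨1, one_pos, by simp⟩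
  | succ n ih =>
    obtain ⟨c, hc, hc'⟩ := ih
    obtain ⟨d, hd, hd'⟩ := polyLap_radSq_pow_mul hh n
    refine ⟨d * c, mul_pos hd hc, ?_⟩
    rw [pow_succ, Module.End.mul_apply, hd', map_smul, hc', smul_smul]

lemma iterate_polyLap_isHomogeneous {p : Poly} {d : ℕ} (hp : p.IsHomogeneous d) (n : ℕ) :
    ((polyLap ^ n) p).IsHomogeneous (d - 2 * n) := by
  induction n with
  | zero => simpa using hp
  | succ n ih =>
    rw [pow_succ', Module.End.mul_apply]
    convert polyLap_isHomogeneous ih using 1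
    omega

lemma polyLap_eq_zero_of_degree {p : Poly} {d : ℕ} (hp : p.IsHomogeneous d) (hd : d < 2) :
    polyLap p = 0 := by
  have h0 : ∀ {q : Poly} (i : Fin 3), q.IsHomogeneous 0 → MvPolynomial.pderiv i q = 0 := by
    intro q i hq
    rw [(MvPolynomial.totalDegree_eq_zero_iff_eq_C).mp
      (Nat.le_zero.mp hq.totalDegree_le)]
    exact MvPolynomial.pderiv_C
  rw [polyLap_apply]
  refine Finset.sum_eq_zero fun i _ => h0 i ?_
  have := hp.pderiv (i := i)
  rwa [show d - 1 = 0 by omega] at this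

lemma iterate_polyLap_eq_zero {p : Poly} {d n : ℕ} (hp : p.IsHomogeneous d) (h : d < 2 * n) :
    (polyLap ^ n) p = 0 := by
  obtain ⟨n, rfl⟩ : ∃ m, n = m + 1 := ⟨n - 1, by omega⟩
  rw [pow_succ', Module.End.mul_apply]
  exact polyLap_eq_zero_of_degree (iterate_polyLap_isHomogeneous hp n) (by omega)

/-! ## Polynomial functions and spherical harmonics -/

/-- Restriction of polynomials to the sphere. -/
def restr : Poly →ₐ[ℝ] SF := MvPolynomial.aeval X

lemma restr_X (i : Fin 3) : restr (MvPolynomial.X i) = X i := MvPolynomial.aeval_X _ _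

lemma restr_radSq : restr radSq = 1 := by
  simp [radSq, restr_X, sum_X_sq]

lemma restr_apply (p : Poly) (x : S2) :
    (restr p).1 x = MvPolynomial.eval (fun i => (x : E3) i) p := by
  induction p using MvPolynomial.induction_on with
  | C a => 
    rw [MvPolynomial.eval_C, restr, MvPolynomial.aeval_C]; rfl
  | add p q hp hq => simp [hp, hq]
  | mul_X p i hp => simp [hp, restr_X]

lemma D_restr (i : Fin 3) (p : Poly) : D i (restr p)
    = restr (MvPolynomial.pderiv i p) - X i * ∑ j, X j * restr (MvPolynomial.pderiv j p) := by
  induction p using MvPolynomial.induction_on with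
  | C a => simp [restr]
  | add p q hp hq =>
    simp only [map_add, hp, hq, mul_add, Finset.sum_add_distrib]
    ring
  | mul_X p k hp =>
    have h1 : ∀ j, restr (MvPolynomial.pderiv j (p * MvPolynomial.X k))
        = (if j = k then restr p else 0) + X k * restr (MvPolynomial.pderiv j p) := by
      intro j
      rw [Derivation.leibniz, MvPolynomial.pderiv_X]
      by_cases h : j = k
      · subst h; simp [restr_X]
      · simp [h, Ne.symm h, restr_X]
    have h2 : ∑ j, X j * restr (MvPolynomial.pderiv j (p * MvPolynomial.X k))
        = X k * restr p + X k * ∑ j, X j * restr (MvPolynomial.pderiv j p) := by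
      rw [Finset.sum_congr rfl fun j _ => by rw [h1 j, mul_add, mul_left_comm (X j) (X k)]]
      simp [Finset.sum_add_distrib, Finset.mul_sum]
    rw [h1, h2, map_mul, Derivation.leibniz, restr_X, D_X, hp, smul_eq_mul, smul_eq_mul, P]
    split_ifs <;> ring

/-- A smooth function as a tensor of rank zero. -/
def fn : SF →ₗ[ℝ] Tn 0 where
  toFun f _ := f
  map_add' _ _ := rfl
  map_smul' _ _ := rfl

@[simp] lemma fn_apply (f : SF) (I : Fin 0 → Fin 3) : fn f I = f := rfl

lemma fn_eval (T : Tn 0) : fn (T ![]) = T := ext_zero rfl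

/-- Euler's identity replaces radial derivatives by the degree, which separates the Euclidean
Laplacian into its spherical part and the multiple d(d+1). -/
lemma lapA_fn_restr {p : Poly} {d : ℕ} (hp : p.IsHomogeneous d) :
    lapA (fn (restr p)) = fn (restr (polyLap p)) - ev d • fn (restr p) := by
  have hE : ∀ {q : Poly} {n : ℕ}, q.IsHomogeneous n →
      ∑ j, X j * restr (MvPolynomial.pderiv j q) = (n : ℝ) • restr q := by
    intro q n hq
    have := congrArg restr hq.sum_X_mul_pderiv
    simpa [restr_X, Nat.cast_smul_eq_nsmul] using this
  have hD : ∀ i, D i (restr p) = restr (MvPolynomial.pderiv i p) - (d : ℝ) • (X i * restr p) := by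
    intro i
    rw [D_restr, hE hp, mul_smul_comm]
  have hDD : ∀ i, D i (D i (restr p))
      = restr (MvPolynomial.pderiv i (MvPolynomial.pderiv i p))
        - X i * (((d - 1 : ℕ) : ℝ) • restr (MvPolynomial.pderiv i p))
        - (d : ℝ) • (P i i * restr p + X i * D i (restr p)) := by
    intro i
    rw [hD i, map_sub, D_restr i (MvPolynomial.pderiv i p), hE (hp.pderiv (i := i)),
      Derivation.map_smul, Derivation.leibniz, D_X, hD i]
    simp only [smul_eq_mul]
    ring_nf
  refine ext_zero ?_
  rw [lapA_apply]
  simp only [Finset.sum_apply, cd_zero_apply, fn_apply, Pi.sub_apply, Pi.smul_apply, hDD]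
  simp only [mul_smul_comm, Finset.sum_sub_distrib, ← Finset.smul_sum, Finset.sum_add_distrib,
    hE hp, sum_X_D, ← Finset.sum_mul, sum_P_diag, polyLap_apply, map_sum, ev]
  -- Degree 0 is separate because the degree d - 1 of the first derivatives is a truncated
  -- subtraction.
  rcases Nat.eq_zero_or_pos d with rfl | hd
  · simp
  · have h2 : (2 : SF) * restr p = (2 : ℝ) • restr p := by rw [two_mul, two_smul]
    rw [Nat.cast_sub hd, Nat.cast_one, h2]
    module

/-- Scalar spherical harmonics of degree `l`, as smooth functions. -/
def harmA (l : ℕ) : Submodule ℝ (Tn 0) := (harmPoly l).map (fn ∘ₗ restr.toLinearMap)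

lemma mem_harmA {l : ℕ} {Y : Tn 0} : Y ∈ harmA l ↔ ∃ p ∈ harmPoly l, fn (restr p) = Y := by
  simp [harmA]

instance (l : ℕ) : FiniteDimensional ℝ (harmA l) := by
  unfold harmA; infer_instance

lemma harmA_le_E (l : ℕ) : harmA l ≤ E 0 l := by
  intro Y hY
  obtain ⟨p, hp, rfl⟩ := mem_harmA.mp hY
  rw [mem_harmPoly] at hp
  rw [mem_E]
  refine ⟨mem_Tan_zero _, ?_⟩
  rw [cas_apply, lapA_fn_restr hp.1, hp.2]
  simp

/-- The polynomial functions on the sphere. -/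
def polySF : Subalgebra ℝ SF := restr.range

lemma X_mem_polySF (i : Fin 3) : X i ∈ polySF := ⟨MvPolynomial.X i, restr_X i⟩

/-- Induction on the number of Laplacians that annihilate p. If n + 1 do, then q = Δⁿp is harmonic,
and a multiple of r²ⁿq can be subtracted from p so that the difference is killed by n of them. On
the sphere r²ⁿq restricts to q. -/
lemma fn_restr_mem_of_iterate (n : ℕ) : ∀ {d : ℕ} {p : Poly}, p.IsHomogeneous d →
    (polyLap ^ n) p = 0 → fn (restr p) ∈ ⨆ l, harmA l := by
  induction n with
  | zero =>
    intro d p _ h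
    simp only [pow_zero, Module.End.one_apply] at h
    simp [h]
  | succ n ih =>
    intro d p hp h
    -- For d < 2n, degree alone gives Δⁿp = 0; otherwise d - 2n is a genuine subtraction.
    by_cases hd : d < 2 * n
    · exact ih hp (iterate_polyLap_eq_zero hp hd)
    · have hh : (polyLap ^ n) p ∈ harmPoly (d - 2 * n) := by
        rw [mem_harmPoly]
        refine ⟨iterate_polyLap_isHomogeneous hp n, ?_⟩
        rwa [pow_succ', Module.End.mul_apply] at h
      obtain ⟨c, hc, hc'⟩ := iterate_polyLap_radSq_pow_mul hh n
      set q := (polyLap ^ n) p with hq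
      have h1 : (p - c⁻¹ • (radSq ^ n * q)).IsHomogeneous d := by
        refine hp.sub ?_
        have := (radSq_isHomogeneous.pow n).mul (mem_harmPoly.mp hh).1
        rw [show 2 * n + (d - 2 * n) = d by omega] at this
        exact (MvPolynomial.homogeneousSubmodule (Fin 3) ℝ d).smul_mem _ this
      have h2 := ih h1 (by rw [map_sub, map_smul, hc', smul_smul, inv_mul_cancel₀ hc.ne']; simp [hq])
      have h3 : fn (restr p) = fn (restr (p - c⁻¹ • (radSq ^ n * q))) + c⁻¹ • fn (restr q) := by
        simp [restr_radSq]
      rw [h3]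
      refine Submodule.add_mem _ h2 (Submodule.smul_mem _ _ ?_)
      exact Submodule.mem_iSup_of_mem _ (mem_harmA.mpr ⟨q, hh, rfl⟩)

/-- Polynomials on the sphere are sums of spherical harmonics. -/
lemma fn_mem_iSup_harmA {f : SF} (hf : f ∈ polySF) : fn f ∈ ⨆ l, harmA l := by
  obtain ⟨p, rfl⟩ := hf
  change fn (restr p) ∈ _
  rw [← MvPolynomial.sum_homogeneousComponent p, map_sum, map_sum]
  refine Submodule.sum_mem _ fun d _ => ?_
  have hp := MvPolynomial.homogeneousComponent_isHomogeneous d p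
  exact fn_restr_mem_of_iterate (d + 1) hp (iterate_polyLap_eq_zero hp (by omega))

lemma D_mem_polySF (i : Fin 3) {f : SF} (hf : f ∈ polySF) : D i f ∈ polySF := by
  obtain ⟨p, rfl⟩ := hf
  change D i (restr p) ∈ _
  rw [D_restr]
  exact polySF.sub_mem ⟨_, rfl⟩ (polySF.mul_mem (X_mem_polySF i)
    (polySF.sum_mem fun j _ => polySF.mul_mem (X_mem_polySF j) ⟨_, rfl⟩))

lemma P_mem_polySF (i j : Fin 3) : P i j ∈ polySF := by
  rw [P]
  refine polySF.sub_mem ?_ (polySF.mul_mem (X_mem_polySF i) (X_mem_polySF j))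
  split_ifs
  · exact polySF.one_mem
  · exact polySF.zero_mem

lemma eps_mem_polySF (i j : Fin 3) : eps i j ∈ polySF := by
  rw [eps]
  split_ifs
  · exact X_mem_polySF _
  · exact polySF.neg_mem (X_mem_polySF _)
  · exact polySF.zero_mem

/-! ## Polynomial tensors are sums of tensor harmonics -/

/-- The electric and magnetic 1-form harmonics of degree `l`. -/
def formA (l : ℕ) : Submodule ℝ (Tn 1) := ((harmA l).prod (harmA l)).map D1A

/-- The electric and magnetic tensor harmonics of degree `l`. -/
def tensA (l : ℕ) : Submodule ℝ (Tn 2) := (formA l).map D2A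

lemma mem_formA {l : ℕ} {V : Tn 1} :
    V ∈ formA l ↔ ∃ Y ∈ harmA l, ∃ Z ∈ harmA l, V = D1A (Y, Z) := by
  simp only [formA, Submodule.mem_map, Submodule.mem_prod, Prod.exists]
  constructor
  · rintro ⟨Y, Z, ⟨hY, hZ⟩, rfl⟩; exact ⟨Y, hY, Z, hZ, rfl⟩
  · rintro ⟨Y, hY, Z, hZ, rfl⟩; exact ⟨Y, Z, ⟨hY, hZ⟩, rfl⟩

lemma mem_tensA {l : ℕ} {S : Tn 2} :
    S ∈ tensA l ↔ ∃ Y ∈ harmA l, ∃ Z ∈ harmA l, S = D2A (D1A (Y, Z)) := by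
  simp only [tensA, Submodule.mem_map, mem_formA]
  constructor
  · rintro ⟨_, ⟨Y, hY, Z, hZ, rfl⟩, rfl⟩; exact ⟨Y, hY, Z, hZ, rfl⟩
  · rintro ⟨Y, hY, Z, hZ, rfl⟩; exact ⟨_, ⟨Y, hY, Z, hZ, rfl⟩, rfl⟩

instance (l : ℕ) : FiniteDimensional ℝ ((harmA l).prod (harmA l)) :=
  Module.Finite.iff_fg.mpr (Submodule.FG.prod (Module.Finite.iff_fg.mp inferInstance)
    (Module.Finite.iff_fg.mp inferInstance))

instance (l : ℕ) : FiniteDimensional ℝ (formA l) := by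
  unfold formA; infer_instance

instance (l : ℕ) : FiniteDimensional ℝ (tensA l) := by
  unfold tensA; infer_instance

lemma formA_le_E (l : ℕ) : formA l ≤ E 1 l := by
  intro V hV
  obtain ⟨Y, hY, Z, hZ, rfl⟩ := mem_formA.mp hV
  exact D1A_mem_E (harmA_le_E l hY) (harmA_le_E l hZ)

lemma tensA_le_E (l : ℕ) : tensA l ≤ E 2 l := by
  intro V hV
  obtain ⟨W, hW, rfl⟩ := hV
  exact D2A_mem_E (formA_le_E l hW)

/-- The gradients of the coordinate functions. -/
def dX (j : Fin 3) : Tn 1 := covA (fn (X j))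

lemma dX_apply (j a : Fin 3) : dX j ![a] = P a j := by
  rw [dX, covA_zero, fn_apply, D_X]

lemma J_dX_apply (j a : Fin 3) : J (dX j) ![a] = eps a j := by
  simp only [J_one, dX_apply, sum_eps_P]

lemma dX_mem (j : Fin 3) : dX j ∈ Tan 1 := covA_mem (mem_Tan_zero _)

lemma sum_P_D (a : Fin 3) (f : SF) : ∑ i, P a i * D i f = D a f := by
  have := congrFun (sum_P_slice a (covA (fn f)) (mem_Tan_succ.mp (covA_mem (mem_Tan_zero _))).1) ![]
  simpa [cd_zero_apply] using this

/-- Explicit Hodge potentials. Expanding eps eps in projections, J d of the second potential gives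
(Δf) dX_j minus d(D_j f) up to first-order terms, which `D_comm` removes. For an eigenfunction f
with nonzero eigenvalue this yields polynomial potentials of f dX_j. -/
lemma laplace_smul_dX (f : SF) (j : Fin 3) :
    (lapA (fn f) ![]) • dX j
      = D1A (fn (-D j f), fn (-∑ b, eps b j * D b f)) := by
  refine ext_one fun a => ?_
  have hlap : lapA (fn f) ![] = ∑ i, D i (D i f) := by simp [lapA_apply, cd_zero_apply]
  have h1 : ∀ m, ∑ b, eps a m * D m (eps b j * D b f)
      = eps a m * (X j * ∑ b, eps m b * D b f) + (∑ b, eps a m * eps b j * D m (D b f)) := by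
    intro m
    have hX : ∑ b, X b * D b f = 0 := sum_X_D f
    have : ∀ b, eps a m * D m (eps b j * D b f) = eps a m * X j * (eps m b * D b f)
        - eps a m * eps m j * (X b * D b f) + eps a m * eps b j * D m (D b f) := by
      intro b
      rw [Derivation.leibniz, D_eps, smul_eq_mul, smul_eq_mul, eps_anti m b]
      ring
    rw [Finset.sum_congr rfl fun b _ => this b, Finset.sum_add_distrib, Finset.sum_sub_distrib,
      ← Finset.mul_sum, ← Finset.mul_sum, hX]
    ring
  have h2 : ∑ m, eps a m * ∑ b, eps m b * D b f = - D a f := by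
    have := congrFun (J_J_one (covA_mem (mem_Tan_zero (fn f)))) ![a]
    simpa only [J_one, covA_zero, fn_apply, Pi.neg_apply] using this
  have h3 : ∑ m, ∑ b, eps a m * eps b j * D m (D b f)
      = D j (D a f) + X a * D j f - P a j * ∑ i, D i (D i f) := by
    have h4 : ∀ m b, eps a m * eps b j * D m (D b f)
        = P a b * (P j m * D m (D b f)) - P a j * (P b m * D m (D b f)) := by
      intro m b
      rw [eps_mul_eps, P_symm m j, P_symm m b]
      ring
    have h5 : ∑ b, P a b * D j (D b f) = D j (D a f) + X a * D j f := by
      have h6 : ∀ b, P a b * D j (D b f) = D j (P a b * D b f) + P j a * (X b * D b f)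
          + X a * (P j b * D b f) := by
        intro b
        rw [Derivation.leibniz, D_P, smul_eq_mul, smul_eq_mul]
        ring
      rw [Finset.sum_congr rfl fun b _ => h6 b, Finset.sum_add_distrib, Finset.sum_add_distrib,
        ← map_sum, ← Finset.mul_sum, ← Finset.mul_sum, sum_P_D, sum_P_D, sum_X_D]
      ring
    simp only [h4]
    rw [Finset.sum_comm]
    simp only [Finset.sum_sub_distrib, ← Finset.mul_sum, sum_P_D, h5]
  have h7 := D_comm a j f
  have h8 : ∑ m, eps a m * (X j * ∑ b, eps m b * D b f) = - X j * D a f := by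
    simp only [mul_left_comm (eps a _)]
    rw [← Finset.mul_sum, h2]
    ring
  have h9 : J (covA (fn (-∑ b, eps b j * D b f))) ![a]
      = - (- X j * D a f + (D j (D a f) + X a * D j f - P a j * ∑ i, D i (D i f))) := by
    rw [J_one]
    simp only [covA_zero, fn_apply]
    simp only [map_neg, map_sum, mul_neg, Finset.sum_neg_distrib]
    rw [← h3, ← h8, ← Finset.sum_add_distrib]
    congr 1
    refine Finset.sum_congr rfl fun m _ => ?_
    rw [Finset.mul_sum, h1]
  rw [D1A_apply, Pi.add_apply, h9, Pi.neg_apply, covA_zero, fn_apply, map_neg, Pi.smul_apply,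
    dX_apply, hlap, smul_eq_mul]
  linear_combination -h7

lemma formA_iSup_of_polySF {f g : SF} (hf : f ∈ polySF) (hg : g ∈ polySF) :
    D1A (fn f, fn g) ∈ ⨆ l, formA l := by
  have h1 : ∀ T ∈ ⨆ l, harmA l, D1A (T, 0) ∈ ⨆ l, formA l := by
    intro T hT
    refine Submodule.iSup_induction harmA (motive := fun T => D1A (T, 0) ∈ ⨆ l, formA l) hT
      (fun l Y hY => ?_) ?_ (fun Y Z hY hZ => ?_)
    · exact Submodule.mem_iSup_of_mem l (mem_formA.mpr ⟨Y, hY, 0, zero_mem _, rfl⟩)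
    · rw [show ((0 : Tn 0), (0 : Tn 0)) = 0 from rfl, map_zero]; exact zero_mem _
    · rw [show (Y + Z, (0 : Tn 0)) = (Y, 0) + (Z, 0) by simp, map_add]
      exact Submodule.add_mem _ hY hZ
  have h2 : ∀ T ∈ ⨆ l, harmA l, D1A (0, T) ∈ ⨆ l, formA l := by
    intro T hT
    refine Submodule.iSup_induction harmA (motive := fun T => D1A (0, T) ∈ ⨆ l, formA l) hT
      (fun l Y hY => ?_) ?_ (fun Y Z hY hZ => ?_)
    · exact Submodule.mem_iSup_of_mem l (mem_formA.mpr ⟨0, zero_mem _, Y, hY, rfl⟩)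
    · rw [show ((0 : Tn 0), (0 : Tn 0)) = 0 from rfl, map_zero]; exact zero_mem _
    · rw [show ((0 : Tn 0), Y + Z) = (0, Y) + (0, Z) by simp, map_add]
      exact Submodule.add_mem _ hY hZ
  rw [show (fn f, fn g) = (fn f, 0) + (0, fn g) by simp, map_add]
  exact Submodule.add_mem _ (h1 _ (fn_mem_iSup_harmA hf)) (h2 _ (fn_mem_iSup_harmA hg))

lemma harmA_polySF {l : ℕ} {Y : Tn 0} (hY : Y ∈ harmA l) : Y ![] ∈ polySF := by
  obtain ⟨p, _, rfl⟩ := mem_harmA.mp hY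
  exact ⟨p, rfl⟩

/-- It suffices to treat a harmonic Y. If its eigenvalue is nonzero, dividing `laplace_smul_dX` by
it writes Y dX_j as D₁⋆ of polynomials, which again split into harmonics. -/
lemma smul_dX_mem {f : SF} (hf : f ∈ polySF) (j : Fin 3) : f • dX j ∈ ⨆ l, formA l := by
  suffices h : ∀ T ∈ ⨆ l, harmA l, (T ![]) • dX j ∈ ⨆ l, formA l by
    simpa using h _ (fn_mem_iSup_harmA hf)
  intro T hT
  refine Submodule.iSup_induction harmA (motive := fun T => (T ![]) • dX j ∈ ⨆ l, formA l) hT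
      (fun l Y hY => ?_) ?_ (fun Y Z hY hZ => ?_)
  · have hE := harmA_le_E l hY
    by_cases hl : ev l = 0
    · have h1 := nsq_covA_add_of_mem_E hE
      rw [hl, zero_mul, J_zero_rank, nsq_zero, add_zero] at h1
      have h2 := eq_zero_of_nsq h1
      -- With eigenvalue zero, dY = 0 and hence Y dX_j = d(Y X_j).
      have h3 : (Y ![]) • dX j = D1A (fn (-(Y ![] * X j)), fn 0) := by
        refine ext_one fun a => ?_
        have h4 : D a (Y ![]) = 0 := by rw [← covA_zero, h2]; rfl
        rw [D1A_apply]
        simp [dX_apply, covA_zero, Derivation.leibniz, h4, D_X]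
      rw [h3]
      exact formA_iSup_of_polySF (polySF.neg_mem (polySF.mul_mem (harmA_polySF hY)
        (X_mem_polySF j))) polySF.zero_mem
    · have h1 := laplace_smul_dX (Y ![]) j
      rw [fn_eval, lapA_of_mem_E_zero hE] at h1
      have h2 : (Y ![]) • dX j = (- ev l)⁻¹ • ((- ev l • Y) ![]) • dX j := by
        rw [Pi.smul_apply, smul_assoc, smul_smul, inv_mul_cancel₀ (neg_ne_zero.mpr hl), one_smul]
      rw [h2, h1]
      refine Submodule.smul_mem _ _ (formA_iSup_of_polySF ?_ ?_)
      · exact polySF.neg_mem (D_mem_polySF j (harmA_polySF hY))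
      · exact polySF.neg_mem (polySF.sum_mem fun b _ => polySF.mul_mem (eps_mem_polySF _ _)
          (D_mem_polySF b (harmA_polySF hY)))
  · simp
  · rw [Pi.add_apply, add_smul]
    exact Submodule.add_mem _ hY hZ

lemma eq_sum_smul_dX {V : Tn 1} (hV : V ∈ Tan 1) : V = ∑ j, (V ![j]) • dX j := by
  refine ext_one fun a => ?_
  have h := congrFun (sum_P_slice a V (mem_Tan_succ.mp hV).1) ![]
  simp only [Finset.sum_apply, Pi.smul_apply, slice_one, smul_eq_mul] at h
  simp only [Finset.sum_apply, Pi.smul_apply, dX_apply, smul_eq_mul, ← h]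
  exact Finset.sum_congr rfl fun i _ => mul_comm _ _

lemma mem_iSup_formA {V : Tn 1} (hV : V ∈ Tan 1) (hp : ∀ a, V ![a] ∈ polySF) :
    V ∈ ⨆ l, formA l := by
  rw [eq_sum_smul_dX hV]
  exact Submodule.sum_mem _ fun j _ => smul_dX_mem (hp j) j

/-! ### Potentials of symmetric trace-free polynomial tensors -/

/-- The symmetric trace-free product of a 1-form with the gradient of a coordinate function. -/
def symProd (W : Tn 1) (j : Fin 3) : Tn 2 := fun I =>
  (W ![I 0]) * P (I 1) j + (W ![I 1]) * P (I 0) j - W ![j] * P (I 0) (I 1)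

lemma symProd_apply (W : Tn 1) (j a b : Fin 3) :
    symProd W j ![a, b] = (W ![a]) * P b j + (W ![b]) * P a j - W ![j] * P a b := rfl

/-- The Hessian of X_j is -X_j times the metric, so dX_j is conformal Killing and D₂⋆(f dX_j) only
sees df. -/
lemma D2A_smul_dX (f : SF) (j : Fin 3) :
    D2A (f • dX j) = (-(1 / 2) : ℝ) • symProd (covA (fn f)) j := by
  have hcov : ∀ a b, covA (f • dX j) ![a, b] = D a f * P b j - f * X j * P a b := by
    intro a b
    rw [covA_one, cd_smul]
    simp only [Pi.add_apply, Pi.smul_apply, smul_eq_mul, cd_one, dX_apply, D_P]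
    ring
  have hdiv : divA (f • dX j) ![] = D j f - 2 * f * X j := by
    rw [divA_one]
    simp only [← covA_one, hcov, Finset.sum_sub_distrib, ← Finset.mul_sum, sum_P_diag]
    have := sum_P_D j f
    simp only [P_symm j, mul_comm (P _ _)] at this
    rw [this]
    ring
  refine ext_two fun a b => ?_
  rw [D2A_apply]
  simp only [Pi.smul_apply, Pi.add_apply, Pi.sub_apply, hcov, hdiv, swapA_apply, metA_apply,
    symProd_apply, covA_zero, fn_apply, P_symm b a]
  congr 1
  ring

lemma P_mul_sub {W : Tn 1} (hW : W ∈ Tan 1) (i j m : Fin 3) :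
    P j m * W ![i] - P i m * W ![j] = eps j i * J W ![m] := by
  have h := fun a => congrFun (sum_P_slice a W (mem_Tan_succ.mp hW).1) ![]
  simp only [Finset.sum_apply, Pi.smul_apply, slice_one, smul_eq_mul] at h
  rw [J_one, Finset.mul_sum]
  simp only [← mul_assoc, eps_mul_eps, sub_mul, Finset.sum_sub_distrib]
  simp only [mul_assoc, mul_left_comm (P j _) (P i m)]
  simp only [← Finset.mul_sum, h]

/-- The field J dX_j generates a rotation and is Killing, so again only df enters; `P_mul_sub` moves
the rotation from dX_j to df. -/
lemma D2A_smul_J_dX (f : SF) (j : Fin 3) :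
    D2A (f • J (dX j)) = (-(1 / 2) : ℝ) • symProd (J (covA (fn f))) j := by
  have hcov : ∀ a b, covA (f • J (dX j)) ![a, b] = D a f * eps b j - f * X j * eps b a := by
    intro a b
    rw [covA_one, cd_smul]
    simp only [Pi.add_apply, Pi.smul_apply, smul_eq_mul, cd_one, J_dX_apply, D_eps]
    ring
  have hdiv : divA (f • J (dX j)) ![] = - J (covA (fn f)) ![j] := by
    rw [divA_one, J_one]
    simp only [← covA_one, hcov, eps_self, mul_zero, sub_zero, covA_zero, fn_apply,
      ← Finset.sum_neg_distrib]
    exact Finset.sum_congr rfl fun i _ => by rw [eps_anti j i]; ring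
  refine ext_two fun a b => ?_
  have hW := covA_mem (mem_Tan_zero (fn f))
  have h1 := P_mul_sub (J_mem hW) a j b
  have h2 := P_mul_sub (J_mem hW) b j a
  rw [J_J_one hW] at h1 h2
  simp only [Pi.neg_apply, covA_zero, fn_apply] at h1 h2
  rw [D2A_apply]
  simp only [Pi.smul_apply, Pi.add_apply, Pi.sub_apply, hcov, hdiv, swapA_apply, metA_apply,
    symProd_apply]
  congr 1
  rw [eps_anti b a, P_symm b j, P_symm a j]
  rw [eps_anti a j, P_symm b a] at *
  rw [eps_anti b j] at *
  linear_combination -h1 - h2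

/-- Combining the two previous formulas, the trace-free product of D₁⋆(f, g) with dX_j is itself in
the range of D₂⋆. -/
lemma symProd_D1A (f g : SF) (j : Fin 3) :
    symProd (D1A (fn f, fn g)) j = D2A ((2 : ℝ) • (f • dX j - g • J (dX j))) := by
  have h : symProd (D1A (fn f, fn g)) j
      = symProd (J (covA (fn g))) j - symProd (covA (fn f)) j := by
    refine ext_two fun a b => ?_
    rw [D1A_apply]
    simp only [symProd_apply, Pi.add_apply, Pi.neg_apply, Pi.sub_apply]
    ring
  rw [h, map_smul, map_sub, D2A_smul_dX, D2A_smul_J_dX]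
  module

lemma exists_D1A_of_mem_iSup {V : Tn 1} (hV : V ∈ ⨆ l, formA l) :
    ∃ f ∈ polySF, ∃ g ∈ polySF, V = D1A (fn f, fn g) := by
  refine Submodule.iSup_induction formA
    (motive := fun V => ∃ f ∈ polySF, ∃ g ∈ polySF, V = D1A (fn f, fn g)) hV
    (fun l V hV => ?_) ?_ ?_
  · obtain ⟨Y, hY, Z, hZ, rfl⟩ := mem_formA.mp hV
    exact ⟨_, harmA_polySF hY, _, harmA_polySF hZ, by rw [fn_eval, fn_eval]⟩
  · exact ⟨0, polySF.zero_mem, 0, polySF.zero_mem, by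
      rw [map_zero, show ((0 : Tn 0), (0 : Tn 0)) = 0 from rfl, map_zero]⟩
  · rintro V W ⟨f, hf, g, hg, rfl⟩ ⟨f', hf', g', hg', rfl⟩
    exact ⟨_, polySF.add_mem hf hf', _, polySF.add_mem hg hg', by
      rw [← map_add, map_add fn, map_add fn]; rfl⟩

/-- A symmetric trace-free tensor is half the sum over j of the trace-free products of its slices
with dX_j. Each slice is a polynomial 1-form, hence D₁⋆ of polynomials, and `symProd_D1A` makes each
product D₂⋆ of a polynomial 1-form. -/
lemma mem_iSup_tensA {S : Tn 2} (hS : S ∈ Tan 2) (hp : ∀ a b, S ![a, b] ∈ polySF)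
    (hsymm : ∀ a b, S ![a, b] = S ![b, a]) (htr : ∑ a, S ![a, a] = 0) :
    S ∈ ⨆ l, tensA l := by
  have hmap : ∀ W ∈ ⨆ l, formA l, D2A W ∈ ⨆ l, tensA l := by
    intro W hW
    have : D2A W ∈ (⨆ l, formA l).map D2A := Submodule.mem_map_of_mem hW
    rwa [Submodule.map_iSup] at this
  have hsum : S = (1 / 2 : ℝ) • ∑ j, symProd (slice j S) j := by
    refine ext_two fun a b => ?_
    have h := fun i c => congrFun (sum_P_slice i (slice c S)
      (mem_Tan_succ.mp ((mem_Tan_succ.mp hS).2 c)).1) ![]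
    simp only [Finset.sum_apply, Pi.smul_apply, slice_one, smul_eq_mul] at h
    have h1 : ∀ c d, ∑ j, S ![j, c] * P d j = S ![c, d] := by
      intro c d
      rw [← slice_two c d S, ← h d c]
      exact Finset.sum_congr rfl fun j _ => by rw [slice_two, hsymm j c, mul_comm]
    simp only [Pi.smul_apply, Finset.sum_apply, symProd_apply, slice_two,
      Finset.sum_sub_distrib, Finset.sum_add_distrib, ← Finset.sum_mul, htr, h1]
    rw [hsymm b a, zero_mul, sub_zero, ← two_smul ℝ, smul_smul]
    norm_num
  rw [hsum]
  refine Submodule.smul_mem _ _ (Submodule.sum_mem _ fun j _ => ?_)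
  have hj : slice j S ∈ ⨆ l, formA l :=
    mem_iSup_formA ((mem_Tan_succ.mp hS).2 j) fun a => hp j a
  obtain ⟨f, hf, g, hg, hfg⟩ := exists_D1A_of_mem_iSup hj
  rw [hfg, symProd_D1A]
  refine hmap _ (Submodule.smul_mem _ _ (Submodule.sub_mem _ (smul_dX_mem hf j) ?_))
  refine mem_iSup_formA ((Tan 1).smul_mem _ (J_mem (dX_mem j))) fun a => ?_
  rw [Pi.smul_apply, J_dX_apply]
  exact polySF.mul_mem hg (eps_mem_polySF _ _)

section

/-! ## Smooth tensors as fields -/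

section Projection

variable {R : Type*} [CommRing R]

/-- Application of a matrix to all slots. -/
def slotMul {k : ℕ} (p : Fin 3 → Fin 3 → R) (t : (Fin k → Fin 3) → R) (I : Fin k → Fin 3) : R :=
  ∑ J : Fin k → Fin 3, (∏ a, p (I a) (J a)) * t J

lemma slotMul_zero (p : Fin 3 → Fin 3 → R) (t : (Fin 0 → Fin 3) → R) : slotMul p t = t := by
  funext I
  rw [slotMul, Fintype.sum_unique]
  simp
  congr 1
  exact Subsingleton.elim _ _

lemma slotMul_cons {k : ℕ} (p : Fin 3 → Fin 3 → R) (t : (Fin (k + 1) → Fin 3) → R) (j : Fin 3)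
    (I : Fin k → Fin 3) :
    slotMul p t (Fin.cons j I) = ∑ i, p j i * slotMul p (fun J => t (Fin.cons i J)) I := by
  simp only [slotMul, Finset.mul_sum]
  rw [← Fintype.sum_prod_type' (f := fun (i : Fin 3) (J : Fin k → Fin 3) =>
    p j i * ((∏ a, p (I a) (J a)) * t (Fin.cons i J)))]
  refine (Fintype.sum_equiv (Fin.consEquiv fun _ : Fin (k + 1) => Fin 3) _ _ fun x => ?_).symm
  rw [Fin.prod_univ_succ]
  simp [Fin.consEquiv, mul_assoc]

lemma slotMul_sum_mul {k : ℕ} (p : Fin 3 → Fin 3 → R) (c : Fin 3 → R)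
    (t : Fin 3 → (Fin k → Fin 3) → R) (I : Fin k → Fin 3) :
    slotMul p (fun J => ∑ i, c i * t i J) I = ∑ i, c i * slotMul p (t i) I := by
  simp only [slotMul, Finset.mul_sum]
  rw [Finset.sum_comm]
  exact Finset.sum_congr rfl fun i _ => Finset.sum_congr rfl fun J _ => by ring

/-- Contractions of all slots with a vector vanish. -/
def SlotTangent {k : ℕ} (x : Fin 3 → R) (t : (Fin k → Fin 3) → R) : Prop :=
  ∀ (a : Fin k) (I : Fin k → Fin 3), ∑ j, x j * t (Function.update I a j) = 0

lemma slotTangent_succ {k : ℕ} {x : Fin 3 → R} {t : (Fin (k + 1) → Fin 3) → R} :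
    SlotTangent x t ↔ (∀ I, ∑ j, x j * t (Fin.cons j I) = 0) ∧
      ∀ j, SlotTangent x fun I => t (Fin.cons j I) := by
  constructor
  · refine fun h => ⟨fun I => ?_, fun j a I => ?_⟩
    · simpa [Fin.update_cons_zero] using h 0 (Fin.cons 0 I)
    · simpa [← Fin.cons_update] using h a.succ (Fin.cons j I)
  · rintro ⟨h1, h2⟩ a I
    obtain ⟨i, I, rfl⟩ : ∃ i I', I = Fin.cons i I' := ⟨I 0, Fin.tail I, (Fin.cons_self_tail I).symm⟩
    refine Fin.cases ?_ (fun b => ?_) a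
    · simpa [Fin.update_cons_zero] using h1 I
    · simpa [← Fin.cons_update] using h2 i b I

variable {x : Fin 3 → R}

lemma slotMul_of_slotTangent {k : ℕ} {t : (Fin k → Fin 3) → R} (h : SlotTangent x t) :
    slotMul (complMat x) t = t := by
  induction k with
  | zero => exact slotMul_zero _ _
  | succ k ih =>
    rw [slotTangent_succ] at h
    funext I
    rw [← Fin.cons_self_tail I, slotMul_cons]
    simp only [ih (h.2 _)]
    have : ∀ i, complMat x (I 0) i * t (Fin.cons i (Fin.tail I))
        = (if I 0 = i then t (Fin.cons i (Fin.tail I)) else 0)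
          - x (I 0) * (x i * t (Fin.cons i (Fin.tail I))) := by
      intro i; rw [complMat]; split_ifs <;> ring
    rw [Finset.sum_congr rfl fun i _ => this i]
    simp [Finset.sum_sub_distrib, ← Finset.mul_sum, h.1]

lemma slotTangent_slotMul (hx : ∑ i, x i * x i = 1) {k : ℕ} (t : (Fin k → Fin 3) → R) :
    SlotTangent x (slotMul (complMat x) t) := by
  induction k with
  | zero => exact fun a => a.elim0
  | succ k ih =>
    rw [slotTangent_succ]
    refine ⟨fun I => ?_, fun j => ?_⟩
    · simp only [slotMul_cons, Finset.mul_sum]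
      rw [Finset.sum_comm]
      simp only [← mul_assoc, ← Finset.sum_mul]
      refine Finset.sum_eq_zero fun i _ => ?_
      have h2 : ∀ j, x j * complMat x j i = (if j = i then x j else 0) - (x j * x j) * x i := by
        intro j; rw [complMat]; split_ifs <;> ring
      rw [Finset.sum_congr rfl fun j _ => h2 j, Finset.sum_sub_distrib, ← Finset.sum_mul, hx]
      simp
    · intro a I
      simp only [slotMul_cons, Finset.mul_sum]
      rw [Finset.sum_comm]
      refine Finset.sum_eq_zero fun i _ => ?_
      have := ih (fun J => t (Fin.cons i J)) a I
      simp only [mul_left_comm (x _), ← Finset.mul_sum, this, mul_zero]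

end Projection

lemma mem_Tan_iff_slotTangent {k : ℕ} {T : Tn k} : T ∈ Tan k ↔ SlotTangent X T := by
  induction k with
  | zero => exact ⟨fun _ a => a.elim0, fun _ => mem_Tan_zero _⟩
  | succ k ih =>
    rw [mem_Tan_succ, slotTangent_succ]
    refine and_congr ⟨fun h I => ?_, fun h => ?_⟩ (forall_congr' fun j => ih)
    · simpa [slice_apply] using congrFun h I
    · funext I
      simpa [slice_apply] using h I

/-- The projection of all slots to the tangent plane. -/
def projA {k : ℕ} (T : Tn k) : Tn k := slotMul P T

lemma projA_mem {k : ℕ} (T : Tn k) : projA T ∈ Tan k :=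
  mem_Tan_iff_slotTangent.mpr (slotTangent_slotMul sum_X_sq T)

lemma projA_of_mem {k : ℕ} {T : Tn k} (hT : T ∈ Tan k) : projA T = T :=
  slotMul_of_slotTangent (mem_Tan_iff_slotTangent.mp hT)

lemma slice_projA {k : ℕ} (j : Fin 3) (T : Tn (k + 1)) :
    slice j (projA T) = projA (∑ i, P j i • slice i T) := by
  funext I
  refine (slotMul_cons P T j I).trans ?_
  rw [← slotMul_sum_mul]
  simp only [projA]
  congr 1

lemma projA_add {k : ℕ} (T U : Tn k) : projA (T + U) = projA T + projA U := by
  funext I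
  simp [projA, slotMul, mul_add, Finset.sum_add_distrib]

lemma projA_smul {k : ℕ} (f : SF) (T : Tn k) : projA (f • T) = f • projA T := by
  funext I
  simp [projA, slotMul, mul_left_comm _ f, Finset.mul_sum]

/-- Differentiating P_jm T_m = T_j moves the derivative onto the projection, and D P supplies the
correction term of `cd`, slot by slot. This identifies the algebraic `cd` with the geometric
derivative. -/
lemma projA_D {k : ℕ} (i : Fin 3) {T : Tn k} (hT : T ∈ Tan k) :
    projA (fun I => D i (T I)) = cd i T := by
  induction k with
  | zero =>
    rw [projA_of_mem (mem_Tan_zero _)]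
    funext I
    rw [cd_zero_apply]
  | succ k ih =>
    refine ext_slice fun j => ?_
    obtain ⟨h1, h2⟩ := mem_Tan_succ.mp hT
    have h3 : ∑ m, P j m • slice m (fun I => D i (T I) : Tn (k + 1))
        = (fun I => D i (slice j T I)) + X j • slice i T := by
      have h4 := sum_P_slice j T h1
      have h5 := sum_P_slice i T h1
      funext I
      have h6 : ∀ m, P j m * D i (slice m T I) = D i (P j m * slice m T I)
          + P i j * (X m * slice m T I) + X j * (P i m * slice m T I) := by
        intro m
        rw [Derivation.leibniz, D_P, smul_eq_mul, smul_eq_mul]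
        ring
      have h4' := congrFun h4 I
      have h5' := congrFun h5 I
      have h1' := congrFun h1 I
      simp only [Finset.sum_apply, Pi.smul_apply, smul_eq_mul, Pi.zero_apply] at h4' h5' h1'
      simp only [Finset.sum_apply, Pi.smul_apply, smul_eq_mul, Pi.add_apply]
      refine (Finset.sum_congr rfl fun m _ => h6 m).trans ?_
      rw [Finset.sum_add_distrib, Finset.sum_add_distrib, ← map_sum, ← Finset.mul_sum,
        ← Finset.mul_sum, h4', h5', h1']
      ring
    rw [slice_projA, h3, projA_add, projA_smul, ih (h2 j), projA_of_mem (h2 i), slice_cd]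

lemma projA_ambient {k : ℕ} {T : Tn k} (hT : T ∈ Tan k) :
    projA (fun I : Fin (k + 1) → Fin 3 => D (I 0) (T (Fin.tail I))) = covA T := by
  refine ext_slice fun j => ?_
  rw [slice_projA, slice_covA]
  have h1 : ∀ i, slice i (fun I : Fin (k + 1) → Fin 3 => D (I 0) (T (Fin.tail I)))
      = fun I => D i (T I) := fun i => rfl
  have h2 : projA (∑ i, P j i • (fun I => D i (T I) : Tn k))
      = ∑ i, P j i • projA (fun I => D i (T I) : Tn k) := by
    funext I
    simp only [Finset.sum_apply, Pi.smul_apply, smul_eq_mul, projA]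
    rw [← slotMul_sum_mul]
    congr 1
  simp only [h1]
  rw [h2]
  simp only [projA_D _ hT]
  have := sum_P_slice j (covA T) (mem_Tan_succ.mp (covA_mem hT)).1
  simpa using this

/-- The tensor field with given smooth components. -/
def fld {k : ℕ} : Tn k →ₗ[ℝ] TField k where
  toFun T x := WithLp.toLp 2 fun I => (T I).1 x
  map_add' _ _ := rfl
  map_smul' _ _ := rfl

@[simp] lemma fld_apply {k : ℕ} (T : Tn k) (x : S2) (I : Fin k → Fin 3) :
    fld T x I = (T I).1 x := rfl

lemma P_apply (i j : Fin 3) (x : S2) : (P i j).1 x = proj x i j := by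
  rw [P, proj]
  split_ifs <;> simp

lemma isTangent_fld {k : ℕ} {T : Tn k} : T ∈ Tan k ↔ ∀ x, IsTangent x (fld T x) := by
  rw [mem_Tan_iff_slotTangent]
  have h : ∀ (x : S2) (a : Fin k) (I : Fin k → Fin 3),
      (∑ j, X j * T (Function.update I a j)).1 x
        = ∑ j, (x : E3) j * fld T x (Function.update I a j) := by
    intro x a I
    simp
  constructor
  · intro hT x a I
    rw [← h, hT a I]; rfl
  · intro hT a I
    ext x
    rw [h, hT x a I]; rfl

lemma radialExt_apply {k : ℕ} (T : TField k) (y : E3) (I : Fin k → Fin 3) :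
    radialExt T y I = ext (fun x => T x I) y := by
  by_cases h : y = 0 <;> simp [radialExt, ext, h]

lemma isSmooth_iff {k : ℕ} {T : TField k} : IsSmooth T ↔ ∀ I, (fun x => T x I) ∈ smoothFn := by
  rw [IsSmooth, contDiffOn_euclidean]
  simp only [radialExt_apply]
  rfl

lemma isSmooth_fld {k : ℕ} (T : Tn k) : IsSmooth (fld T) :=
  isSmooth_iff.mpr fun I => (T I).2

lemma exists_fld {k : ℕ} {W : TField k} (hW : IsSmooth W) : ∃ T : Tn k, fld T = W :=
  ⟨fun I => ⟨_, isSmooth_iff.mp hW I⟩, rfl⟩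

lemma classicalCov_fld {k : ℕ} {T : Tn k} (hT : T ∈ Tan k) :
    classicalCov (fld T) = fld (covA T) := by
  funext x
  ext I
  rw [← projA_ambient hT, fld_apply, classicalCov, projTens]
  have h : ∀ J : Fin (k + 1) → Fin 3,
      (fderiv ℝ (radialExt (fld T)) (x : E3) (EuclideanSpace.single (J 0) 1)) (Fin.tail J)
        = (D (J 0) (T (Fin.tail J))).1 x := by
    intro J
    have hd : DifferentiableAt ℝ (radialExt (fld T)) (x : E3) :=
      ((isSmooth_fld T).contDiffAt
        (isOpen_punctured.mem_nhds (sphere_ne_zero x))).differentiableAt (by simp)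
    have h1 := ((EuclideanSpace.proj (Fin.tail J) : Tens k →L[ℝ] ℝ).hasFDerivAt.comp
      (x : E3) hd.hasFDerivAt).fderiv
    rw [D_apply]
    have h2 : ext (T (Fin.tail J)).1
        = (EuclideanSpace.proj (Fin.tail J) : Tens k →L[ℝ] ℝ) ∘ radialExt (fld T) := by
      funext y
      exact (radialExt_apply (fld T) y (Fin.tail J)).symm
    rw [h2, h1]
    rfl
  simp only [projA, slotMul]
  rw [SF.val_sum, Finset.sum_apply]
  refine Finset.sum_congr rfl fun J _ => ?_
  rw [SF.val_mul, Pi.mul_apply, ← h J]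
  congr 1
  have h3 : ∀ s : Finset (Fin (k + 1)),
      ∏ a ∈ s, proj x (I a) (J a) = (∏ a ∈ s, P (I a) (J a)).1 x := by
    intro s
    induction s using Finset.induction_on with
    | empty => simp
    | insert a s ha ih => simp [Finset.prod_insert ha, ih, P_apply]
  exact h3 _

lemma tr_fld {k : ℕ} (T : Tn (k + 2)) (x : S2) : tr (fld T x) = fld (trA T) x := by
  ext I
  simp [tr, trA_apply, slice_apply]

lemma isTangent_iff {k : ℕ} {x : S2} {t : Tens k} : IsTangent x t ↔ projTens x t = t := by
  have hx : ∑ i, (x : E3) i * (x : E3) i = 1 := by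
    have := congrArg (fun f : SF => f.1 x) sum_X_sq
    simpa using this
  have h : ∀ I, projTens x t I = slotMul (complMat fun i => (x : E3) i) t.ofLp I := fun I => rfl
  constructor
  · intro ht
    ext I
    rw [h]
    exact congrFun (slotMul_of_slotTangent (x := fun i => (x : E3) i) ht) I
  · intro ht
    rw [← ht]
    exact slotTangent_slotMul hx t.ofLp

end

/-! ## Square-integrable tensor fields -/

lemma continuous_fld {k : ℕ} (T : Tn k) : Continuous (fld T) :=
  (PiLp.continuous_toLp 2 _).comp (continuous_pi fun I => (T I).continuous)

lemma memLp_fld {k : ℕ} (T : Tn k) : MemLp (fld T) 2 σ := by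
  obtain ⟨c, hc⟩ := (isCompact_range (continuous_fld T)).isBounded.exists_norm_le
  exact MemLp.of_bound (continuous_fld T).aestronglyMeasurable c
    (Eventually.of_forall fun x => hc _ ⟨x, rfl⟩)

/-- Smooth tensor fields as elements of `L²`. -/
def emb {k : ℕ} : Tn k →ₗ[ℝ] Lp (Tens k) 2 σ where
  toFun T := (memLp_fld T).toLp (fld T)
  map_add' _ _ := rfl
  map_smul' _ _ := rfl

lemma coeFn_emb {k : ℕ} (T : Tn k) : emb T =ᵐ[σ] fld T := (memLp_fld T).coeFn_toLp

lemma inner_fld {k : ℕ} (T : TField k) (U : Tn k) (x : S2) :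
    inner ℝ (T x) (fld U x) = ∑ I, T x I * (U I).1 x := by
  simp [PiLp.inner_apply, mul_comm]

lemma integral_inner_fld {k : ℕ} (T U : Tn k) : ∫ x, inner ℝ (fld T x) (fld U x) ∂σ = pair T U := by
  rw [pair, integ_apply]
  congr 1
  ext x
  rw [inner_fld]
  simp [ip]

lemma inner_toLp {k : ℕ} {T U : TField k} (hT : MemLp T 2 σ) (hU : MemLp U 2 σ) :
    inner ℝ (hT.toLp T) (hU.toLp U) = ∫ x, inner ℝ (T x) (U x) ∂σ := by
  rw [L2.inner_def]
  refine integral_congr_ae ?_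
  filter_upwards [hT.coeFn_toLp, hU.coeFn_toLp] with x h1 h2
  rw [h1, h2]

lemma inner_emb {k : ℕ} (T U : Tn k) : inner ℝ (emb T) (emb U) = pair T U :=
  (inner_toLp (memLp_fld T) (memLp_fld U)).trans (integral_inner_fld T U)

lemma norm_emb_sq {k : ℕ} (T : Tn k) : ‖emb T‖ ^ 2 = nsq T := by
  rw [← real_inner_self_eq_norm_sq, inner_emb, nsq]

lemma emb_injective {k : ℕ} : Function.Injective (emb (k := k)) := by
  rw [← LinearMap.ker_eq_bot, LinearMap.ker_eq_bot']
  intro T hT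
  refine eq_zero_of_nsq ?_
  rw [← norm_emb_sq, hT]
  simp

/-! ### Operators of order zero -/

/-- Matrices of smooth functions acting on tensor components. -/
abbrev Mat (m k : ℕ) := (Fin m → Fin 3) → (Fin k → Fin 3) → SF

/-- Application of a matrix of smooth functions to a smooth tensor. -/
def matA {m k : ℕ} (M : Mat m k) : Tn k →ₗ[ℝ] Tn m where
  toFun T I := ∑ J, M I J * T J
  map_add' T U := by funext I; simp [mul_add, Finset.sum_add_distrib]
  map_smul' c T := by funext I; simp [Finset.smul_sum]

lemma matA_apply {m k : ℕ} (M : Mat m k) (T : Tn k) (I : Fin m → Fin 3) :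
    matA M T I = ∑ J, M I J * T J := rfl

/-- Application of a matrix of smooth functions to a tensor field. -/
def matF {m k : ℕ} (M : Mat m k) (T : TField k) : TField m := fun x =>
  WithLp.toLp 2 fun I => ∑ J, (M I J).1 x * T x J

lemma matF_apply {m k : ℕ} (M : Mat m k) (T : TField k) (x : S2) (I : Fin m → Fin 3) :
    matF M T x I = ∑ J, (M I J).1 x * T x J := rfl

lemma matF_fld {m k : ℕ} (M : Mat m k) (T : Tn k) : matF M (fld T) = fld (matA M T) := by
  funext x
  ext I
  simp [matF_apply, matA_apply]

lemma matF_add {m k : ℕ} (M : Mat m k) (T U : TField k) : matF M (T + U) = matF M T + matF M U := by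
  funext x
  ext I
  simp [matF_apply, mul_add, Finset.sum_add_distrib]

lemma matF_smul {m k : ℕ} (M : Mat m k) (c : ℝ) (T : TField k) : matF M (c • T) = c • matF M T := by
  funext x
  ext I
  simp [matF_apply, Finset.mul_sum, mul_left_comm]

lemma matF_congr {m k : ℕ} (M : Mat m k) {T U : TField k} (h : T =ᵐ[σ] U) :
    matF M T =ᵐ[σ] matF M U := by
  filter_upwards [h] with x hx
  ext I
  simp only [matF_apply, hx]

lemma abs_apply_le {k : ℕ} (t : Tens k) (I : Fin k → Fin 3) : |t I| ≤ ‖t‖ := by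
  simpa using PiLp.norm_apply_le t I

lemma norm_le_sum_abs {k : ℕ} (t : Tens k) : ‖t‖ ≤ ∑ I, |t I| := by
  rw [EuclideanSpace.norm_eq]
  refine Real.sqrt_le_iff.mpr ⟨Finset.sum_nonneg fun _ _ => abs_nonneg _, ?_⟩
  simpa using Finset.sum_sq_le_sq_sum_of_nonneg (s := Finset.univ) (f := fun I => |t I|)
    fun _ _ => abs_nonneg _

lemma exists_matF_bound {m k : ℕ} (M : Mat m k) :
    ∃ c : ℝ, 0 ≤ c ∧ ∀ (T : TField k) (x : S2), ‖matF M T x‖ ≤ c * ‖T x‖ := by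
  choose c hc0 hc using fun I J => (M I J).exists_bound
  refine ⟨∑ I, ∑ J, c I J, Finset.sum_nonneg fun I _ => Finset.sum_nonneg fun J _ => hc0 I J,
    fun T x => (norm_le_sum_abs _).trans ?_⟩
  rw [Finset.sum_mul]
  refine Finset.sum_le_sum fun I _ => ?_
  rw [Finset.sum_mul, matF_apply]
  refine (Finset.abs_sum_le_sum_abs _ _).trans (Finset.sum_le_sum fun J _ => ?_)
  rw [abs_mul]
  exact mul_le_mul (hc I J x) (abs_apply_le _ _) (abs_nonneg _) (hc0 I J)

lemma memLp_matF {m k : ℕ} (M : Mat m k) {T : TField k} (hT : MemLp T 2 σ) :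
    MemLp (matF M T) 2 σ := by
  obtain ⟨c, -, hc⟩ := exists_matF_bound M
  refine hT.of_le_mul ?_ (Eventually.of_forall (hc T))
  have h : AEStronglyMeasurable (fun x => fun I => ∑ J, (M I J).1 x * T x J) σ := by
    refine (aemeasurable_pi_lambda _ fun I => ?_).aestronglyMeasurable
    refine Finset.aemeasurable_fun_sum _ fun J _ => ?_
    refine (M I J).continuous.measurable.aemeasurable.mul ?_
    exact ((EuclideanSpace.proj J : Tens k →L[ℝ] ℝ).continuous.comp_aestronglyMeasurable
      hT.1).aemeasurable
  exact (PiLp.continuous_toLp 2 _).comp_aestronglyMeasurable h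

/-- Application of a matrix of smooth functions as a bounded operator on `L²`. -/
def matLp {m k : ℕ} (M : Mat m k) : Lp (Tens k) 2 σ →L[ℝ] Lp (Tens m) 2 σ :=
  LinearMap.mkContinuousOfExistsBound
    { toFun F := (memLp_matF M (Lp.memLp F)).toLp _
      map_add' F G := by
        rw [← MemLp.toLp_add]
        refine MemLp.toLp_congr _ _ ?_
        rw [← matF_add]
        exact matF_congr M (Lp.coeFn_add F G)
      map_smul' c F := by
        rw [RingHom.id_apply, ← MemLp.toLp_const_smul]
        refine MemLp.toLp_congr _ _ ?_
        rw [← matF_smul]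
        exact matF_congr M (Lp.coeFn_smul c F) } <| by
    obtain ⟨c, -, hc⟩ := exists_matF_bound M
    refine ⟨c, fun F => Lp.norm_le_mul_norm_of_ae_le_mul ?_⟩
    filter_upwards [(memLp_matF M (Lp.memLp F)).coeFn_toLp] with x hx
    exact (congrArg norm hx).trans_le (hc F x)

lemma matLp_toLp {m k : ℕ} (M : Mat m k) {T : TField k} (hT : MemLp T 2 σ) :
    matLp M (hT.toLp T) = (memLp_matF M hT).toLp _ :=
  MemLp.toLp_congr (memLp_matF M (Lp.memLp _)) _ (matF_congr M hT.coeFn_toLp)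

lemma matLp_emb {m k : ℕ} (M : Mat m k) (T : Tn k) : matLp M (emb T) = emb (matA M T) := by
  refine (matLp_toLp M (memLp_fld T)).trans (MemLp.toLp_congr _ (memLp_fld _) ?_)
  rw [matF_fld]

/-! ### Density of the polynomial tensors -/

/-- Tensors with polynomial components. -/
def polyTn (k : ℕ) : Submodule ℝ (Tn k) where
  carrier := {T | ∀ I, T I ∈ polySF}
  zero_mem' _ := polySF.zero_mem
  add_mem' h h' I := polySF.add_mem (h I) (h' I)
  smul_mem' c _ h I := polySF.smul_mem (h I) c

lemma matA_mem_polyTn {m k : ℕ} {M : Mat m k} (hM : ∀ I J, M I J ∈ polySF) {T : Tn k}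
    (hT : T ∈ polyTn k) : matA M T ∈ polyTn m := fun I =>
  polySF.sum_mem fun J _ => polySF.mul_mem (hM I J) (hT J)

/-- Smooth functions as continuous functions. -/
def SF.toC : SF →ₐ[ℝ] C(S2, ℝ) where
  toFun f := ⟨f.1, f.continuous⟩
  map_one' := rfl
  map_mul' _ _ := rfl
  map_zero' := rfl
  map_add' _ _ := rfl
  commutes' _ := rfl

@[simp] lemma SF.toC_apply (f : SF) (x : S2) : SF.toC f x = f.1 x := rfl

lemma dense_polySF (f : C(S2, ℝ)) : f ∈ (polySF.map SF.toC).topologicalClosure := by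
  refine ContinuousMap.continuousMap_mem_subalgebra_closure_of_separatesPoints _ ?_ f
  intro x y hxy
  by_contra h
  push Not at h
  refine hxy (Subtype.ext ?_)
  ext i
  exact h _ ⟨SF.toC (X i), ⟨X i, X_mem_polySF i, rfl⟩, rfl⟩

lemma dense_polyTn (k : ℕ) : ((polyTn k).map emb).topologicalClosure = ⊤ := by
  rw [eq_top_iff]
  have hd := ContinuousMap.toLp_denseRange (p := 2) (Tens k) σ ℝ (by simp)
  have hsub : Set.range (ContinuousMap.toLp (E := Tens k) 2 σ ℝ)
      ⊆ ((polyTn k).map emb).topologicalClosure := by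
    rintro _ ⟨g, rfl⟩
    let L : (Fin k → Fin 3) → C(S2, ℝ) →L[ℝ] Lp (Tens k) 2 σ := fun I =>
      (ContinuousMap.toLp (E := Tens k) 2 σ ℝ).comp
        (ContinuousLinearMap.compLeftContinuous ℝ S2
          ((ContinuousLinearMap.id ℝ ℝ).smulRight (EuclideanSpace.single I (1 : ℝ))))
    have hg : ContinuousMap.toLp (E := Tens k) 2 σ ℝ g
        = ∑ I, L I ⟨fun x => g x I, by fun_prop⟩ := by
      simp only [L, ContinuousLinearMap.comp_apply, ← map_sum]
      congr 1
      ext x J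
      simp [Pi.single_apply]
    rw [hg]
    refine Submodule.sum_mem _ fun I _ => ?_
    have hmaps : Set.MapsTo (L I) (polySF.map SF.toC : Set C(S2, ℝ))
        ((polyTn k).map emb : Set (Lp (Tens k) 2 σ)) := by
      rintro _ ⟨f, hf, rfl⟩
      refine ⟨Pi.single I f, fun J => ?_, ?_⟩
      · by_cases h : J = I
        · subst h; simpa using hf
        · simp [Pi.single_eq_of_ne h]
      · refine (MemLp.toLp_eq_toLp_iff (memLp_fld _) (Lp.memLp _)).mpr ?_ |>.trans (Lp.toLp_coeFn _ _)
        refine EventuallyEq.trans (Eventually.of_forall fun x => ?_)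
          (ContinuousMap.coeFn_toLp (𝕜 := ℝ) σ _).symm
        ext J
        by_cases h : J = I
        · subst h; simp
        · simp [h]
    exact (hmaps.closure (L I).continuous) (dense_polySF _)
  intro F _
  exact closure_minimal hsub (Submodule.isClosed_topologicalClosure _) (hd F)

/-! ### Tangential projection -/

/-- The matrix of the projection of all slots to the tangent plane. -/
def projMat (k : ℕ) : Mat k k := fun I J => ∏ a, P (I a) (J a)

lemma matA_projMat {k : ℕ} (T : Tn k) : matA (projMat k) T = projA T := rfl

lemma projMat_apply {k : ℕ} (I J : Fin k → Fin 3) (x : S2) :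
    (projMat k I J).1 x = ∏ a, proj x (I a) (J a) := by
  have h3 : ∀ s : Finset (Fin k),
      (∏ a ∈ s, P (I a) (J a)).1 x = ∏ a ∈ s, proj x (I a) (J a) := by
    intro s
    induction s using Finset.induction_on with
    | empty => simp
    | insert a s ha ih => simp [Finset.prod_insert ha, ih, P_apply]
  exact h3 _

lemma projMat_mem_polySF {k : ℕ} (I J : Fin k → Fin 3) : projMat k I J ∈ polySF :=
  polySF.prod_mem fun _ _ => P_mem_polySF _ _

lemma matF_projMat {k : ℕ} (T : TField k) (x : S2) : matF (projMat k) T x = projTens x (T x) := by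
  ext I
  simp only [matF_apply, projMat_apply, projTens]

lemma ae_isTangent_iff {k : ℕ} {T : TField k} :
    (∀ᵐ x ∂σ, IsTangent x (T x)) ↔ matF (projMat k) T =ᵐ[σ] T :=
  eventually_congr (Eventually.of_forall fun x => by rw [isTangent_iff, matF_projMat])

lemma inner_matF_projMat {k : ℕ} (T U : TField k) (x : S2) :
    inner ℝ (matF (projMat k) T x) (U x) = inner ℝ (T x) (matF (projMat k) U x) := by
  have h : ∀ I J, (projMat k I J).1 x = (projMat k J I).1 x := by
    intro I J
    rw [projMat, projMat]
    simp only [P_symm]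
  simp only [PiLp.inner_apply, matF_apply, RCLike.inner_apply, conj_trivial, Finset.sum_mul,
    Finset.mul_sum]
  rw [Finset.sum_comm]
  refine Finset.sum_congr rfl fun J _ => Finset.sum_congr rfl fun I _ => ?_
  rw [h I J]
  ring

section

/-! ## Expansions into eigentensors -/

section Hilbert

variable {H : Type*} [NormedAddCommGroup H] [InnerProductSpace ℝ H]

lemma norm_sum_sq_of_orthogonal {v : ℕ → H} (hv : ∀ i j, i ≠ j → inner ℝ (v i) (v j) = 0)
    (s : Finset ℕ) : ‖∑ i ∈ s, v i‖ ^ 2 = ∑ i ∈ s, ‖v i‖ ^ 2 := by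
  rw [← real_inner_self_eq_norm_sq, sum_inner]
  refine Finset.sum_congr rfl fun i hi => ?_
  rw [inner_sum, Finset.sum_eq_single_of_mem i hi fun j _ hj => hv i j hj.symm,
    real_inner_self_eq_norm_sq]

lemma inner_hasSum_of_orthogonal {v : ℕ → H} (hv : ∀ i j, i ≠ j → inner ℝ (v i) (v j) = 0) {x : H}
    (hx : HasSum v x) (i : ℕ) : inner ℝ x (v i) = ‖v i‖ ^ 2 := by
  have h1 : HasSum (fun j => inner ℝ (v i) (v j)) (inner ℝ (v i) x) :=
    hx.mapL (innerSL ℝ (v i))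
  have h2 := h1.unique (hasSum_single i fun j hj => hv i j hj.symm)
  rw [real_inner_comm, h2, real_inner_self_eq_norm_sq]

lemma hasSum_norm_sq_of_orthogonal {v : ℕ → H} (hv : ∀ i j, i ≠ j → inner ℝ (v i) (v j) = 0) {x : H}
    (hx : HasSum v x) : HasSum (fun i => ‖v i‖ ^ 2) (‖x‖ ^ 2) := by
  have h1 : HasSum (fun j => inner ℝ x (v j)) (inner ℝ x x) := hx.mapL (innerSL ℝ x)
  simpa only [inner_hasSum_of_orthogonal hv hx, real_inner_self_eq_norm_sq] using h1

lemma summable_of_orthogonal [CompleteSpace H] {v : ℕ → H}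
    (hv : ∀ i j, i ≠ j → inner ℝ (v i) (v j) = 0) (hs : Summable fun i => ‖v i‖ ^ 2) :
    Summable v := by
  have hV : OrthogonalFamily ℝ (fun i => ℝ ∙ v i) fun i => (ℝ ∙ v i).subtypeₗᵢ := by
    intro i j hij x y
    obtain ⟨a, ha⟩ := Submodule.mem_span_singleton.mp x.2
    obtain ⟨b, hb⟩ := Submodule.mem_span_singleton.mp y.2
    simp [← ha, ← hb, inner_smul_left, inner_smul_right, hv i j hij]
  exact (hV.summable_iff_norm_sq_summable fun i =>
    ⟨v i, Submodule.mem_span_singleton_self _⟩).mpr hs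

/-- Bessel's inequality for an orthogonal sequence of components. -/
lemma summable_norm_sq_of_inner {v : ℕ → H} (hv : ∀ i j, i ≠ j → inner ℝ (v i) (v j) = 0) {x : H}
    (hx : ∀ i, inner ℝ x (v i) = ‖v i‖ ^ 2) : Summable fun i => ‖v i‖ ^ 2 := by
  refine summable_of_sum_le (c := ‖x‖ ^ 2) (fun i => sq_nonneg _) fun s => ?_
  have h1 : inner ℝ x (∑ i ∈ s, v i) = ∑ i ∈ s, ‖v i‖ ^ 2 := by
    rw [inner_sum]
    exact Finset.sum_congr rfl fun i _ => hx i
  have h2 := real_inner_le_norm x (∑ i ∈ s, v i)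
  rw [h1, ← norm_sum_sq_of_orthogonal hv] at h2
  rw [← norm_sum_sq_of_orthogonal hv]
  have h3 := norm_nonneg (∑ i ∈ s, v i)
  have h4 := norm_nonneg x
  nlinarith [sq_nonneg (‖x‖ - ‖∑ i ∈ s, v i‖)]

/-- Expansion with respect to a sequence of mutually orthogonal subspaces. -/
lemma exists_hasSum_of_mem_closure [CompleteSpace H] (V : ℕ → Submodule ℝ H)
    [∀ l, (V l).HasOrthogonalProjection]
    (hV : ∀ i j, i ≠ j → ∀ x ∈ V i, ∀ y ∈ V j, inner ℝ x y = (0 : ℝ)) {x : H}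
    (hx : x ∈ (⨆ l, V l).topologicalClosure) : ∃ v : ℕ → H, (∀ l, v l ∈ V l) ∧ HasSum v x := by
  set v : ℕ → H := fun l => (V l).starProjection x with hvdef
  have hmem : ∀ l, v l ∈ V l := fun l => Submodule.starProjection_apply_mem _ _
  have hperp : ∀ l, ∀ y ∈ V l, inner ℝ (x - v l) y = 0 := fun l y hy =>
    Submodule.starProjection_inner_eq_zero x y hy
  have hv : ∀ i j, i ≠ j → inner ℝ (v i) (v j) = 0 := fun i j hij =>
    hV i j hij _ (hmem i) _ (hmem j)
  have hin : ∀ i, inner ℝ x (v i) = ‖v i‖ ^ 2 := by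
    intro i
    have := hperp i _ (hmem i)
    rw [inner_sub_left, real_inner_self_eq_norm_sq] at this
    linarith
  obtain ⟨y, hy⟩ := summable_of_orthogonal hv (summable_norm_sq_of_inner hv hin)
  refine ⟨v, hmem, ?_⟩
  -- The difference is orthogonal to every `V l`, hence to the closure of their sum, in which it
  -- also lies.
  suffices h : x - y = 0 by rwa [sub_eq_zero.mp h]
  have hyc : y ∈ (⨆ l, V l).topologicalClosure :=
    (Submodule.isClosed_topologicalClosure _).mem_of_tendsto hy
      (Eventually.of_forall fun s => Submodule.le_topologicalClosure _
        (Submodule.sum_mem _ fun l _ => Submodule.mem_iSup_of_mem l (hmem l)))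
  have horth : ∀ l, V l ≤ (ℝ ∙ (x - y))ᗮ := by
    intro l z hz
    rw [Submodule.mem_orthogonal_singleton_iff_inner_right]
    have h1 : HasSum (fun j => inner ℝ z (v j)) (inner ℝ z y) := hy.mapL (innerSL ℝ z)
    have h2 := h1.unique (hasSum_single l fun j hj => hV l j hj.symm z hz _ (hmem j))
    have h3 := hperp l z hz
    rw [inner_sub_left] at h3 ⊢
    rw [real_inner_comm, real_inner_comm z (v l)] at h3
    rw [real_inner_comm, real_inner_comm z y, h2]
    exact h3
  have hle : (⨆ l, V l).topologicalClosure ≤ (ℝ ∙ (x - y))ᗮ :=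
    Submodule.topologicalClosure_minimal _ (iSup_le horth) (Submodule.isClosed_orthogonal _)
  have := hle (Submodule.sub_mem _ hx hyc)
  rw [Submodule.mem_orthogonal_singleton_iff_inner_right] at this
  exact inner_self_eq_zero.mp this

end Hilbert

/-- `T` is the `L²`-sum of the eigentensors `t l`. -/
structure HasModes {k : ℕ} (T : TField k) (t : ℕ → Tn k) : Prop where
  mem : ∀ l, t l ∈ E k l
  memLp : MemLp T 2 σ
  hasSum : HasSum (fun l => emb (t l)) (memLp.toLp T)

variable {k m : ℕ} {T U : TField k} {t u : ℕ → Tn k}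

lemma inner_emb_of_mem_E (ht : ∀ l, t l ∈ E k l) (i j : ℕ) (hij : i ≠ j) :
    inner ℝ (emb (t i)) (emb (t j)) = 0 := by
  rw [inner_emb]
  exact pair_of_mem_E hij (ht i) (ht j)

lemma HasModes.hasSum_nsq (h : HasModes T t) :
    HasSum (fun l => nsq (t l)) (‖h.memLp.toLp T‖ ^ 2) := by
  simpa only [norm_emb_sq] using hasSum_norm_sq_of_orthogonal (inner_emb_of_mem_E h.mem) h.hasSum

lemma HasModes.summable (h : HasModes T t) : Summable fun l => nsq (t l) := h.hasSum_nsq.summable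

lemma HasModes.eLpNorm_sq (h : HasModes T t) :
    eLpNorm T 2 σ ^ 2 = ENNReal.ofReal (∑' l, nsq (t l)) := by
  rw [h.hasSum_nsq.tsum_eq, ENNReal.ofReal_pow (norm_nonneg _), Lp.norm_toLp,
    ENNReal.ofReal_toReal h.memLp.2.ne]

lemma HasModes.hasSum_pair (h : HasModes T t) (w : Tn k) :
    HasSum (fun l => pair (t l) w) (∫ x, inner ℝ (T x) (fld w x) ∂σ) := by
  have h1 : HasSum (fun l => inner ℝ (emb w) (emb (t l))) (inner ℝ (emb w) (h.memLp.toLp T)) :=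
    h.hasSum.mapL (innerSL ℝ (emb w))
  simp only [inner_emb, pair_comm w] at h1
  rwa [real_inner_comm, show emb w = (memLp_fld w).toLp _ from rfl, inner_toLp] at h1

lemma HasModes.inner_fld (h : HasModes T t) {l : ℕ} {w : Tn k} (hw : w ∈ E k l) :
    ∫ x, inner ℝ (T x) (fld w x) ∂σ = pair (t l) w :=
  (h.hasSum_pair w).unique (hasSum_single l fun _ hj => pair_of_mem_E hj (h.mem _) hw)

lemma HasModes.unique (h : HasModes T t) (h' : HasModes T u) : t = u := by
  funext l
  rw [← sub_eq_zero]
  refine eq_zero_of_nsq ?_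
  have h1 := h.inner_fld ((E k l).sub_mem (h.mem l) (h'.mem l))
  have h2 := h'.inner_fld ((E k l).sub_mem (h.mem l) (h'.mem l))
  rw [nsq, pair_sub_left, ← h1, ← h2, sub_self]

lemma HasModes.congr (h : HasModes T t) (hTU : T =ᵐ[σ] U) : HasModes U t where
  mem := h.mem
  memLp := (memLp_congr_ae hTU).mp h.memLp
  hasSum := by
    rw [MemLp.toLp_congr _ h.memLp hTU.symm]
    exact h.hasSum

lemma HasModes.ae_eq (h : HasModes T t) (h' : HasModes U t) : T =ᵐ[σ] U :=
  (MemLp.toLp_eq_toLp_iff h.memLp h'.memLp).mp (h.hasSum.unique h'.hasSum)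

lemma HasModes.of_hasSum {F : Lp (Tens k) 2 σ} (ht : ∀ l, t l ∈ E k l)
    (h : HasSum (fun l => emb (t l)) F) : HasModes F t :=
  ⟨ht, Lp.memLp F, by rwa [Lp.toLp_coeFn]⟩

lemma exists_hasModes (ht : ∀ l, t l ∈ E k l) (hs : Summable fun l => nsq (t l)) :
    ∃ T : TField k, HasModes T t := by
  obtain ⟨F, hF⟩ := summable_of_orthogonal (inner_emb_of_mem_E ht)
    (by simpa only [norm_emb_sq] using hs)
  exact ⟨F, HasModes.of_hasSum ht hF⟩

lemma hasModes_zero : HasModes (0 : TField k) fun _ => 0 :=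
  ⟨fun _ => Submodule.zero_mem _, MemLp.zero, by
    simp only [map_zero]
    rw [MemLp.toLp_zero]
    exact hasSum_zero⟩

lemma HasModes.add (h : HasModes T t) (h' : HasModes U u) : HasModes (T + U) fun l => t l + u l :=
  ⟨fun l => Submodule.add_mem _ (h.mem l) (h'.mem l), h.memLp.add h'.memLp, by
    simp only [map_add]
    exact h.hasSum.add h'.hasSum⟩

lemma HasModes.smul (h : HasModes T t) (c : ℝ) : HasModes (c • T) fun l => c • t l :=
  ⟨fun l => Submodule.smul_mem _ c (h.mem l), h.memLp.const_smul c, by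
    simp only [map_smul]
    exact h.hasSum.const_smul c⟩

lemma HasModes.mat (h : HasModes T t) (M : Mat m k) (hM : ∀ l, matA M (t l) ∈ E m l) :
    HasModes (matF M T) fun l => matA M (t l) :=
  ⟨hM, memLp_matF M h.memLp, by
    have := h.hasSum.mapL (matLp M)
    simpa only [matLp_emb, matLp_toLp] using this⟩

lemma HasModes.matF_ae_eq (h : HasModes T t) {M : Mat k k} (hM : ∀ l, matA M (t l) = t l) :
    matF M T =ᵐ[σ] T := by
  have h1 := h.mat M fun l => by rw [hM]; exact h.mem l
  simp only [hM] at h1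
  exact h1.ae_eq h

lemma E_le_Tan {l : ℕ} {w : Tn k} (hw : w ∈ E k l) : w ∈ Tan k := (mem_E.mp hw).1

lemma HasModes.isTangent (h : HasModes T t) : ∀ᵐ x ∂σ, IsTangent x (T x) :=
  ae_isTangent_iff.mpr (h.matF_ae_eq fun l => projA_of_mem (E_le_Tan (h.mem l)))

lemma hasModes_fld {l : ℕ} {w : Tn k} (hw : w ∈ E k l) : HasModes (fld w) (Pi.single l w) := by
  refine ⟨fun j => ?_, memLp_fld w, ?_⟩
  · by_cases hj : j = l
    · subst hj; simpa using hw
    · simp [Pi.single_eq_of_ne hj]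
  · have : HasSum (fun j => emb (Pi.single (M := fun _ => Tn k) l w j))
        (emb (Pi.single (M := fun _ => Tn k) l w l)) :=
      hasSum_single l fun j hj => by simp [Pi.single_eq_of_ne hj]
    rwa [Pi.single_eq_same] at this

/-! ### Weak covariant derivatives -/

/-- For a tangential T, a test field may be replaced by its tangential projection, because that
projection is pointwise self-adjoint. Tangential tests therefore suffice, and polynomial tensors are
dense. -/
lemma ae_eq_zero_of_inner (hT : MemLp T 2 σ) (ht : ∀ᵐ x ∂σ, IsTangent x (T x))
    (h : ∀ w ∈ Tan k, ∫ x, inner ℝ (T x) (fld w x) ∂σ = 0) : T =ᵐ[σ] 0 := by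
  have h1 : ∀ w : Tn k, inner ℝ (hT.toLp T) (emb w) = 0 := by
    intro w
    rw [show emb w = (memLp_fld w).toLp _ from rfl, inner_toLp, ← h _ (projA_mem w)]
    refine integral_congr_ae ?_
    filter_upwards [ae_isTangent_iff.mp ht] with x hx
    rw [← matA_projMat, ← matF_fld, ← inner_matF_projMat, hx]
  have h2 : ((polyTn k).map emb).topologicalClosure ≤ (ℝ ∙ hT.toLp T)ᗮ := by
    refine Submodule.topologicalClosure_minimal _ ?_ (Submodule.isClosed_orthogonal _)
    rintro _ ⟨w, -, rfl⟩
    rw [Submodule.mem_orthogonal_singleton_iff_inner_right]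
    exact h1 w
  have h3 : hT.toLp T ∈ (ℝ ∙ hT.toLp T)ᗮ := h2 (by rw [dense_polyTn]; trivial)
  rw [Submodule.mem_orthogonal_singleton_iff_inner_right, inner_self_eq_zero] at h3
  exact (MemLp.toLp_eq_toLp_iff hT MemLp.zero).mp (h3.trans (MemLp.toLp_zero _).symm)

lemma integral_inner_sub (hT : MemLp T 2 σ) (hU : MemLp U 2 σ) (w : Tn k) :
    ∫ x, inner ℝ ((T - U) x) (fld w x) ∂σ
      = ∫ x, inner ℝ (T x) (fld w x) ∂σ - ∫ x, inner ℝ (U x) (fld w x) ∂σ := by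
  rw [← inner_toLp hT (memLp_fld w), ← inner_toLp hU (memLp_fld w),
    ← inner_toLp (hT.sub hU) (memLp_fld w), MemLp.toLp_sub hT hU, inner_sub_left]

lemma tr_classicalCov_fld {w : Tn (k + 1)} (hw : w ∈ Tan (k + 1)) (x : S2) :
    tr (classicalCov (fld w) x) = fld (divA w) x := by
  rw [classicalCov_fld hw, tr_fld]
  rfl

lemma isWeakCov_iff {S : TField (k + 1)} : IsWeakCov T S ↔ MemLp T 2 σ ∧ MemLp S 2 σ ∧
    (∀ᵐ x ∂σ, IsTangent x (S x)) ∧ ∀ w ∈ Tan (k + 1),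
      ∫ x, inner ℝ (S x) (fld w x) ∂σ = - ∫ x, inner ℝ (T x) (fld (divA w) x) ∂σ := by
  refine and_congr_right fun _ => and_congr_right fun _ => and_congr_right fun _ => ⟨?_, ?_⟩
  · intro h w hw
    rw [h _ (isSmooth_fld w) (isTangent_fld.mp hw)]
    simp only [tr_classicalCov_fld hw]
  · intro h W hW hWt
    obtain ⟨w, rfl⟩ := exists_fld hW
    have hw := isTangent_fld.mpr hWt
    rw [h w hw]
    simp only [tr_classicalCov_fld hw]

lemma IsWeakCov.ae_eq {S S' : TField (k + 1)} (h : IsWeakCov T S) (h' : IsWeakCov T S') :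
    S =ᵐ[σ] S' := by
  rw [isWeakCov_iff] at h h'
  have h1 : S - S' =ᵐ[σ] 0 := by
    refine ae_eq_zero_of_inner (h.2.1.sub h'.2.1) ?_ fun w hw => ?_
    · filter_upwards [h.2.2.1, h'.2.2.1] with x hx hx' a I
      simp [mul_sub, Finset.sum_sub_distrib, hx a I, hx' a I]
    · rw [integral_inner_sub h.2.1 h'.2.1, h.2.2.2 w hw, h'.2.2.2 w hw, sub_self]
  filter_upwards [h1] with x hx
  exact sub_eq_zero.mp hx

lemma HasModes.isWeakCov {S : TField (k + 1)} (h : HasModes T t)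
    (h' : HasModes S fun l => covA (t l)) : IsWeakCov T S := by
  refine isWeakCov_iff.mpr ⟨h.memLp, h'.memLp, h'.isTangent, fun w hw => ?_⟩
  refine (h'.hasSum_pair w).unique ?_
  have := (h.hasSum_pair (divA w)).neg
  simp only [← pair_covA (E_le_Tan (h.mem _)) hw] at this
  exact this

/-- Testing S against covA (t l) gives its component there, since the divergence of that tensor has
degree l. Bessel's inequality then makes the derived modes square-summable. Their sum is a weak
derivative, and weak derivatives are unique. -/
lemma HasModes.of_isWeakCov {S : TField (k + 1)} (h : HasModes T t) (hS : IsWeakCov T S) :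
    HasModes S fun l => covA (t l) := by
  have hmem : ∀ l, covA (t l) ∈ E (k + 1) l := fun l => covA_mem_E (h.mem l)
  have hS' := isWeakCov_iff.mp hS
  have hsum : Summable fun l => ‖emb (covA (t l))‖ ^ 2 := by
    refine summable_norm_sq_of_inner (inner_emb_of_mem_E hmem) (x := hS'.2.1.toLp S) fun l => ?_
    rw [show emb (covA (t l)) = (memLp_fld _).toLp _ from rfl, inner_toLp,
      hS'.2.2.2 _ (E_le_Tan (hmem l)), h.inner_fld (divA_mem_E (hmem l)),
      ← pair_covA (E_le_Tan (h.mem l)) (E_le_Tan (hmem l))]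
    exact (norm_emb_sq _).symm
  obtain ⟨S', hS'm⟩ := exists_hasModes hmem (by simpa only [norm_emb_sq] using hsum)
  exact hS'm.congr ((h.isWeakCov hS'm).ae_eq hS)

lemma HasModes.exists_isWeakCov (h : HasModes T t) :
    (∃ S, IsWeakCov T S) ↔ Summable fun l => nsq (covA (t l)) := by
  constructor
  · rintro ⟨S, hS⟩
    exact (h.of_isWeakCov hS).summable
  · intro hs
    obtain ⟨S, hS⟩ := exists_hasModes (fun l => covA_mem_E (h.mem l)) hs
    exact ⟨S, h.isWeakCov hS⟩

lemma HasModes.cov (h : HasModes T t) (hs : Summable fun l => nsq (covA (t l))) :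
    HasModes (cov T) fun l => covA (t l) := by
  have he := h.exists_isWeakCov.mpr hs
  rw [CharGluing.cov, dif_pos he]
  exact h.of_isWeakCov he.choose_spec

end

section

/-! ## Sobolev norms of expansions -/

/-- The matrix of an operator of order zero. -/
def toMat {m k : ℕ} (L : Tn k →ₗ[SF] Tn m) : Mat m k := fun I J =>
  L (fun j => if J = j then 1 else 0) I

lemma matA_toMat {m k : ℕ} (L : Tn k →ₗ[SF] Tn m) (T : Tn k) : matA (toMat L) T = L T := by
  rw [LinearMap.pi_apply_eq_sum_univ L T]
  funext I
  simp [matA_apply, toMat, mul_comm]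

lemma exists_nsq_map_le {m k : ℕ} (L : Tn k →ₗ[SF] Tn m) :
    ∃ c : ℝ, 0 ≤ c ∧ ∀ T, nsq (L T) ≤ c * nsq T := by
  refine ⟨‖matLp (toMat L)‖ ^ 2, sq_nonneg _, fun T => ?_⟩
  rw [← matA_toMat, ← norm_emb_sq, ← norm_emb_sq, ← matLp_emb, ← mul_pow]
  exact pow_le_pow_left₀ (norm_nonneg _) ((matLp (toMat L)).le_opNorm _) 2

/-- Iterated covariant derivatives of smooth tensors. -/
def covAIter {k : ℕ} (T : Tn k) : (i : ℕ) → Tn (k + i)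
  | 0 => T
  | i + 1 => covA (covAIter T i)

variable {k m : ℕ} {l : ℕ}

lemma covAIter_mem_E {T : Tn k} (hT : T ∈ E k l) (i : ℕ) : covAIter T i ∈ E (k + i) l := by
  induction i with
  | zero => exact hT
  | succ i ih => exact covA_mem_E ih

lemma nsq_covA_le {T : Tn k} (hT : T ∈ E k l) : nsq (covA T) ≤ (1 + ev l) * nsq T := by
  have := nsq_covA_add_of_mem_E hT
  linarith [nsq_nonneg (J T), nsq_nonneg T]

lemma nsq_covAIter_le {T : Tn k} (hT : T ∈ E k l) (i : ℕ) :
    nsq (covAIter T i) ≤ (1 + ev l) ^ i * nsq T := by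
  induction i with
  | zero => simp [covAIter]
  | succ i ih =>
    refine (nsq_covA_le (covAIter_mem_E hT i)).trans ?_
    rw [pow_succ', mul_assoc]
    exact mul_le_mul_of_nonneg_left ih (by linarith [ev_nonneg l])

/-- Since `J` is bounded, the eigenvalue identity gives (1 + λ)‖T‖² ≤ ‖∇T‖² + K‖T‖². The induction
applies this to each iterated derivative, all of which lie in degree l. -/
lemma exists_pow_mul_nsq_le (k m : ℕ) : ∃ C : ℝ, 0 ≤ C ∧ ∀ (l : ℕ) (T : Tn k), T ∈ E k l →
    (1 + ev l) ^ m * nsq T ≤ C * ∑ i ∈ Finset.range (m + 1), nsq (covAIter T i) := by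
  induction m with
  | zero => exact ⟨1, zero_le_one, fun l T _ => by simp [covAIter]⟩
  | succ m ih =>
    obtain ⟨C, hC0, hC⟩ := ih
    choose K hK0 hK using fun i : ℕ => exists_nsq_map_le (J (k := k + i))
    refine ⟨C * (2 + ∑ i ∈ Finset.range (m + 1), K i),
      mul_nonneg hC0 (add_nonneg (by norm_num) (Finset.sum_nonneg fun i _ => hK0 i)),
      fun l T hT => ?_⟩
    have hev := ev_nonneg l
    have hg : ∀ i, 0 ≤ nsq (covAIter T i) := fun i => nsq_nonneg _
    have h1 : ∀ i ∈ Finset.range (m + 1), (1 + ev l) * nsq (covAIter T i)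
        ≤ nsq (covAIter T (i + 1))
          + (1 + ∑ i ∈ Finset.range (m + 1), K i) * nsq (covAIter T i) := by
      intro i hi
      have h2 := nsq_covA_add_of_mem_E (covAIter_mem_E hT i)
      have h3 := hK i (covAIter T i)
      have h4 := mul_le_mul_of_nonneg_right (Finset.single_le_sum (fun j _ => hK0 j) hi) (hg i)
      change _ ≤ nsq (covA (covAIter T i)) + _
      linarith
    have h5 := Finset.sum_le_sum h1
    rw [Finset.sum_add_distrib, ← Finset.mul_sum, ← Finset.mul_sum] at h5
    have h6 : ∑ i ∈ Finset.range (m + 1), nsq (covAIter T (i + 1))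
        ≤ ∑ i ∈ Finset.range (m + 2), nsq (covAIter T i) := by
      rw [Finset.sum_range_succ' _ (m + 1)]
      linarith [hg 0]
    have h7 : ∑ i ∈ Finset.range (m + 1), nsq (covAIter T i)
        ≤ ∑ i ∈ Finset.range (m + 2), nsq (covAIter T i) := by
      rw [Finset.sum_range_succ _ (m + 1)]
      linarith [hg (m + 1)]
    have h8 := mul_le_mul_of_nonneg_left h7
      (add_nonneg zero_le_one (Finset.sum_nonneg fun i (_ : i ∈ Finset.range (m + 1)) => hK0 i))
    calc (1 + ev l) ^ (m + 1) * nsq T = (1 + ev l) * ((1 + ev l) ^ m * nsq T) := by ring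
      _ ≤ (1 + ev l) * (C * ∑ i ∈ Finset.range (m + 1), nsq (covAIter T i)) :=
        mul_le_mul_of_nonneg_left (hC l T hT) (by linarith)
      _ = C * ((1 + ev l) * ∑ i ∈ Finset.range (m + 1), nsq (covAIter T i)) := by ring
      _ ≤ C * ((2 + ∑ i ∈ Finset.range (m + 1), K i)
            * ∑ i ∈ Finset.range (m + 2), nsq (covAIter T i)) :=
        mul_le_mul_of_nonneg_left (by linarith) hC0
      _ = _ := by ring

/-- The square of the `H^m` norm of an expansion, up to constants. -/
def energy {k : ℕ} (m : ℕ) (t : ℕ → Tn k) : ℝ≥0∞ := ∑' l, ENNReal.ofReal ((1 + ev l) ^ m * nsq (t l))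

lemma one_le_pow_ev (l m : ℕ) : 1 ≤ (1 + ev l) ^ m :=
  one_le_pow₀ (by linarith [ev_nonneg l])

lemma energy_mono {t : ℕ → Tn k} {m m' : ℕ} (h : m ≤ m') : energy m t ≤ energy m' t :=
  ENNReal.tsum_le_tsum fun l => ENNReal.ofReal_le_ofReal <| mul_le_mul_of_nonneg_right
    (pow_le_pow_right₀ (by linarith [ev_nonneg l]) h) (nsq_nonneg _)

lemma energy_le_mul {k' m' : ℕ} {t : ℕ → Tn k} {u : ℕ → Tn k'} (c : ℝ≥0)
    (h : ∀ l, (1 + ev l) ^ m * nsq (t l) ≤ c * ((1 + ev l) ^ m' * nsq (u l))) :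
    energy m t ≤ c * energy m' u := by
  rw [energy, energy, ← ENNReal.tsum_mul_left]
  refine ENNReal.tsum_le_tsum fun l => (ENNReal.ofReal_le_ofReal (h l)).trans_eq ?_
  rw [ENNReal.ofReal_mul c.coe_nonneg, ENNReal.ofReal_coe_nnreal]

lemma summable_of_energy {t : ℕ → Tn k} (h : energy m t < ⊤) : Summable fun l => nsq (t l) := by
  have h1 : energy 0 t ≠ ⊤ := ((energy_mono (Nat.zero_le m)).trans_lt h).ne
  have h2 := ENNReal.summable_toReal h1
  refine h2.congr fun l => ?_
  rw [pow_zero, one_mul, ENNReal.toReal_ofReal (nsq_nonneg _)]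

lemma energy_zero_of_summable {t : ℕ → Tn k} (h : Summable fun l => nsq (t l)) :
    energy 0 t = ENNReal.ofReal (∑' l, nsq (t l)) := by
  rw [ENNReal.ofReal_tsum_of_nonneg (fun l => nsq_nonneg _) h, energy]
  simp

variable {T : TField k} {t : ℕ → Tn k}

lemma HasModes.energy_zero (h : HasModes T t) : energy 0 t = eLpNorm T 2 σ ^ 2 := by
  rw [energy_zero_of_summable h.summable, h.eLpNorm_sq]

lemma HasModes.covIter (h : HasModes T t) {i : ℕ}
    (hs : ∀ j ≤ i, Summable fun l => nsq (covAIter (t l) j)) :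
    HasModes (covIter T i) fun l => covAIter (t l) i := by
  induction i with
  | zero => exact h
  | succ i ih => exact (ih fun j hj => hs j (by lia)).cov (hs (i + 1) le_rfl)

lemma HasModes.memSob_iff (h : HasModes T t) :
    MemSob m T ↔ ∀ i ≤ m, Summable fun l => nsq (covAIter (t l) i) := by
  constructor
  · rintro ⟨-, -, hm⟩ i
    induction i using Nat.strong_induction_on with
    | _ i ih =>
      intro hi
      match i with
      | 0 => exact h.summable
      | i + 1 =>
        exact (h.covIter fun j hj => ih j (by lia) (by lia)).exists_isWeakCov.mp (hm i (by lia))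
  · intro hs
    refine ⟨h.memLp, h.isTangent, fun i hi => ?_⟩
    exact (h.covIter fun j hj => hs j (by lia)).exists_isWeakCov.mpr (hs (i + 1) (by lia))

lemma sobNorm_sq {r : ℝ} (h : MemSob m T) : sobNorm r m T ^ 2 = ∑ i ∈ Finset.range (m + 1),
    ENNReal.ofReal (r ^ (2 - 2 * ((k : ℤ) + i))) * eLpNorm (covIter T i) 2 σ ^ 2 := by
  rw [sobNorm, if_pos h, ← ENNReal.rpow_natCast, ← ENNReal.rpow_mul]
  norm_num

lemma energy_covAIter_le {i : ℕ} (ht : ∀ l, t l ∈ E k l) :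
    energy m (fun l => covAIter (t l) i) ≤ energy (m + i) t := by
  refine (energy_le_mul 1 fun l => ?_).trans_eq (one_mul _)
  rw [NNReal.coe_one, one_mul, pow_add, mul_assoc]
  exact mul_le_mul_of_nonneg_left (nsq_covAIter_le (ht l) i) (by linarith [one_le_pow_ev l m])

lemma HasModes.memSob (h : HasModes T t) (he : energy m t < ⊤) : MemSob m T :=
  h.memSob_iff.mpr fun i hi => summable_of_energy (m := 0)
    ((energy_covAIter_le h.mem).trans (energy_mono (by lia)) |>.trans_lt he)

lemma exists_sobNorm_le (k : ℕ) (r : ℝ) (m : ℕ) : ∃ C : ℝ≥0, ∀ (T : TField k) (t : ℕ → Tn k),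
    HasModes T t → sobNorm r m T ^ 2 ≤ C * energy m t := by
  -- The summand 1 keeps the constant nonzero, so that its product with an infinite energy is
  -- infinite. The same device covers fields outside H^m in the converse estimate.
  refine ⟨1 + ∑ i ∈ Finset.range (m + 1), (r ^ (2 - 2 * ((k : ℤ) + i))).toNNReal, fun T t h => ?_⟩
  by_cases he : energy m t < ⊤
  · have hs := h.memSob_iff.mp (h.memSob he)
    rw [sobNorm_sq (h.memSob he), ENNReal.coe_add, add_mul, ENNReal.ofNNReal_finsetSum, Finset.sum_mul]
    refine le_add_left (Finset.sum_le_sum fun i hi => ?_)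
    have hi : i ≤ m := Nat.lt_succ_iff.mp (Finset.mem_range.mp hi)
    refine mul_le_mul_right ?_ _
    rw [← (h.covIter fun j hj => hs j (hj.trans hi)).energy_zero]
    exact (energy_covAIter_le h.mem).trans (energy_mono (by lia))
  · rw [not_lt_top_iff.mp he, ENNReal.mul_top]
    · exact le_top
    · simp

lemma exists_energy_le (k : ℕ) {r : ℝ} (hr : 0 < r) (m : ℕ) : ∃ C : ℝ≥0,
    ∀ (T : TField k) (t : ℕ → Tn k), HasModes T t → energy m t ≤ C * sobNorm r m T ^ 2 := by
  obtain ⟨C, hC0, hC⟩ := exists_pow_mul_nsq_le k m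
  set w : ℕ → ℝ := fun i => r ^ (2 - 2 * ((k : ℤ) + i)) with hw
  have hw0 : ∀ i, 0 < w i := fun i => zpow_pos hr _
  refine ⟨1 + ∑ i ∈ Finset.range (m + 1), (C / w i).toNNReal, fun T t h => ?_⟩
  by_cases hm : MemSob m T
  · have hs := h.memSob_iff.mp hm
    have h1 : energy m t ≤ ∑ i ∈ Finset.range (m + 1),
        ENNReal.ofReal C * eLpNorm (covIter T i) 2 σ ^ 2 := by
      have h2 : ∀ l, ENNReal.ofReal ((1 + ev l) ^ m * nsq (t l)) ≤ ∑ i ∈ Finset.range (m + 1),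
          ENNReal.ofReal C * ENNReal.ofReal (nsq (covAIter (t l) i)) := by
        intro l
        refine (ENNReal.ofReal_le_ofReal (hC l (t l) (h.mem l))).trans_eq ?_
        rw [ENNReal.ofReal_mul hC0, ENNReal.ofReal_sum_of_nonneg fun i _ => nsq_nonneg _,
          Finset.mul_sum]
      refine (ENNReal.tsum_le_tsum h2).trans_eq ?_
      rw [Summable.tsum_finsetSum fun i _ => ENNReal.summable]
      refine Finset.sum_congr rfl fun i hi => ?_
      have hi : i ≤ m := Nat.lt_succ_iff.mp (Finset.mem_range.mp hi)
      rw [ENNReal.tsum_mul_left, ← (h.covIter fun j hj => hs j (hj.trans hi)).energy_zero, energy]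
      simp
    refine h1.trans ?_
    rw [ENNReal.coe_add, add_mul, ENNReal.ofNNReal_finsetSum, Finset.sum_mul]
    refine le_add_left (Finset.sum_le_sum fun i hi => ?_)
    have h3 : ENNReal.ofReal (w i) * eLpNorm (covIter T i) 2 σ ^ 2 ≤ sobNorm r m T ^ 2 := by
      rw [sobNorm_sq hm]
      exact Finset.single_le_sum
        (f := fun i : ℕ => ENNReal.ofReal (w i) * eLpNorm (CharGluing.covIter T i) 2 σ ^ 2)
        (fun _ _ => zero_le) hi
    refine le_trans (le_of_eq ?_) (mul_le_mul_right h3 _)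
    rw [← mul_assoc]
    congr 1
    change _ = ENNReal.ofReal (C / w i) * _
    rw [← ENNReal.ofReal_mul (div_nonneg hC0 (hw0 i).le), div_mul_cancel₀ _ (hw0 i).ne']
  · rw [sobNorm, if_neg hm]
    simp

/-- The field `T` in `H^m` has the expansion `t`. -/
structure HM {k : ℕ} (m : ℕ) (T : TField k) (t : ℕ → Tn k) : Prop extends HasModes T t where
  fin : energy m t < ⊤

lemma HasModes.hm_of_sobNorm {r : ℝ} (hr : 0 < r) (h : HasModes T t) (hn : sobNorm r m T < ⊤) :
    HM m T t := by
  obtain ⟨C, hC⟩ := exists_energy_le k hr m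
  exact ⟨h, (hC T t h).trans_lt (ENNReal.mul_lt_top ENNReal.coe_lt_top (ENNReal.pow_lt_top hn))⟩

end

section

/-! ## Differential operators on expansions -/

variable {k m : ℕ} {T U : TField k} {t u : ℕ → Tn k}

/-- The tensor with constant components. -/
def cst {k : ℕ} (t : Tens k) : Tn k := fun I => algebraMap ℝ SF (t I)

lemma fld_cst {k : ℕ} (t : Tens k) (x : S2) : fld (cst t) x = t := by
  ext I
  simp [cst]
  rfl

/-- The action of an operator of order zero on tensor fields. -/
def opF {m k : ℕ} (L : Tn k →ₗ[SF] Tn m) (T : TField k) : TField m := matF (toMat L) T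

/-- An operator of order zero depends at x only on the value T x, so T may be frozen to constant
components. This transfers identities for smooth tensors to arbitrary fields. -/
lemma opF_apply {m k : ℕ} (L : Tn k →ₗ[SF] Tn m) (T : TField k) (x : S2) :
    opF L T x = fld (L (cst (T x))) x := by
  rw [← matA_toMat L, ← matF_fld]
  ext I
  simp only [opF, matF_apply, fld_cst]

lemma cst_apply_val {k : ℕ} (t : Tens k) (I : Fin k → Fin 3) (x : S2) : (cst t I).1 x = t I :=
  congrArg (fun t : Tens k => t I) (fld_cst t x)

/-! ### Energies -/

lemma energy_add_le : energy m (fun l => t l + u l) ≤ 2 * (energy m t + energy m u) := by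
  rw [energy, energy, energy, ← ENNReal.tsum_add, ← ENNReal.tsum_mul_left]
  refine ENNReal.tsum_le_tsum fun l => ?_
  have h1 : 0 ≤ (1 + ev l) ^ m := zero_le_one.trans (one_le_pow_ev l m)
  rw [← ENNReal.ofReal_add (mul_nonneg h1 (nsq_nonneg _)) (mul_nonneg h1 (nsq_nonneg _)),
    show (2 : ℝ≥0∞) = ENNReal.ofReal 2 by simp, ← ENNReal.ofReal_mul zero_le_two]
  refine ENNReal.ofReal_le_ofReal ?_
  have := mul_le_mul_of_nonneg_left (nsq_add_le (t l) (u l)) h1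
  linarith

lemma energy_smul_le (c : ℝ) : energy m (fun l => c • t l) ≤ (c ^ 2).toNNReal * energy m t := by
  refine energy_le_mul _ fun l => ?_
  rw [Real.coe_toNNReal _ (sq_nonneg c), nsq_smul]
  exact le_of_eq (by ring)

lemma exists_energy_map_le {k' : ℕ} (L : Tn k →ₗ[SF] Tn k') : ∃ C : ℝ≥0, ∀ (m : ℕ) (t : ℕ → Tn k),
    energy m (fun l => L (t l)) ≤ C * energy m t := by
  obtain ⟨c, hc0, hc⟩ := exists_nsq_map_le L
  lift c to ℝ≥0 using hc0
  refine ⟨c, fun m t => energy_le_mul _ fun l => ?_⟩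
  have := mul_le_mul_of_nonneg_left (hc (t l)) (zero_le_one.trans (one_le_pow_ev l m))
  exact this.trans_eq (mul_left_comm _ _ _)

lemma energy_zero_seq : energy m (fun _ => (0 : Tn k)) = 0 := by
  simp [energy]

lemma energy_single (l : ℕ) (w : Tn k) :
    energy m (Pi.single l w) = ENNReal.ofReal ((1 + ev l) ^ m * nsq w) := by
  rw [energy, tsum_eq_single l fun j hj => by simp [Pi.single_eq_of_ne hj]]
  rw [Pi.single_eq_same]

/-! ### Calculus -/

lemma HM.congr (h : HM m T t) (hTU : T =ᵐ[σ] U) : HM m U t := ⟨h.toHasModes.congr hTU, h.fin⟩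

lemma HM.mono {m' : ℕ} (h : HM m T t) (hm : m' ≤ m) : HM m' T t :=
  ⟨h.toHasModes, (energy_mono hm).trans_lt h.fin⟩

lemma HM.add (h : HM m T t) (h' : HM m U u) : HM m (T + U) fun l => t l + u l :=
  ⟨h.toHasModes.add h'.toHasModes, energy_add_le.trans_lt
    (ENNReal.mul_lt_top (by simp) (ENNReal.add_lt_top.mpr ⟨h.fin, h'.fin⟩))⟩

lemma HM.smul (h : HM m T t) (c : ℝ) : HM m (c • T) fun l => c • t l :=
  ⟨h.toHasModes.smul c, (energy_smul_le c).trans_lt (ENNReal.mul_lt_top (by simp) h.fin)⟩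

lemma HM.neg (h : HM m T t) : HM m (-T) fun l => - t l := by simpa using h.smul (-1)

lemma HM.sub (h : HM m T t) (h' : HM m U u) : HM m (T - U) fun l => t l - u l := by
  simpa [sub_eq_add_neg] using h.add h'.neg

lemma HM.zero : HM m (0 : TField k) fun _ => 0 := ⟨hasModes_zero, by simp [energy_zero_seq]⟩

lemma HM.op (h : HM m T t) {k' : ℕ} (L : Tn k →ₗ[SF] Tn k') (hL : ∀ l, L (t l) ∈ E k' l) :
    HM m (opF L T) fun l => L (t l) := by
  obtain ⟨C, hC⟩ := exists_energy_map_le L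
  refine ⟨?_, (hC m t).trans_lt (ENNReal.mul_lt_top ENNReal.coe_lt_top h.fin)⟩
  have := h.toHasModes.mat (toMat L) fun l => by rw [matA_toMat]; exact hL l
  simp only [matA_toMat] at this
  exact this

lemma HM.cov (h : HM (m + 1) T t) : HM m (cov T) fun l => covA (t l) := by
  have he : energy m (fun l => covA (t l)) < ⊤ := (energy_covAIter_le (i := 1) h.mem).trans_lt h.fin
  exact ⟨h.toHasModes.cov (summable_of_energy he), he⟩

lemma HM.fld {l : ℕ} {w : Tn k} (hw : w ∈ E k l) : HM m (fld w) (Pi.single l w) :=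
  ⟨hasModes_fld hw, by simp [energy_single]⟩

lemma exists_HM (ht : ∀ l, t l ∈ E k l) (he : energy m t < ⊤) : ∃ T, HM m T t := by
  obtain ⟨T, hT⟩ := exists_hasModes ht (summable_of_energy he)
  exact ⟨T, hT, he⟩

lemma tr_eq_opF (S : TField (k + 2)) : (fun x => tr (S x)) = opF trA S := by
  funext x
  rw [opF_apply, ← tr_fld, fld_cst]

lemma div1_eq (X : TField 1) : div1 X = opF trA (cov X) := tr_eq_opF (cov X)

lemma div2_eq (V : TField 2) : div2 V = opF trA (cov V) := tr_eq_opF (cov V)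

lemma HM.grad {f : TField 0} {t : ℕ → Tn 0} (h : HM (m + 1) f t) :
    HM m (grad f) fun l => covA (t l) := h.cov

lemma HM.div1 {X : TField 1} {t : ℕ → Tn 1} (h : HM (m + 1) X t) :
    HM m (div1 X) fun l => divA (t l) := by
  rw [div1_eq]
  exact h.cov.op trA fun l => divA_mem_E (h.mem l)

lemma HM.div2 {V : TField 2} {t : ℕ → Tn 2} (h : HM (m + 1) V t) :
    HM m (div2 V) fun l => divA (t l) := by
  rw [div2_eq]
  exact h.cov.op trA fun l => divA_mem_E (h.mem l)

lemma HM.lap {f : TField 0} {t : ℕ → Tn 0} (h : HM (m + 2) f t) :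
    HM m (lap f) fun l => - ev l • t l := by
  have h1 := h.grad.div1
  have h2 : (fun l => divA (covA (t l))) = fun l => - ev l • t l := by
    funext l
    rw [divA_covA (mem_Tan_zero _), lapA_of_mem_E_zero (h.mem l)]
  rwa [h2] at h1

lemma star_eq_opF (X : TField 1) : star X = opF J X := by
  funext x
  ext I
  rw [opF_apply, idx_one I, fld_apply, J_one]
  have h : ∀ a : Fin 3, ∑ m, eps a m * cst (X x) ![m]
      = cst (X x) ![a + 1] * CharGluing.X (a + 2) - cst (X x) ![a + 2] * CharGluing.X (a + 1) := by
    intro a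
    fin_cases a <;> simp [Fin.sum_univ_three, eps] <;> ring
  rw [h]
  simp [star, cst_apply_val, X_apply]

lemma HM.star {X : TField 1} {t : ℕ → Tn 1} (h : HM m X t) : HM m (star X) fun l => J (t l) := by
  rw [star_eq_opF]
  exact h.op J fun l => J_mem_E (h.mem l)

lemma mulMetric_eq_opF (φ : TField 0) : mulMetric φ = opF metA φ := by
  funext x
  ext I
  rw [opF_apply, idx_two I]
  simp [mulMetric, cst_apply_val, P_apply]

lemma HM.mulMetric {φ : TField 0} {t : ℕ → Tn 0} (h : HM m φ t) :
    HM m (mulMetric φ) fun l => metA (t l) := by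
  rw [mulMetric_eq_opF]
  exact h.op metA fun l => metA_mem_E (h.mem l)

lemma HM.D1s {f g : TField 0} {t u : ℕ → Tn 0} (h : HM (m + 1) f t) (h' : HM (m + 1) g u) :
    HM m (D1s f g) fun l => D1A (t l, u l) := h.grad.neg.add h'.grad.star

lemma D2s_eq (X : TField 1) :
    D2s X = (-(1 / 2) : ℝ) • (cov X + opF swapA (cov X) - mulMetric (div1 X)) := by
  funext x
  ext I
  have h : opF swapA (CharGluing.cov X) x I = CharGluing.cov X x ![I 1, I 0] := by
    rw [opF_apply, fld_apply]
    exact cst_apply_val _ _ _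
  have h2 : CharGluing.cov X x I = CharGluing.cov X x ![I 0, I 1] :=
    congrArg (CharGluing.cov X x) (idx_two I)
  simp only [Pi.smul_apply, Pi.sub_apply, Pi.add_apply, PiLp.smul_apply, PiLp.sub_apply,
    PiLp.add_apply, h, smul_eq_mul]
  rw [h2]
  simp [D2s, mulMetric]

lemma HM.D2s {X : TField 1} {t : ℕ → Tn 1} (h : HM (m + 1) X t) :
    HM m (D2s X) fun l => D2A (t l) := by
  rw [D2s_eq]
  exact ((h.cov.add (h.cov.op swapA fun l => swapA_mem_E (covA_mem_E (h.mem l)))).sub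
    h.div1.mulMetric).smul _

/-! ### Existence of expansions -/

/-- M is a pointwise projection to the kind of tensor considered. It fixes T and maps the dense
polynomial tensors into the algebraic sum of the `A l`; by L² continuity, T lies in the closure of
that sum, where orthogonal expansion applies. -/
lemma exists_hasModes_of_matF {A : ℕ → Submodule ℝ (Tn k)} [∀ l, FiniteDimensional ℝ (A l)]
    (hA : ∀ l, A l ≤ E k l) (M : Mat k k) (hM : ∀ w ∈ polyTn k, matA M w ∈ ⨆ l, A l)
    (hT : MemLp T 2 σ) (hMT : matF M T =ᵐ[σ] T) : ∃ t, HasModes T t ∧ ∀ l, t l ∈ A l := by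
  have hx : hT.toLp T ∈ (⨆ l, (A l).map emb).topologicalClosure := by
    have h1 : matLp M (hT.toLp T) = hT.toLp T := by
      rw [matLp_toLp]
      exact MemLp.toLp_congr _ _ hMT
    have hmaps : Set.MapsTo (matLp M) ((polyTn k).map emb : Set (Lp (Tens k) 2 σ))
        (⨆ l, (A l).map emb : Submodule ℝ (Lp (Tens k) 2 σ)) := by
      rintro _ ⟨w, hw, rfl⟩
      rw [matLp_emb, ← Submodule.map_iSup]
      exact Submodule.mem_map_of_mem (hM w hw)
    rw [← h1]
    refine (hmaps.closure (matLp M).continuous) ?_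
    have : hT.toLp T ∈ ((polyTn k).map emb).topologicalClosure := by rw [dense_polyTn]; trivial
    exact this
  obtain ⟨v, hv, hsum⟩ := exists_hasSum_of_mem_closure (fun l => (A l).map emb) (by
    rintro i j hij _ ⟨x, hx, rfl⟩ _ ⟨y, hy, rfl⟩
    rw [inner_emb]
    exact pair_of_mem_E hij (hA i hx) (hA j hy)) hx
  choose t ht htv using hv
  exact ⟨t, ⟨fun l => hA l (ht l), hT, by simpa only [htv] using hsum⟩, ht⟩

lemma exists_hasModes_harmA {f : TField 0} (hf : MemLp f 2 σ) :
    ∃ t, HasModes f t ∧ ∀ l, t l ∈ harmA l := by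
  refine exists_hasModes_of_matF harmA_le_E (toMat LinearMap.id) (fun w hw => ?_) hf ?_
  · rw [matA_toMat]
    have := fn_mem_iSup_harmA (hw ![])
    rwa [fn_eval] at this
  · refine Eventually.of_forall fun x => ?_
    exact (opF_apply LinearMap.id f x).trans (fld_cst _ _)

lemma projA_mem_polyTn {w : Tn k} (hw : w ∈ polyTn k) : projA w ∈ polyTn k :=
  matA_mem_polyTn projMat_mem_polySF hw

lemma exists_hasModes_formA {X : TField 1} (hX : MemLp X 2 σ) (ht : ∀ᵐ x ∂σ, IsTangent x (X x)) :
    ∃ t, HasModes X t ∧ ∀ l, t l ∈ formA l := by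
  refine exists_hasModes_of_matF formA_le_E (projMat 1) (fun w hw => ?_) hX (ae_isTangent_iff.mp ht)
  exact mem_iSup_formA (projA_mem w) fun a => projA_mem_polyTn hw _

/-- The projection as a linear map. -/
def projL (k : ℕ) : Tn k →ₗ[SF] Tn k where
  toFun := projA
  map_add' := projA_add
  map_smul' := projA_smul

/-- The symmetric trace-free tangential part. -/
def stfL : Tn 2 →ₗ[SF] Tn 2 :=
  (algebraMap ℝ SF (1 / 2)) • (projL 2 + swapA ∘ₗ projL 2 - metA ∘ₗ trA ∘ₗ projL 2)

lemma stfL_apply (w : Tn 2) :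
    stfL w = (1 / 2 : ℝ) • (projA w + swapA (projA w) - metA (trA (projA w))) := by
  change algebraMap ℝ SF (1 / 2) • (projA w + swapA (projA w) - metA (trA (projA w))) = _
  funext I
  exact (Algebra.smul_def (1 / 2 : ℝ) (_ : SF)).symm

lemma stfL_mem_iSup {w : Tn 2} (hw : w ∈ polyTn 2) : stfL w ∈ ⨆ l, tensA l := by
  have hp := projA_mem_polyTn hw
  have ht := projA_mem w
  rw [stfL_apply]
  refine mem_iSup_tensA (Tan_smul_real _ ((Tan 2).sub_mem ((Tan 2).add_mem ht (swapA_mem ht))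
    (metA_mem _))) (fun a b => ?_) (fun a b => ?_) ?_
  · refine polySF.smul_mem (polySF.sub_mem (polySF.add_mem (hp _) (hp _))
      (polySF.mul_mem ?_ (P_mem_polySF _ _))) _
    rw [trA_two]
    exact polySF.sum_mem fun i _ => hp _
  · simp only [Pi.smul_apply, Pi.sub_apply, Pi.add_apply, swapA_apply, metA_apply, P_symm a b]
    rw [add_comm (projA w ![a, b])]
  · have h : trA ((1 / 2 : ℝ) • (projA w + swapA (projA w) - metA (trA (projA w)))) = 0 := by
      have h1 : trA (swapA (projA w)) = trA (projA w) := ext_zero (by simp [trA_two])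
      have h2 : trA ((1 / 2 : ℝ) • (projA w + swapA (projA w) - metA (trA (projA w))))
          = (1 / 2 : ℝ) • trA (projA w + swapA (projA w) - metA (trA (projA w))) :=
        (trA.restrictScalars ℝ).map_smul _ _
      rw [h2, map_sub, map_add, h1, trA_metA]
      module
    rw [← trA_two, h]
    rfl

lemma exists_hasModes_tensA {V : TField 2} (hV : MemLp V 2 σ) (hs : IsSTF V) :
    ∃ t, HasModes V t ∧ ∀ l, t l ∈ tensA l := by
  refine exists_hasModes_of_matF tensA_le_E (toMat stfL) (fun w hw => ?_) hV ?_
  · rw [matA_toMat]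
    exact stfL_mem_iSup hw
  · filter_upwards [hs] with x ⟨hx1, hx2, hx3⟩
    refine (opF_apply stfL V x).trans ?_
    have h1 : fld (projA (cst (V x))) x = V x := by
      rw [← matA_projMat, ← matF_fld, matF_projMat, fld_cst, isTangent_iff.mp hx1]
    have h2 : ∀ a b, (projA (cst (V x)) ![a, b]).1 x = V x ![a, b] := fun a b =>
      congrArg (fun t : Tens 2 => t ![a, b]) h1
    ext I
    rw [idx_two I, fld_apply, stfL_apply]
    simp [h2, trA_two, hx3, hx2 (I 1) (I 0)]
    ring

end

section

/-! ## Mode projections -/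

variable {k m : ℕ} {T U : TField k} {t u : ℕ → Tn k}

lemma mem_harm {l : ℕ} {W : TField 0} : W ∈ harm l ↔ ∃ w ∈ harmA l, W = fld w := by
  constructor
  · rintro ⟨p, hp, hp', h⟩
    refine ⟨fn (restr p), mem_harmA.mpr ⟨p, mem_harmPoly.mpr ⟨hp, by rwa [polyLap_apply]⟩, rfl⟩, ?_⟩
    funext x
    ext I
    rw [h, fld_apply, fn_apply, restr_apply]
  · rintro ⟨w, hw, rfl⟩
    obtain ⟨p, hp, rfl⟩ := mem_harmA.mp hw
    rw [mem_harmPoly, polyLap_apply] at hp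
    exact ⟨p, hp.1, hp.2, fun x I => by rw [fld_apply, fn_apply, restr_apply]⟩

lemma apply_single {k' : ℕ} (f : Tn k → Tn k') (h0 : f 0 = 0) (l : ℕ) (w : Tn k) :
    (fun j => f (Pi.single (M := fun _ => Tn k) l w j)) = Pi.single l (f w) := by
  funext j
  by_cases h : j = l
  · subst h; simp
  · simp [Pi.single_eq_of_ne h, h0]

lemma single_D1A (l : ℕ) (Y Z : Tn 0) :
    (fun j => D1A (Pi.single (M := fun _ => Tn 0) l Y j, Pi.single (M := fun _ => Tn 0) l Z j))
      = Pi.single l (D1A (Y, Z)) := by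
  funext j
  by_cases h : j = l
  · subst h; simp
  · simp only [Pi.single_eq_of_ne h]
    exact map_zero D1A

lemma HM.D1s_fld {l : ℕ} {Y Z : Tn 0} (hY : Y ∈ E 0 l) (hZ : Z ∈ E 0 l) :
    HM m (CharGluing.D1s (CharGluing.fld Y) (CharGluing.fld Z)) (Pi.single l (D1A (Y, Z))) := by
  rw [← single_D1A]
  exact (HM.fld hY).D1s (HM.fld hZ)

lemma D1s_fld {l : ℕ} {Y Z : Tn 0} (hY : Y ∈ E 0 l) (hZ : Z ∈ E 0 l) :
    D1s (fld Y) (fld Z) =ᵐ[σ] fld (D1A (Y, Z)) :=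
  (HM.D1s_fld (m := 0) hY hZ).toHasModes.ae_eq (hasModes_fld (D1A_mem_E hY hZ))

lemma D2s_D1s_fld {l : ℕ} {Y Z : Tn 0} (hY : Y ∈ E 0 l) (hZ : Z ∈ E 0 l) :
    D2s (D1s (fld Y) (fld Z)) =ᵐ[σ] fld (D2A (D1A (Y, Z))) := by
  have h := (HM.D1s_fld (m := 1) hY hZ).D2s
  rw [apply_single D2A (map_zero _)] at h
  exact h.toHasModes.ae_eq (hasModes_fld (D2A_mem_E (D1A_mem_E hY hZ)))

/-- Here a l is the orthogonal projection of t l to B l, so ‖a l‖ ≤ ‖t l‖ and the candidate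
converges. It lies in the mode space, and its difference from T is orthogonal to the generators.
Generators are compared almost everywhere, since weak derivatives are only defined up to null sets.
-/
lemma HasModes.modeProj {A : Set (TField k)} {B : ℕ → Submodule ℝ (Tn k)} {s : Set ℕ}
    (hAB : ∀ W ∈ A, ∃ l ∈ s, ∃ w ∈ B l, W =ᵐ[σ] fld w)
    (hBA : ∀ l ∈ s, ∀ w ∈ B l, ∃ W ∈ A, W =ᵐ[σ] fld w) (hB : ∀ l, B l ≤ E k l)
    (h : HasModes T t) {a : ℕ → Tn k} (ha : ∀ l ∈ s, a l ∈ B l)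
    (hperp : ∀ l ∈ s, ∀ w ∈ B l, pair (t l - a l) w = 0) :
    HasModes (modeProj A T) (s.indicator a) := by
  have hmem : ∀ l, s.indicator a l ∈ E k l := by
    intro l
    by_cases hl : l ∈ s
    · rw [Set.indicator_of_mem hl]; exact hB l (ha l hl)
    · rw [Set.indicator_of_notMem hl]; exact Submodule.zero_mem _
  have hle : ∀ l, nsq (s.indicator a l) ≤ nsq (t l) := by
    intro l
    by_cases hl : l ∈ s
    · rw [Set.indicator_of_mem hl]
      have h1 := hperp l hl (a l) (ha l hl)
      have h2 := nsq_nonneg (t l - a l)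
      rw [nsq, pair_sub_left, sub_eq_add_neg (t l), pair_add_right, pair_add_right,
        pair_neg_right, pair_neg_right] at h2
      rw [pair_sub_left] at h1
      rw [pair_comm (a l) (t l)] at h2
      simp only [nsq]
      linarith
    · rw [Set.indicator_of_notMem hl, nsq_zero]; exact nsq_nonneg _
  obtain ⟨y, hy⟩ := exists_hasModes hmem (h.summable.of_nonneg_of_le (fun l => nsq_nonneg _) hle)
  have hyA : hy.memLp.toLp y ∈ modeSpace A := by
    refine (Submodule.isClosed_topologicalClosure _).mem_of_tendsto hy.hasSum
      (Eventually.of_forall fun S => Submodule.sum_mem _ fun l _ => ?_)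
    by_cases hl : l ∈ s
    · obtain ⟨W, hW, hWa⟩ := hBA l hl _ (ha l hl)
      refine Submodule.le_topologicalClosure _ (Submodule.subset_span ⟨W, hW, ?_⟩)
      rw [Set.indicator_of_mem hl]
      exact (coeFn_emb _).trans hWa.symm
    · rw [Set.indicator_of_notMem hl, map_zero]; exact Submodule.zero_mem _
  have horth : modeSpace A ≤ (ℝ ∙ (h.memLp.toLp T - hy.memLp.toLp y))ᗮ := by
    refine Submodule.topologicalClosure_minimal _ (Submodule.span_le.mpr ?_)
      (Submodule.isClosed_orthogonal _)
    rintro F ⟨W, hW, hF⟩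
    obtain ⟨l, hl, w, hw, hWw⟩ := hAB W hW
    have hFw : F = emb w := Lp.ext ((hF.trans hWw).trans (coeFn_emb w).symm)
    rw [SetLike.mem_coe, Submodule.mem_orthogonal_singleton_iff_inner_right, hFw, inner_sub_left,
      show emb w = (memLp_fld w).toLp _ from rfl, inner_toLp, inner_toLp,
      h.inner_fld (hB l hw), hy.inner_fld (hB l hw), Set.indicator_of_mem hl, ← pair_sub_left,
      hperp l hl w hw]
  have hproj : (modeSpace A).starProjection (h.memLp.toLp T) = hy.memLp.toLp y := by
    refine Submodule.eq_starProjection_of_mem_of_inner_eq_zero hyA fun w hw => ?_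
    exact (Submodule.mem_orthogonal_singleton_iff_inner_right).mp (horth hw)
  rw [CharGluing.modeProj, dif_pos h.memLp, hproj]
  exact hy.congr hy.memLp.coeFn_toLp.symm

lemma D1A_eq_zero {l : ℕ} (hl : ev l = 0) {Y Z : Tn 0} (hY : Y ∈ E 0 l) (hZ : Z ∈ E 0 l) :
    D1A (Y, Z) = 0 := by
  refine eq_zero_of_nsq ?_
  rw [nsq, pair_D1A _ _ hY hZ, hl, zero_mul]

lemma D2A_D1A_eq_zero {l : ℕ} (hl : l < 2) {Y Z : Tn 0} (hY : Y ∈ E 0 l) (hZ : Z ∈ E 0 l) :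
    D2A (D1A (Y, Z)) = 0 := by
  refine eq_zero_of_nsq ?_
  rw [nsq, pair_D2A_D1A _ _ hY hZ]
  have : l = 0 ∨ l = 1 := by lia
  rcases this with rfl | rfl <;> norm_num [ev]

/-- Eigentensor expansions are unique, so any expansion agrees with the one supplied by density of
polynomials. No classification of smooth eigenfunctions is needed. -/
lemma HasModes.mem_harmA {f : TField 0} {t : ℕ → Tn 0} (h : HasModes f t) (l : ℕ) :
    t l ∈ harmA l := by
  obtain ⟨t', h', ht'⟩ := exists_hasModes_harmA h.memLp
  rw [h.unique h']
  exact ht' l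

lemma HasModes.mem_formA {X : TField 1} {t : ℕ → Tn 1} (h : HasModes X t) (l : ℕ) :
    t l ∈ formA l := by
  obtain ⟨t', h', ht'⟩ := exists_hasModes_formA h.memLp h.isTangent
  rw [h.unique h']
  exact ht' l

lemma HasModes.modes {f : TField 0} {t : ℕ → Tn 0} (h : HasModes f t) (s : Set ℕ) :
    HasModes (modes s f) (s.indicator t) := by
  refine h.modeProj (B := harmA) ?_ ?_ harmA_le_E (fun l _ => h.mem_harmA l) fun l _ w _ => by simp
  · rintro W ⟨l, hl, hW⟩
    obtain ⟨w, hw, rfl⟩ := mem_harm.mp hW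
    exact ⟨l, hl, w, hw, ae_eq_rfl⟩
  · exact fun l hl w hw => ⟨fld w, ⟨l, hl, mem_harm.mpr ⟨w, hw, rfl⟩⟩, ae_eq_rfl⟩

/-- For reconciling the lower bounds l ≥ 1 and l ≥ 2 in the definition of the harmonics with index
sets s that ignore them: the excluded modes vanish. -/
lemma indicator_inter {s : Set ℕ} {n : ℕ} (h : ∀ l < n, t l = 0) :
    (s ∩ {l | n ≤ l}).indicator t = s.indicator t := by
  funext l
  by_cases hl : l ∈ s
  · by_cases hn : n ≤ l
    · rw [Set.indicator_of_mem hl, Set.indicator_of_mem (show l ∈ s ∩ {l | n ≤ l} from ⟨hl, hn⟩)]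
    · rw [Set.indicator_of_mem hl, Set.indicator_of_notMem fun h => hn h.2, h l (not_le.mp hn)]
  · rw [Set.indicator_of_notMem hl, Set.indicator_of_notMem fun h => hl h.1]

lemma HasModes.modes1 {X : TField 1} {t : ℕ → Tn 1} (h : HasModes X t) (s : Set ℕ) :
    HasModes (modes1 s X) (s.indicator t) := by
  rw [← indicator_inter (n := 1) fun l hl => ?_]
  · refine h.modeProj (B := formA) ?_ ?_ formA_le_E (fun l _ => h.mem_formA l)
      fun l _ w _ => by simp
    · rintro W ⟨l, hl, hl1, Y, hY, Z, hZ, rfl⟩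
      obtain ⟨y, hy, rfl⟩ := mem_harm.mp hY
      obtain ⟨z, hz, rfl⟩ := mem_harm.mp hZ
      exact ⟨l, ⟨hl, hl1⟩, D1A (y, z), CharGluing.mem_formA.mpr ⟨y, hy, z, hz, rfl⟩,
        D1s_fld (harmA_le_E l hy) (harmA_le_E l hz)⟩
    · rintro l ⟨hl, hl1⟩ w hw
      obtain ⟨y, hy, z, hz, rfl⟩ := CharGluing.mem_formA.mp hw
      exact ⟨_, ⟨l, hl, hl1, _, mem_harm.mpr ⟨y, hy, rfl⟩, _, mem_harm.mpr ⟨z, hz, rfl⟩, rfl⟩,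
        D1s_fld (harmA_le_E l hy) (harmA_le_E l hz)⟩
  · obtain ⟨y, hy, z, hz, hyz⟩ := CharGluing.mem_formA.mp (h.mem_formA l)
    rw [hyz]
    refine D1A_eq_zero ?_ (harmA_le_E l hy) (harmA_le_E l hz)
    rw [Nat.lt_one_iff.mp hl]
    simp [ev]

lemma HasModes.modes2 {V : TField 2} {t : ℕ → Tn 2} (h : HasModes V t) (ht : ∀ l, t l ∈ tensA l)
    (s : Set ℕ) : HasModes (modes2 s V) (s.indicator t) := by
  rw [← indicator_inter (n := 2) fun l hl => ?_]
  · refine h.modeProj (B := tensA) ?_ ?_ tensA_le_E (fun l _ => ht l) fun l _ w _ => by simp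
    · rintro W ⟨l, hl, hl1, Y, hY, Z, hZ, rfl⟩
      obtain ⟨y, hy, rfl⟩ := mem_harm.mp hY
      obtain ⟨z, hz, rfl⟩ := mem_harm.mp hZ
      exact ⟨l, ⟨hl, hl1⟩, D2A (D1A (y, z)), CharGluing.mem_tensA.mpr ⟨y, hy, z, hz, rfl⟩,
        D2s_D1s_fld (harmA_le_E l hy) (harmA_le_E l hz)⟩
    · rintro l ⟨hl, hl1⟩ w hw
      obtain ⟨y, hy, z, hz, rfl⟩ := CharGluing.mem_tensA.mp hw
      exact ⟨_, ⟨l, hl, hl1, _, mem_harm.mpr ⟨y, hy, rfl⟩, _, mem_harm.mpr ⟨z, hz, rfl⟩, rfl⟩,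
        D2s_D1s_fld (harmA_le_E l hy) (harmA_le_E l hz)⟩
  · obtain ⟨y, hy, z, hz, hyz⟩ := CharGluing.mem_tensA.mp (ht l)
    rw [hyz]
    exact D2A_D1A_eq_zero hl (harmA_le_E l hy) (harmA_le_E l hz)

/-- The electric tensor harmonics. -/
def elecA (l : ℕ) : Submodule ℝ (Tn 2) :=
  (harmA l).map (D2A ∘ₗ D1A ∘ₗ LinearMap.inl ℝ (Tn 0) (Tn 0))

lemma mem_elecA {l : ℕ} {S : Tn 2} : S ∈ elecA l ↔ ∃ Y ∈ harmA l, D2A (D1A (Y, 0)) = S := by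
  simp [elecA]

lemma elecA_le_E (l : ℕ) : elecA l ≤ E 2 l := by
  intro S hS
  obtain ⟨Y, hY, rfl⟩ := mem_elecA.mp hS
  exact D2A_mem_E (D1A_mem_E (harmA_le_E l hY) (Submodule.zero_mem _))

lemma fld_zero : fld (0 : Tn k) = 0 := map_zero fld

/-- By `pair_D2A_D1A` the electric and magnetic tensors of the same degree are orthogonal, so
projecting just drops the second potential. -/
lemma HasModes.elec {V : TField 2} {Y Z : ℕ → Tn 0} (h : HasModes V fun l => D2A (D1A (Y l, Z l)))
    (hY : ∀ l, Y l ∈ harmA l) : HasModes (elec V) fun l => D2A (D1A (Y l, 0)) := by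
  have h0 : (fun l => D2A (D1A (Y l, 0)))
      = {l | 2 ≤ l}.indicator fun l => D2A (D1A (Y l, 0)) := by
    rw [← Set.univ_inter {l : ℕ | 2 ≤ l}, indicator_inter, Set.indicator_univ]
    exact fun l hl => D2A_D1A_eq_zero hl (harmA_le_E l (hY l)) (Submodule.zero_mem _)
  rw [h0]
  refine h.modeProj (B := elecA) ?_ ?_ elecA_le_E (fun l _ => mem_elecA.mpr ⟨_, hY l, rfl⟩)
    fun l _ w hw => ?_
  · rintro W ⟨l, hl, Y, hY, rfl⟩
    obtain ⟨y, hy, rfl⟩ := mem_harm.mp hY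
    refine ⟨l, hl, D2A (D1A (y, 0)), mem_elecA.mpr ⟨y, hy, rfl⟩, ?_⟩
    have := D2s_D1s_fld (harmA_le_E l hy) (Submodule.zero_mem _)
    rwa [fld_zero] at this
  · rintro l hl w hw
    obtain ⟨y, hy, rfl⟩ := mem_elecA.mp hw
    refine ⟨_, ⟨l, hl, _, mem_harm.mpr ⟨y, hy, rfl⟩, rfl⟩, ?_⟩
    have := D2s_D1s_fld (harmA_le_E l hy) (Submodule.zero_mem _)
    rwa [fld_zero] at this
  · obtain ⟨y, hy, rfl⟩ := mem_elecA.mp hw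
    rw [pair_sub_left, pair_D2A_D1A _ _ (harmA_le_E l hy) (Submodule.zero_mem _),
      pair_D2A_D1A _ _ (harmA_le_E l hy) (Submodule.zero_mem _)]
    simp

lemma energy_indicator_le (s : Set ℕ) : energy m (s.indicator t) ≤ energy m t := by
  refine (energy_le_mul 1 fun l => ?_).trans_eq (one_mul _)
  rw [NNReal.coe_one, one_mul]
  have h1 : 0 ≤ (1 + ev l) ^ m := zero_le_one.trans (one_le_pow_ev l m)
  refine mul_le_mul_of_nonneg_left ?_ h1
  by_cases hl : l ∈ s
  · rw [Set.indicator_of_mem hl]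
  · rw [Set.indicator_of_notMem hl, nsq_zero]; exact nsq_nonneg _

lemma HM.modes {f : TField 0} {t : ℕ → Tn 0} (h : HM m f t) (s : Set ℕ) :
    HM m (modes s f) (s.indicator t) :=
  ⟨h.toHasModes.modes s, (energy_indicator_le s).trans_lt h.fin⟩

lemma HM.modes1 {X : TField 1} {t : ℕ → Tn 1} (h : HM m X t) (s : Set ℕ) :
    HM m (modes1 s X) (s.indicator t) :=
  ⟨h.toHasModes.modes1 s, (energy_indicator_le s).trans_lt h.fin⟩

lemma HM.modes2 {V : TField 2} {t : ℕ → Tn 2} (h : HM m V t) (ht : ∀ l, t l ∈ tensA l)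
    (s : Set ℕ) : HM m (modes2 s V) (s.indicator t) :=
  ⟨h.toHasModes.modes2 ht s, (energy_indicator_le s).trans_lt h.fin⟩

/-! ### Fields of finite norm -/

lemma memSob_of_sobNorm {r : ℝ} (h : sobNorm r m T < ⊤) : MemSob m T := by
  by_contra hm
  simp [sobNorm, hm] at h

lemma exists_HM_of_sobNorm {r : ℝ} (hr : 0 < r) {f : TField 0} (h : sobNorm r m f < ⊤) :
    ∃ t, HM m f t ∧ ∀ l, t l ∈ harmA l := by
  obtain ⟨t, ht, ht'⟩ := exists_hasModes_harmA (memSob_of_sobNorm h).1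
  exact ⟨t, ht.hm_of_sobNorm hr h, ht'⟩

lemma exists_HM_of_sobNorm_one {r : ℝ} (hr : 0 < r) {X : TField 1} (h : sobNorm r m X < ⊤) :
    ∃ Y Z : ℕ → Tn 0, HM m X (fun l => D1A (Y l, Z l)) ∧ (∀ l, Y l ∈ harmA l) ∧
      ∀ l, Z l ∈ harmA l := by
  obtain ⟨t, ht, ht'⟩ := exists_hasModes_formA (memSob_of_sobNorm h).1 (memSob_of_sobNorm h).2.1
  choose Y hY Z hZ hYZ using fun l => mem_formA.mp (ht' l)
  obtain rfl : t = _ := funext hYZ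
  exact ⟨Y, Z, ht.hm_of_sobNorm hr h, hY, hZ⟩

lemma exists_HM_of_sobNorm_two {r : ℝ} (hr : 0 < r) {V : TField 2} (h : sobNorm r m V < ⊤)
    (hV : IsSTF V) : ∃ Y Z : ℕ → Tn 0, HM m V (fun l => D2A (D1A (Y l, Z l))) ∧
      (∀ l, Y l ∈ harmA l) ∧ ∀ l, Z l ∈ harmA l := by
  obtain ⟨t, ht, ht'⟩ := exists_hasModes_tensA (memSob_of_sobNorm h).1 hV
  choose Y hY Z hZ hYZ using fun l => mem_tensA.mp (ht' l)
  obtain rfl : t = _ := funext hYZ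
  exact ⟨Y, Z, ht.hm_of_sobNorm hr h, hY, hZ⟩

end

section

/-! ## Dimensions of the low mode spaces -/

variable {k : ℕ}

/-- A finite-dimensional subspace is closed, so taking the closure of the span adds nothing and
dimensions can be counted on smooth representatives. -/
lemma modeSpace_eq_map {A : Set (TField k)} {S : Submodule ℝ (Tn k)} [FiniteDimensional ℝ S]
    (h1 : ∀ W ∈ A, ∃ w ∈ S, W =ᵐ[σ] fld w) (h2 : ∀ w ∈ S, emb w ∈ modeSpace A) :
    modeSpace A = S.map emb := by
  refine le_antisymm (Submodule.topologicalClosure_minimal _ (Submodule.span_le.mpr ?_)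
    (Submodule.closed_of_finiteDimensional _)) ?_
  · rintro F ⟨W, hW, hF⟩
    obtain ⟨w, hw, hWw⟩ := h1 W hW
    exact ⟨w, hw, (Lp.ext ((hF.trans hWw).trans (coeFn_emb w).symm)).symm⟩
  · rintro _ ⟨w, hw, rfl⟩
    exact h2 w hw

lemma finrank_map_emb (S : Submodule ℝ (Tn k)) :
    Module.finrank ℝ (S.map emb) = Module.finrank ℝ S :=
  (Submodule.equivMapOfInjective emb emb_injective S).finrank_eq.symm

lemma emb_mem_modeSpace {A : Set (TField k)} {W : TField k} (hW : W ∈ A) {w : Tn k}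
    (h : W =ᵐ[σ] fld w) : emb w ∈ modeSpace A :=
  Submodule.le_topologicalClosure _ (Submodule.subset_span ⟨W, hW, (coeFn_emb w).trans h.symm⟩)

/-- The point of the sphere on a coordinate axis. -/
def axisPoint (i : Fin 3) : S2 := ⟨EuclideanSpace.single i 1, by simp⟩

lemma X_axisPoint (i j : Fin 3) : (X j).1 (axisPoint i) = if j = i then 1 else 0 := by
  rw [X_apply]
  simp [axisPoint]

lemma exists_C_of_isHomogeneous_zero {p : Poly} (hp : p.IsHomogeneous 0) :
    ∃ c, p = MvPolynomial.C c :=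
  ⟨_, MvPolynomial.totalDegree_eq_zero_iff_eq_C.mp (Nat.le_zero.mp hp.totalDegree_le)⟩

/-- Linear functions on the sphere. -/
def linFn : (Fin 3 → ℝ) →ₗ[ℝ] Tn 0 where
  toFun c := fn (∑ i, c i • X i)
  map_add' c d := by rw [← map_add]; congr 1; simp [add_smul, Finset.sum_add_distrib]
  map_smul' a c := by rw [RingHom.id_apply, ← map_smul]; congr 1; simp [Finset.smul_sum, mul_smul]

lemma linFn_injective : Function.Injective linFn := by
  rw [← LinearMap.ker_eq_bot, LinearMap.ker_eq_bot']
  intro c hc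
  funext i
  have h : (∑ j, c j • X j : SF).1 (axisPoint i) = 0 := by
    have := congrArg (fun T : Tn 0 => (T ![]).1 (axisPoint i)) hc
    exact this
  rw [SF.val_sum, Finset.sum_apply] at h
  simp only [SF.val_smul, Pi.smul_apply, X_axisPoint] at h
  simpa using h

lemma range_linFn : LinearMap.range linFn = harmA 1 := by
  refine le_antisymm ?_ fun Y hY => ?_
  · rintro _ ⟨c, rfl⟩
    refine mem_harmA.mpr ⟨∑ i, c i • MvPolynomial.X i, Submodule.sum_mem _ fun i _ =>
      Submodule.smul_mem _ _ (mem_harmPoly.mpr ⟨MvPolynomial.isHomogeneous_X ℝ i, ?_⟩), ?_⟩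
    · have hX : ∀ j, MvPolynomial.pderiv j (MvPolynomial.X i : Poly)
          = MvPolynomial.C (Pi.single (M := fun _ => ℝ) i 1 j) := by
        intro j
        by_cases h : j = i
        · subst h; simp
        · rw [MvPolynomial.pderiv_X_of_ne (Ne.symm h), Pi.single_eq_of_ne h, map_zero]
      rw [polyLap_apply]
      exact Finset.sum_eq_zero fun j _ => by rw [hX, MvPolynomial.pderiv_C]
    · simp [linFn, restr_X]
  · obtain ⟨p, hp, rfl⟩ := mem_harmA.mp hY
    rw [mem_harmPoly] at hp
    choose c hc using fun i => exists_C_of_isHomogeneous_zero (hp.1.pderiv (i := i))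
    refine ⟨c, ?_⟩
    -- In degree 1 the partial derivatives are constants, and Euler's identity displays p as the
    -- linear form with these coefficients.
    have h := hp.1.sum_X_mul_pderiv
    simp only [hc, one_smul] at h
    rw [← h]
    simp only [linFn, LinearMap.coe_mk, AddHom.coe_mk, map_sum, map_mul, restr_X]
    refine Finset.sum_congr rfl fun i _ => ?_
    rw [restr, MvPolynomial.aeval_C, mul_comm, ← Algebra.smul_def, map_smul]

lemma finrank_harmA_one : Module.finrank ℝ (harmA 1) = 3 := by
  rw [← range_linFn, LinearMap.finrank_range_of_inj linFn_injective]
  simp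

lemma harmA_zero : harmA 0 = ℝ ∙ fn 1 := by
  ext Y
  rw [mem_harmA, Submodule.mem_span_singleton]
  constructor
  · rintro ⟨p, hp, rfl⟩
    obtain ⟨c, rfl⟩ := exists_C_of_isHomogeneous_zero (mem_harmPoly.mp hp).1
    refine ⟨c, ?_⟩
    rw [restr, MvPolynomial.aeval_C, ← map_smul, Algebra.algebraMap_eq_smul_one]
  · rintro ⟨c, rfl⟩
    refine ⟨MvPolynomial.C c, mem_harmPoly.mpr ⟨MvPolynomial.isHomogeneous_C _ c, ?_⟩, ?_⟩
    · simp [polyLap_apply]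
    · rw [restr, MvPolynomial.aeval_C, ← map_smul, Algebra.algebraMap_eq_smul_one]

lemma finrank_harmA_zero : Module.finrank ℝ (harmA 0) = 1 := by
  rw [harmA_zero]
  refine finrank_span_singleton fun h => ?_
  have := congrArg (fun T : Tn 0 => (T ![]).1 (axisPoint 0)) h
  exact one_ne_zero (α := ℝ) this

lemma disjoint_harmA {l l' : ℕ} (h : l ≠ l') : harmA l ⊓ harmA l' = ⊥ := by
  rw [eq_bot_iff]
  rintro Y ⟨h1, h2⟩
  exact eq_zero_of_nsq (pair_of_mem_E h (harmA_le_E l h1) (harmA_le_E l' h2))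

lemma finrank_scalarHarm : Module.finrank ℝ (modeSpace (scalarHarm {l | l ≤ 1})) = 4 := by
  rw [modeSpace_eq_map (S := harmA 0 ⊔ harmA 1), finrank_map_emb]
  · have := Submodule.finrank_sup_add_finrank_inf_eq (harmA 0) (harmA 1)
    rw [disjoint_harmA zero_ne_one, finrank_bot, finrank_harmA_zero, finrank_harmA_one] at this
    exact this
  · rintro W ⟨l, hl, hW⟩
    obtain ⟨w, hw, rfl⟩ := mem_harm.mp hW
    refine ⟨w, ?_, ae_eq_rfl⟩
    have hl : l ≤ 1 := hl
    interval_cases l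
    · exact Submodule.mem_sup_left hw
    · exact Submodule.mem_sup_right hw
  · have h : harmA 0 ⊔ harmA 1 ≤ (modeSpace (scalarHarm {l | l ≤ 1})).comap emb := by
      refine sup_le (fun w hw => ?_) fun w hw => ?_
      · have : fld w ∈ scalarHarm {l | l ≤ 1} := ⟨0, Nat.zero_le 1, mem_harm.mpr ⟨w, hw, rfl⟩⟩
        exact emb_mem_modeSpace this ae_eq_rfl
      · have : fld w ∈ scalarHarm {l | l ≤ 1} := ⟨1, le_refl 1, mem_harm.mpr ⟨w, hw, rfl⟩⟩
        exact emb_mem_modeSpace this ae_eq_rfl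
    exact fun w hw => h hw

lemma D1A_injOn {l : ℕ} (hl : ev l ≠ 0) {Y Z : Tn 0} (hY : Y ∈ E 0 l) (hZ : Z ∈ E 0 l)
    (h : D1A (Y, Z) = 0) : Y = 0 ∧ Z = 0 := by
  have h1 := pair_D1A Y Z hY hZ
  rw [h, pair_zero_left] at h1
  have h2 : nsq Y + nsq Z = 0 := (mul_eq_zero.mp h1.symm).resolve_left hl
  have h3 := nsq_nonneg Y
  have h4 := nsq_nonneg Z
  exact ⟨eq_zero_of_nsq (by linarith), eq_zero_of_nsq (by linarith)⟩

lemma finrank_formA_one : Module.finrank ℝ (formA 1) = 6 := by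
  let L : (harmA 1 × harmA 1) →ₗ[ℝ] Tn 1 :=
    D1A ∘ₗ ((harmA 1).subtype.prodMap (harmA 1).subtype)
  have hL : Function.Injective L := by
    rw [← LinearMap.ker_eq_bot, LinearMap.ker_eq_bot']
    rintro ⟨Y, Z⟩ h
    obtain ⟨h1, h2⟩ := D1A_injOn (by norm_num [ev]) (harmA_le_E 1 Y.2) (harmA_le_E 1 Z.2) h
    exact Prod.ext (Subtype.ext h1) (Subtype.ext h2)
  have hr : formA 1 = LinearMap.range L := by
    ext V
    rw [mem_formA]
    constructor
    · rintro ⟨Y, hY, Z, hZ, rfl⟩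
      exact ⟨(⟨Y, hY⟩, ⟨Z, hZ⟩), rfl⟩
    · rintro ⟨⟨Y, Z⟩, rfl⟩
      exact ⟨Y, Y.2, Z, Z.2, rfl⟩
  rw [hr, LinearMap.finrank_range_of_inj hL, Module.finrank_prod, finrank_harmA_one]

lemma finrank_formHarm : Module.finrank ℝ (modeSpace (formHarm {1})) = 6 := by
  rw [modeSpace_eq_map (S := formA 1), finrank_map_emb, finrank_formA_one]
  · rintro W ⟨l, rfl, -, Y, hY, Z, hZ, rfl⟩
    obtain ⟨y, hy, rfl⟩ := mem_harm.mp hY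
    obtain ⟨z, hz, rfl⟩ := mem_harm.mp hZ
    exact ⟨_, mem_formA.mpr ⟨y, hy, z, hz, rfl⟩, D1s_fld (harmA_le_E _ hy) (harmA_le_E _ hz)⟩
  · intro w hw
    obtain ⟨y, hy, z, hz, rfl⟩ := mem_formA.mp hw
    have : D1s (fld y) (fld z) ∈ formHarm {1} :=
      ⟨1, rfl, le_rfl, _, mem_harm.mpr ⟨y, hy, rfl⟩, _, mem_harm.mpr ⟨z, hz, rfl⟩, rfl⟩
    exact emb_mem_modeSpace this (D1s_fld (harmA_le_E _ hy) (harmA_le_E _ hz))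

end

section

/-! ## Charges of linearized perturbations -/

lemma HM.conv {k m : ℕ} {T U : TField k} {t u : ℕ → Tn k} (h : HM m T t) (hT : U = T)
    (ht : ∀ l, u l = t l) : HM m U u := by
  obtain rfl : u = t := funext ht
  exact hT ▸ h

/-- A linearized perturbation of finite norm with its expansion into spherical harmonics; the angular
perturbation is `j = D₁⋆ (a, b)`. -/
structure PertModes where
  f : TransFun
  j : TField 1
  φ : ℕ → Tn 0
  u : ℕ → Tn 0
  v : ℕ → Tn 0
  w : ℕ → Tn 0
  a : ℕ → Tn 0
  b : ℕ → Tn 0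
  hφ : HM 8 f.f φ
  hu : HM 6 f.f_u u
  hv : HM 4 f.f_uu v
  hw : HM 2 f.f_uuu w
  ha : ∀ l, a l ∈ harmA l
  hb : ∀ l, b l ∈ harmA l
  hj : HM 7 j fun l => D1A (a l, b l)

namespace PertModes

variable (x : PertModes)

/-- The perturbation of the sphere data of radius `2`. -/
def data : LinData := x.f.pert 2 + angPert 2 x.j

lemma a_mem (l : ℕ) : x.a l ∈ E 0 l := harmA_le_E l (x.ha l)

lemma b_mem (l : ℕ) : x.b l ∈ E 0 l := harmA_le_E l (x.hb l)

lemma data_Om : x.data.Om = (1 / 2 : ℝ) • x.f.f_u := add_zero _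

lemma data_phi : x.data.phi = -x.f.f + ((2 : ℝ) / 2) • div1 x.j := rfl

lemma data_gc : x.data.gc = (-2 : ℝ) • D2s x.j := zero_add _

lemma data_trX : x.data.trX = ((2 : ℝ) / 2 ^ 2) • (lap x.f.f + x.f.f) := add_zero _

lemma data_trXb : x.data.trXb = (-2 : ℝ) • x.f.duQuot 2 := add_zero _

lemma data_chibh : x.data.chibh = 0 := add_zero _

lemma data_eta : x.data.eta = (2 : ℝ) • grad (x.f.duQuot 2) := add_zero _

lemma data_omb : x.data.omb = (1 / 2 : ℝ) • x.f.f_uu := add_zero _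

lemma data_Dbomb : x.data.Dbomb = (1 / 2 : ℝ) • x.f.f_uuu := add_zero _

lemma data_alb : x.data.alb = 0 := add_zero _

lemma hm_div_j : HM 6 (div1 x.j) fun l => ev l • x.a l := by
  have h := x.hj.div1
  simpa only [divA_D1A (x.a_mem _)] using h

lemma hm_Om : HM 6 x.data.Om fun l => (1 / 2 : ℝ) • x.u l := by
  rw [data_Om]
  exact x.hu.smul _

lemma hm_phi : HM 6 x.data.phi fun l => ev l • x.a l - x.φ l := by
  rw [data_phi]
  refine HM.conv ((x.hφ.mono (m' := 6) (by norm_num)).neg.add (x.hm_div_j.smul _)) rfl fun l => ?_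
  module

lemma hm_gc : HM 6 x.data.gc fun l => (-2 : ℝ) • D2A (D1A (x.a l, x.b l)) := by
  rw [data_gc]
  exact x.hj.D2s.smul _

lemma hm_trX : HM 6 x.data.trX fun l => ((1 - ev l) / 2) • x.φ l := by
  rw [data_trX]
  refine HM.conv ((x.hφ.lap.add (x.hφ.mono (m' := 6) (by norm_num))).smul _) rfl fun l => ?_
  module

lemma hm_duQuot : HM 6 (x.f.duQuot 2) fun l => (1 / 2 : ℝ) • x.u l + (1 / 4 : ℝ) • x.φ l := by
  refine HM.conv ((x.hu.smul (1 / 2)).add ((x.hφ.mono (m' := 6) (by norm_num)).smul (1 / 2 ^ 2))) rfl fun l => ?_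
  module

lemma hm_trXb : HM 6 x.data.trXb fun l => - x.u l - (1 / 2 : ℝ) • x.φ l := by
  rw [data_trXb]
  refine HM.conv (x.hm_duQuot.smul _) rfl fun l => ?_
  module

lemma hm_eta : HM 5 x.data.eta fun l => covA (x.u l + (1 / 2 : ℝ) • x.φ l) := by
  rw [data_eta]
  refine HM.conv (x.hm_duQuot.grad.smul _) rfl fun l => ?_
  rw [← map_smul]
  congr 1
  module

lemma hm_B : HM 6 (x.data.B 2) fun l => ((1 - ev l) / 2) • x.φ l - x.u l := by
  refine HM.conv (x.hm_trX.sub (x.hm_Om.smul (4 / 2))) rfl fun l => ?_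
  module

/-- The contributions of f_u to η and to (r/2)dB cancel, so this combination only depends on f. -/
lemma hm_eta_add : HM 5 (x.data.eta + ((2 : ℝ) / 2) • grad (x.data.B 2))
    fun l => covA ((1 - ev l / 2) • x.φ l) := by
  refine HM.conv (x.hm_eta.add (x.hm_B.grad.smul (2 / 2))) rfl fun l => ?_
  rw [← map_smul, ← map_add]
  congr 1
  module

lemma hm_div_eta_add : HM 4 (div1 (x.data.eta + ((2 : ℝ) / 2) • grad (x.data.B 2)))
    fun l => (-(ev l) * (1 - ev l / 2)) • x.φ l := by
  refine HM.conv (x.hm_eta_add.div1) rfl fun l => ?_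
  rw [divA_covA (mem_Tan_zero _), lapA_of_mem_E_zero ((E 0 l).smul_mem _ (x.hφ.mem l))]
  module

lemma hm_div2_gc : HM 5 (div2 x.data.gc) fun l => (2 - ev l) • D1A (x.a l, x.b l) := by
  refine HM.conv (x.hm_gc.div2) rfl fun l => ?_
  rw [map_smul, divA_D2A (D1A_mem_E (x.a_mem l) (x.b_mem l))]
  module

lemma hm_div1_div2_gc : HM 4 (div1 (div2 x.data.gc)) fun l => (ev l * (2 - ev l)) • x.a l := by
  refine HM.conv (x.hm_div2_gc.div1) rfl fun l => ?_
  rw [map_smul, divA_D1A (x.a_mem l)]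
  module

/-- The angular potential a cancels: the linearized Gauss curvature at a metric of constant
curvature is invariant under diffeomorphisms. -/
lemma hm_gaussK : HM 4 (x.data.gaussK 2) fun l => ((2 - ev l) / 8) • x.φ l := by
  refine HM.conv ((x.hm_div1_div2_gc.smul (1 / (2 * 2 ^ 2))).sub
    ((x.hm_phi.lap.add ((x.hm_phi.mono (m' := 4) (by norm_num)).smul 2)).smul (1 / 2 ^ 3))) rfl fun l => ?_
  module

lemma hm_Q0 : HM 5 (x.data.Q0 2) fun _ => 0 := by
  refine HM.conv (((x.hm_eta.modes1 {1}).smul (2 ^ 2)).add ((((x.hm_trX.modes {1}).sub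
    ((x.hm_Om.modes {1}).smul (4 / 2))).grad).smul (2 ^ 3 / 2))) rfl fun l => ?_
  by_cases hl : l = 1
  · subst hl
    rw [Set.indicator_of_mem (Set.mem_singleton _), Set.indicator_of_mem (Set.mem_singleton _),
      Set.indicator_of_mem (Set.mem_singleton _), ← map_smul, ← map_smul, ← map_add]
    refine (map_zero covA).symm.trans (congrArg covA ?_)
    -- In degree 1, λ = 2 and the potential is 4(u + φ/2) + 4(-φ/2 - u) = 0.
    norm_num [ev]
    module
  · simp [Set.indicator_of_notMem (show l ∉ ({1} : Set ℕ) from hl)]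

lemma hm_Q1 : HM 6 (x.data.Q1 2) fun l => (ev l / 2) • (x.a l - x.φ l) - x.u l := by
  refine HM.conv ((x.hm_B.smul (2 / 2)).add (x.hm_phi.smul (1 / 2))) rfl fun l => ?_
  module

/-- The f_u terms of trXb and B cancel and a has dropped out with the curvature. The remaining
multiplier of φ vanishes in degrees 0 and 1, which is the gauge invariance, and is invertible of
order four beyond them. -/
lemma hm_Q2 : HM 4 (x.data.Q2 2) fun l => (-2 * (ev l * (ev l - 2))) • x.φ l := by
  have h1 : HM 4 (div1 ((2 : ℝ) ^ 2 • x.data.eta + ((2 : ℝ) ^ 3 / 2) • grad (x.data.B 2)))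
      fun l => (-4 * (ev l) * (1 - ev l / 2)) • x.φ l := by
    have h2 : (2 : ℝ) ^ 2 • x.data.eta + ((2 : ℝ) ^ 3 / 2) • grad (x.data.B 2)
        = (4 : ℝ) • (x.data.eta + ((2 : ℝ) / 2) • grad (x.data.B 2)) := by module
    rw [h2]
    refine HM.conv ((x.hm_eta_add.smul 4).div1) rfl fun l => ?_
    rw [map_smul, divA_covA (mem_Tan_zero _),
      lapA_of_mem_E_zero ((E 0 l).smul_mem _ (x.hφ.mem l))]
    module
  refine HM.conv (((((x.hm_trXb.mono (m' := 4) (by norm_num)).smul (2 ^ 2)).sub (h1.smul (2 / 2))).sub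
    ((x.hm_B.mono (m' := 4) (by norm_num)).smul (2 ^ 2))).add (x.hm_gaussK.smul (2 * 2 ^ 3))) rfl fun l => ?_
  module

lemma covA_eq_D1A (Y : Tn 0) : covA Y = D1A (-Y, 0) := by
  rw [D1A_apply, map_neg, map_zero, map_zero, neg_neg, add_zero]

lemma D1A_add (Y Z Y' Z' : Tn 0) : D1A (Y, Z) + D1A (Y', Z') = D1A (Y + Y', Z + Z') :=
  (map_add D1A (Y, Z) (Y', Z')).symm

lemma D1A_smul (c : ℝ) (Y Z : Tn 0) : c • D1A (Y, Z) = D1A (c • Y, c • Z) :=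
  (map_smul D1A c (Y, Z)).symm

/-- All terms are D₂⋆ of 1-forms. In degree l, D₂⋆ div + 1 multiplies D₂⋆D₁⋆(a, b) by λ/2, while the
two terms in B and η combine to the potential -(λ/2)φ - 2u. -/
lemma hm_Q3 : HM 4 (x.data.Q3 2) fun l =>
    D2A (D1A ((ev l / 2) • (x.a l - x.φ l) - (2 : ℝ) • x.u l, (ev l / 2) • x.b l)) := by
  have h1 := ((HM.zero (k := 2) (m := 4)).congr
    (show (0 : TField 2) =ᵐ[σ] x.data.chibh from by rw [data_chibh])).smul (1 / 2)
  have h2 := (x.hm_div2_gc.D2s.add (x.hm_gc.mono (m' := 4) (by norm_num))).smul (1 / 2)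
  refine HM.conv (((h1.sub h2).add x.hm_eta_add.D2s).sub
    ((x.hm_B.grad.D2s.mono (m' := 4) (by norm_num)).smul 2)) rfl fun l => ?_
  simp only [covA_eq_D1A, ← map_smul D2A, ← map_add D2A, ← map_sub D2A, smul_zero, zero_sub,
    ← map_neg D2A]
  congr 1
  simp only [sub_eq_add_neg, ← neg_one_smul ℝ (D1A _), D1A_add, D1A_smul, smul_zero,
    smul_add]
  congr 2 <;> module

/-- The forms η/r and ½ d trXb cancel on the perturbation, and the tensor entries χ̲̂ and α̲ are
zero, so only f_uu remains. -/
lemma hm_Q4 : HM 2 (x.data.Q4 2) fun l => D2A (D1A (x.v l, 0)) := by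
  have h1 : HasModes (elec x.data.alb) fun l => D2A (D1A ((0 : Tn 0), 0)) := by
    refine HasModes.elec (Z := fun _ => 0) ?_ fun l => Submodule.zero_mem _
    rw [data_alb]
    convert hasModes_zero with l
    exact (congrArg D2A (map_zero D1A)).trans (map_zero D2A)
  have h1' : HM 2 (elec x.data.alb) fun l => D2A (D1A ((0 : Tn 0), 0)) := by
    refine ⟨h1, ?_⟩
    have : (fun _ : ℕ => D2A (D1A ((0 : Tn 0), 0))) = fun _ => 0 :=
      funext fun _ => (congrArg D2A (map_zero D1A)).trans (map_zero D2A)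
    rw [this, energy_zero_seq]
    simp
  have h2 : HM 3 (div2 x.data.chibh) fun _ => 0 := by
    rw [data_chibh]
    convert (HM.zero (k := 2) (m := 4)).div2 with l
    exact (map_zero divA).symm
  have h3 : HM 3 (D1s x.data.omb 0) fun l => D1A ((1 / 2 : ℝ) • x.v l, 0) := by
    refine HM.D1s ?_ HM.zero
    rw [data_omb]
    exact x.hv.smul _
  have h4 := (((h2.smul (1 / 2 ^ 2)).sub ((x.hm_eta.mono (m' := 3) (by norm_num)).smul (1 / 2))).sub
    (((x.hm_trXb.mono (m' := 4) (by norm_num)).grad).smul (1 / 2))).add h3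
  have h5 : HM 2 (D2s ((1 / 2 ^ 2 : ℝ) • div2 x.data.chibh - (1 / 2 : ℝ) • x.data.eta
      - (1 / 2 : ℝ) • grad x.data.trXb + D1s x.data.omb 0))
      fun l => D2A (D1A ((1 / 2 : ℝ) • x.v l, 0)) := by
    refine HM.conv (h4.D2s) rfl fun l => ?_
    rw [smul_zero, ← map_smul, ← map_smul, zero_sub, ← map_neg, ← map_sub]
    have : -((1 / 2 : ℝ) • (x.u l + (1 / 2 : ℝ) • x.φ l))
        - (1 / 2 : ℝ) • (-x.u l - (1 / 2 : ℝ) • x.φ l) = 0 := by module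
    rw [this, map_zero, zero_add]
  have h6 : HM 2 _ _ := ⟨h5.toHasModes.elec fun l =>
    (harmA l).smul_mem _ (x.hv.toHasModes.mem_harmA l), h5.fin⟩
  refine HM.conv ((h1'.smul (1 / 2)).add (h6.smul 2)) rfl fun l => ?_
  simp only [← map_smul D2A, ← map_add D2A, D1A_smul, D1A_add]
  congr 3 <;> module

lemma hm_modes_Q2 : HM 4 (modes {l | l ≤ 1} (x.data.Q2 2)) fun _ => 0 := by
  refine HM.conv (x.hm_Q2.modes {l | l ≤ 1}) rfl fun l => ?_
  by_cases hl : l ≤ 1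
  · rw [Set.indicator_of_mem (show l ∈ {l | l ≤ 1} from hl)]
    interval_cases l <;> norm_num [ev]
  · rw [Set.indicator_of_notMem (show l ∉ {l | l ≤ 1} from hl)]

lemma hm_div_Q0 : HM 4 (div1 (x.data.Q0 2)) fun _ => 0 := by
  refine HM.conv (x.hm_Q0.div1) rfl fun l => ?_
  exact (map_zero divA).symm

lemma hm_Q5 : HM 4 (x.data.Q5 2) ({l | l ≤ 1}.indicator fun l => (1 / 2 : ℝ) • x.v l) := by
  have h : HM 4 x.data.omb fun l => (1 / 2 : ℝ) • x.v l := by rw [data_omb]; exact x.hv.smul _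
  refine HM.conv (((h.modes {l | l ≤ 1}).add (x.hm_modes_Q2.smul (1 / (4 * 2 ^ 2)))).add
    (x.hm_div_Q0.smul (1 / (3 * 2 ^ 3)))) rfl fun l => ?_
  simp

lemma hm_Dbomb : HM 2 x.data.Dbomb fun l => (1 / 2 : ℝ) • x.w l := by
  rw [data_Dbomb]
  exact x.hw.smul _

lemma hm_Q6 : HM 2 (x.data.Q6 2) ({l | l ≤ 1}.indicator fun l => (1 / 2 : ℝ) • x.w l) := by
  refine HM.conv (((x.hm_Dbomb.modes {l | l ≤ 1}).sub ((x.hm_modes_Q2.lap.sub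
    ((x.hm_modes_Q2.mono (m' := 2) (by norm_num)).smul 3)).smul (1 / (6 * 2 ^ 3)))).add
    ((x.hm_div_Q0.mono (m' := 2) (by norm_num)).smul (1 / 2 ^ 4))) rfl fun l => ?_
  simp

lemma hm_Q7 : HM 2 (x.data.Q7 2) (({2} : Set ℕ).indicator fun l => (1 / 2 : ℝ) • x.w l
    + (3 / 16 * (-2 * (ev l * (ev l - 2)))) • x.φ l
    + (3 / 2 : ℝ) • ((ev l / 2) • (x.a l - x.φ l) - (2 : ℝ) • x.u l)
    - (3 : ℝ) • ((ev l / 2) • (x.a l - x.φ l) - x.u l)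
    + (9 / 2 : ℝ) • (x.φ l + x.a l)) := by
  have hY : ∀ l, (ev l / 2) • (x.a l - x.φ l) - (2 : ℝ) • x.u l ∈ harmA l := fun l =>
    (harmA l).sub_mem ((harmA l).smul_mem _ ((harmA l).sub_mem (x.ha l)
      (x.hφ.toHasModes.mem_harmA l))) ((harmA l).smul_mem _ (x.hu.toHasModes.mem_harmA l))
  have hZ : ∀ l, (ev l / 2) • x.b l ∈ harmA l := fun l => (harmA l).smul_mem _ (x.hb l)
  have h3 := (x.hm_Q3.modes2 (fun l => mem_tensA.mpr ⟨_, hY l, _, hZ l, rfl⟩) {2}).div2.div1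
  refine HM.conv ((((((x.hm_Dbomb.modes {2}).add (((x.hm_Q2.mono (m' := 2) (by norm_num)).modes {2}).smul
    (3 / (2 * 2 ^ 3)))).add (h3.smul (1 / (2 * 2 ^ 2)))).sub
    (((x.hm_Q1.mono (m' := 2) (by norm_num)).modes {2}).smul (12 / 2 ^ 2))).add
    (((x.hm_div_eta_add.mono (m' := 2) (by norm_num)).modes {2}).smul (3 / (2 * 2 ^ 2)))).sub
    (((x.hm_div1_div2_gc.mono (m' := 2) (by norm_num)).modes {2}).smul (3 / (4 * 2 ^ 2)))) rfl fun l => ?_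
  by_cases hl : l = 2
  · subst hl
    simp only [Set.indicator_of_mem (Set.mem_singleton 2)]
    -- At λ = 6, div div of the third charge contributes 2 · 6 times its electric potential, hence
    -- the coefficient 12/8 = 3/2. The last two terms of the charge give (9/2)φ and (9/2)a.
    rw [divA_D2A (D1A_mem_E (harmA_le_E 2 (hY 2)) (harmA_le_E 2 (hZ 2))), map_smul,
      divA_D1A (harmA_le_E 2 (hY 2))]
    norm_num [ev]
    module
  · simp [Set.indicator_of_notMem (show l ∉ ({2} : Set ℕ) from hl)]

end PertModes

/-- Perturbations of finite norm have expansions. -/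
lemma exists_pertModes {f : TransFun} {j : TField 1} (hf : f.norm < ⊤) (hj : angNorm j < ⊤) :
    ∃ x : PertModes, x.f = f ∧ x.j = j := by
  simp only [TransFun.norm, ENNReal.add_lt_top] at hf
  obtain ⟨φ, hφ, -⟩ := exists_HM_of_sobNorm one_pos hf.1.1.1
  obtain ⟨u, hu, -⟩ := exists_HM_of_sobNorm one_pos hf.1.1.2
  obtain ⟨v, hv, -⟩ := exists_HM_of_sobNorm one_pos hf.1.2
  obtain ⟨w, hw, -⟩ := exists_HM_of_sobNorm one_pos hf.2
  obtain ⟨a, b, hab, ha, hb⟩ := exists_HM_of_sobNorm_one one_pos hj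
  exact ⟨⟨f, j, φ, u, v, w, a, b, hφ, hu, hv, hw, ha, hb, hab⟩, rfl, rfl⟩

lemma invariant_charges {f : TransFun} {j : TField 1} (hf : f.norm < ⊤) (hj : angNorm j < ⊤) :
    (f.pert 2 + angPert 2 j).Q0 2 =ᵐ[σ] 0 ∧
      modes {l | l ≤ 1} ((f.pert 2 + angPert 2 j).Q2 2) =ᵐ[σ] 0 := by
  obtain ⟨x, rfl, rfl⟩ := exists_pertModes hf hj
  exact ⟨x.hm_Q0.toHasModes.ae_eq hasModes_zero, x.hm_modes_Q2.toHasModes.ae_eq hasModes_zero⟩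

end

section

/-! ## Uniform bounds -/

section Families

variable {ι : Type} {N : ι → ℝ≥0∞} {k m : ℕ}

/-- The `H^m` energies of a family of expansions are controlled by `N`. -/
def EnergyBound (N : ι → ℝ≥0∞) {k : ℕ} (m : ℕ) (t : ι → ℕ → Tn k) : Prop :=
  ∃ C : ℝ≥0, ∀ i, energy m (t i) ≤ C * N i

lemma EnergyBound.trans {k' m' : ℕ} {t : ι → ℕ → Tn k} {u : ι → ℕ → Tn k'}
    (h : EnergyBound N m u) (C : ℝ≥0) (hC : ∀ i, energy m' (t i) ≤ C * energy m (u i)) :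
    EnergyBound N m' t := by
  obtain ⟨C', hC'⟩ := h
  refine ⟨C * C', fun i => (hC i).trans ?_⟩
  rw [ENNReal.coe_mul, mul_assoc]
  exact mul_le_mul_right (hC' i) _

lemma EnergyBound.mono {m' : ℕ} {t : ι → ℕ → Tn k} (h : EnergyBound N m t) (hm : m' ≤ m) :
    EnergyBound N m' t :=
  h.trans 1 fun i => by rw [ENNReal.coe_one, one_mul]; exact energy_mono hm

lemma EnergyBound.add {t u : ι → ℕ → Tn k} (h : EnergyBound N m t) (h' : EnergyBound N m u) :
    EnergyBound N m fun i l => t i l + u i l := by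
  obtain ⟨C, hC⟩ := h
  obtain ⟨C', hC'⟩ := h'
  refine ⟨2 * (C + C'), fun i => energy_add_le.trans ?_⟩
  rw [ENNReal.coe_mul, ENNReal.coe_add, mul_assoc, add_mul]
  exact mul_le_mul_right (add_le_add (hC i) (hC' i)) _

lemma EnergyBound.smul {t : ι → ℕ → Tn k} (h : EnergyBound N m t) (c : ℝ) :
    EnergyBound N m fun i l => c • t i l :=
  h.trans _ fun _ => energy_smul_le c

lemma EnergyBound.sub {t u : ι → ℕ → Tn k} (h : EnergyBound N m t) (h' : EnergyBound N m u) :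
    EnergyBound N m fun i l => t i l - u i l := by
  simpa [sub_eq_add_neg] using h.add (h'.smul (-1))

lemma EnergyBound.zero : EnergyBound N m fun _ _ => (0 : Tn k) :=
  ⟨0, fun i => by simp [energy_zero_seq]⟩

/-- Multiplication of the modes by constants that decay with a power of the degree. -/
lemma EnergyBound.mul {t : ι → ℕ → Tn k} (h : EnergyBound N m t) (n : ℕ) (c : ℕ → ℝ) (C : ℝ≥0)
    (hc : ∀ l, |c l| * (1 + ev l) ^ n ≤ C) : EnergyBound N (m + 2 * n) fun i l => c l • t i l := by
  -- The energy is quadratic: a coefficient decaying like (1 + λ)⁻ⁿ enters squared and gains 2n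
  -- orders.
  refine h.trans (C ^ 2) fun i => energy_le_mul _ fun l => ?_
  have h1 : 0 ≤ (1 + ev l) ^ n := zero_le_one.trans (one_le_pow_ev l n)
  have h2 : (|c l| * (1 + ev l) ^ n) ^ 2 ≤ (C : ℝ) ^ 2 :=
    pow_le_pow_left₀ (mul_nonneg (abs_nonneg _) h1) (hc l) 2
  have h3 := mul_le_mul_of_nonneg_right h2
    (mul_nonneg (zero_le_one.trans (one_le_pow_ev l m)) (nsq_nonneg (t i l)))
  rw [nsq_smul, NNReal.coe_pow]
  refine le_trans (le_of_eq ?_) h3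
  rw [mul_pow, sq_abs]
  ring

lemma EnergyBound.indicator {t : ι → ℕ → Tn k} (h : EnergyBound N m t) (s : Set ℕ) :
    EnergyBound N m fun i => s.indicator (t i) :=
  h.trans 1 fun i => by rw [ENNReal.coe_one, one_mul]; exact energy_indicator_le s

/-- The fields `T i` in `H^m` have norm controlled by `N`. -/
def FieldBound (N : ι → ℝ≥0∞) {k : ℕ} (m : ℕ) (T : ι → TField k) : Prop :=
  ∃ t : ι → ℕ → Tn k, (∀ i, HM m (T i) (t i)) ∧ EnergyBound N m t

variable {T U : ι → TField k}

lemma FieldBound.mono {m' : ℕ} (h : FieldBound N m T) (hm : m' ≤ m) : FieldBound N m' T := by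
  obtain ⟨t, h1, h2⟩ := h
  exact ⟨t, fun i => (h1 i).mono hm, h2.mono hm⟩

lemma FieldBound.zero : FieldBound N m fun _ => (0 : TField k) :=
  ⟨_, fun _ => HM.zero, EnergyBound.zero⟩

lemma FieldBound.add (h : FieldBound N m T) (h' : FieldBound N m U) :
    FieldBound N m fun i => T i + U i := by
  obtain ⟨t, h1, h2⟩ := h
  obtain ⟨u, h1', h2'⟩ := h'
  exact ⟨_, fun i => (h1 i).add (h1' i), h2.add h2'⟩

lemma FieldBound.smul (h : FieldBound N m T) (c : ℝ) : FieldBound N m fun i => c • T i := by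
  obtain ⟨t, h1, h2⟩ := h
  exact ⟨_, fun i => (h1 i).smul c, h2.smul c⟩

lemma FieldBound.neg (h : FieldBound N m T) : FieldBound N m fun i => - T i := by
  simpa using h.smul (-1)

lemma FieldBound.sub (h : FieldBound N m T) (h' : FieldBound N m U) :
    FieldBound N m fun i => T i - U i := by
  simpa [sub_eq_add_neg] using h.add h'.neg

lemma FieldBound.cov (h : FieldBound N (m + 1) T) : FieldBound N m fun i => cov (T i) := by
  obtain ⟨t, h1, h2⟩ := h
  refine ⟨_, fun i => (h1 i).cov, h2.trans 1 fun i => ?_⟩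
  rw [ENNReal.coe_one, one_mul]
  exact energy_covAIter_le (i := 1) (h1 i).mem

lemma FieldBound.op (h : FieldBound N m T) {k' : ℕ} (L : Tn k →ₗ[SF] Tn k')
    (hL : ∀ l, ∀ w ∈ E k l, L w ∈ E k' l) : FieldBound N m fun i => opF L (T i) := by
  obtain ⟨t, h1, h2⟩ := h
  obtain ⟨C, hC⟩ := exists_energy_map_le L
  exact ⟨_, fun i => (h1 i).op L fun l => hL l _ ((h1 i).mem l), h2.trans C fun i => hC m (t i)⟩

lemma FieldBound.div1 {X : ι → TField 1} (h : FieldBound N (m + 1) X) :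
    FieldBound N m fun i => div1 (X i) := by
  simp only [div1_eq]
  exact h.cov.op trA fun l w hw => trA_mem_E hw

lemma FieldBound.mulMetric {φ : ι → TField 0} (h : FieldBound N m φ) :
    FieldBound N m fun i => mulMetric (φ i) := by
  simp only [mulMetric_eq_opF]
  exact h.op metA fun l w hw => metA_mem_E hw

lemma FieldBound.lap {f : ι → TField 0} (h : FieldBound N (m + 2) f) :
    FieldBound N m fun i => lap (f i) :=
  FieldBound.div1 (X := fun i => grad (f i)) h.cov

lemma FieldBound.D2s {X : ι → TField 1} (h : FieldBound N (m + 1) X) :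
    FieldBound N m fun i => D2s (X i) := by
  simp only [D2s_eq]
  exact ((h.cov.add (h.cov.op swapA fun l w hw => swapA_mem_E hw)).sub h.div1.mulMetric).smul _

/-- Quantities controlled by the square root of `N`. -/
def RootBound (N : ι → ℝ≥0∞) (F : ι → ℝ≥0∞) : Prop :=
  ∃ C : ℝ≥0, ∀ i, F i ≤ C * N i ^ (1 / 2 : ℝ)

lemma RootBound.add {F G : ι → ℝ≥0∞} (h : RootBound N F) (h' : RootBound N G) :
    RootBound N fun i => F i + G i := by
  obtain ⟨C, hC⟩ := h
  obtain ⟨C', hC'⟩ := h'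
  exact ⟨C + C', fun i => by
    rw [ENNReal.coe_add, add_mul]
    exact add_le_add (hC i) (hC' i)⟩

lemma le_rpow_half {a b : ℝ≥0∞} {C : ℝ≥0} (h : a ^ 2 ≤ C * b) :
    a ≤ (C ^ (1 / 2 : ℝ) : ℝ≥0) * b ^ (1 / 2 : ℝ) := by
  have h1 := ENNReal.rpow_le_rpow h (show (0 : ℝ) ≤ 1 / 2 by norm_num)
  rwa [← ENNReal.rpow_natCast, ← ENNReal.rpow_mul, ENNReal.mul_rpow_of_nonneg _ _ (by norm_num),
    show ((2 : ℕ) : ℝ) * (1 / 2) = 1 by norm_num, ENNReal.rpow_one,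
    ← ENNReal.coe_rpow_of_nonneg _ (by norm_num)] at h1

lemma FieldBound.sobNorm (h : FieldBound N m T) (r : ℝ) :
    RootBound N fun i => sobNorm r m (T i) := by
  obtain ⟨t, h1, C, hC⟩ := h
  obtain ⟨C', hC'⟩ := exists_sobNorm_le k r m
  refine ⟨(C' * C) ^ (1 / 2 : ℝ), fun i => le_rpow_half ((hC' _ _ (h1 i).toHasModes).trans ?_)⟩
  rw [ENNReal.coe_mul, mul_assoc]
  exact mul_le_mul_right (hC i) _

end Families

namespace PertModes

/-- The total energy of a perturbation. -/
def size (x : PertModes) : ℝ≥0∞ :=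
  energy 8 x.φ + energy 6 x.u + energy 4 x.v + energy 2 x.w + energy 7 fun l => D1A (x.a l, x.b l)

lemma fieldBound_of_le {k m : ℕ} {T : PertModes → TField k} {t : PertModes → ℕ → Tn k}
    (h : ∀ x, HM m (T x) (t x)) (hle : ∀ x, energy m (t x) ≤ x.size) : FieldBound size m T :=
  ⟨t, h, 1, fun x => by rw [ENNReal.coe_one, one_mul]; exact hle x⟩

lemma bound_f : FieldBound size 8 fun x => x.f.f :=
  fieldBound_of_le hφ fun x => by
    simp only [size, add_assoc]; exact le_self_add

lemma bound_fu : FieldBound size 6 fun x => x.f.f_u :=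
  fieldBound_of_le hu fun x => by
    simp only [size, add_assoc]; exact le_add_left le_self_add

lemma bound_fuu : FieldBound size 4 fun x => x.f.f_uu :=
  fieldBound_of_le hv fun x => by
    simp only [size, add_assoc]; exact le_add_left (le_add_left le_self_add)

lemma bound_fuuu : FieldBound size 2 fun x => x.f.f_uuu :=
  fieldBound_of_le hw fun x => by
    simp only [size, add_assoc]; exact le_add_left (le_add_left (le_add_left le_self_add))

lemma bound_j : FieldBound size 7 fun x => x.j :=
  fieldBound_of_le hj fun x => by
    simp only [size]; exact le_add_self

lemma bound_duQuot : FieldBound size 6 fun x => x.f.duQuot 2 :=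
  (bound_fu.smul _).add ((bound_f.mono (by norm_num)).smul _)

/-- Counting derivatives in every entry: Δf and D₂⋆df use two of the eight derivatives of f, η uses
one of the six of f/r and f_u, and the metric uses one of the seven of j. Treating all perturbations
as one family makes the constant uniform. -/
lemma norm_bound : RootBound size fun x =>
    x.f.norm + angNorm x.j + (x.f.pert 2).norm 2 + (angPert 2 x.j).norm 2 := by
  have hf6 : FieldBound size 6 fun x => x.f.f := bound_f.mono (by norm_num)
  have h0 : ∀ (k m : ℕ) (r : ℝ), RootBound size fun _ => CharGluing.sobNorm r m (0 : TField k) :=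
    fun k m r => FieldBound.zero.sobNorm r
  have h1 : RootBound size fun x => x.f.norm :=
    (((bound_f.sobNorm 1).add (bound_fu.sobNorm 1)).add (bound_fuu.sobNorm 1)).add
      (bound_fuuu.sobNorm 1)
  have hm : FieldBound size 6 fun x => (x.f.pert 2).metric 2 :=
    (hf6.neg.mulMetric.smul _).add (FieldBound.zero.smul _)
  have hm' : FieldBound size 6 fun x => (angPert 2 x.j).metric 2 :=
    ((bound_j.div1.smul _).mulMetric.smul _).add ((bound_j.D2s.smul _).smul _)
  have h2 : RootBound size fun x => (x.f.pert 2).norm 2 := by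
    refine ((((((((((((((bound_fu.smul _).sobNorm 2).add (hm.sobNorm 2)).add
      (((bound_f.lap.add hf6).smul _).sobNorm 2)).add ?_).add
      (((bound_duQuot.mono (by norm_num)).smul _).sobNorm 2)).add (h0 _ _ _)).add
      ((bound_duQuot.cov.smul _).sobNorm 2)).add (h0 _ _ _)).add (h0 _ _ _)).add
      ((bound_fuu.smul _).sobNorm 2)).add ((bound_fuuu.smul _).sobNorm 2)).add (h0 _ _ _)).add
      (h0 _ _ _))
    exact (((FieldBound.D2s (X := fun x : PertModes => grad x.f.f) bound_f.cov).mono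
      (by norm_num)).smul _).sobNorm 2
  have h3 : RootBound size fun x => (angPert 2 x.j).norm 2 :=
    ((((((((((((h0 _ _ _).add (hm'.sobNorm 2)).add (h0 _ _ _)).add (h0 _ _ _)).add
      (h0 _ _ _)).add (h0 _ _ _)).add (h0 _ _ _)).add (h0 _ _ _)).add (h0 _ _ _)).add
      (h0 _ _ _)).add (h0 _ _ _)).add (h0 _ _ _)).add (h0 _ _ _)
  exact ((h1.add (bound_j.sobNorm 1)).add h2).add h3

end PertModes

end

section

/-! ## Solving for the perturbation -/

/-- Prescribed charges with their expansions into spherical harmonics. -/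
structure ChargeModes where
  q₁ : TField 0
  q₂ : TField 0
  q₃ : TField 2
  q₄ : TField 2
  q₅ : TField 0
  q₆ : TField 0
  q₇ : TField 0
  p₁ : ℕ → Tn 0
  p₂ : ℕ → Tn 0
  Y : ℕ → Tn 0
  Z : ℕ → Tn 0
  P : ℕ → Tn 0
  p₅ : ℕ → Tn 0
  p₆ : ℕ → Tn 0
  p₇ : ℕ → Tn 0
  h₁ : HM 6 q₁ p₁
  h₂ : HM 4 q₂ p₂
  h₃ : HM 4 q₃ fun l => D2A (D1A (Y l, Z l))
  h₄ : HM 2 q₄ fun l => D2A (D1A (P l, 0))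
  h₅ : HM 4 q₅ p₅
  h₆ : HM 2 q₆ p₆
  h₇ : HM 2 q₇ p₇
  hY : ∀ l, Y l ∈ harmA l
  hZ : ∀ l, Z l ∈ harmA l
  hP : ∀ l, P l ∈ harmA l
  hp₂ : ∀ l ≤ 1, p₂ l = 0
  hp₅ : ∀ l, 2 ≤ l → p₅ l = 0
  hp₆ : ∀ l, 2 ≤ l → p₆ l = 0
  hp₇ : ∀ l, l ≠ 2 → p₇ l = 0

lemma six_le_ev {l : ℕ} (hl : 2 ≤ l) : 6 ≤ ev l := by
  have : (2 : ℝ) ≤ l := by exact_mod_cast hl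
  rw [ev]
  nlinarith

lemma nsq_D2A_D1A {l : ℕ} {Y Z : Tn 0} (hY : Y ∈ E 0 l) (hZ : Z ∈ E 0 l) :
    nsq (D2A (D1A (Y, Z))) = (ev l - 2) / 2 * ev l * (nsq Y + nsq Z) :=
  pair_D2A_D1A _ _ hY hZ

/-- The constant 6 works because (1 + λ)² ≤ 3λ(λ - 2) as soon as λ ≥ 6, that is from degree 2 on. -/
lemma sq_mul_nsq_le {l : ℕ} (hl : 2 ≤ l) {Y Z : Tn 0} (hY : Y ∈ E 0 l) (hZ : Z ∈ E 0 l) :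
    (1 + ev l) ^ 2 * (nsq Y + nsq Z) ≤ 6 * nsq (D2A (D1A (Y, Z))) := by
  rw [nsq_D2A_D1A hY hZ, ← mul_assoc]
  refine mul_le_mul_of_nonneg_right ?_ (add_nonneg (nsq_nonneg _) (nsq_nonneg _))
  have := six_le_ev hl
  nlinarith

lemma mem_indicator_harmA {s : Set ℕ} {t : ℕ → Tn 0} (ht : ∀ l, t l ∈ harmA l) (l : ℕ) :
    s.indicator t l ∈ harmA l := by
  by_cases h : l ∈ s
  · rw [Set.indicator_of_mem h]; exact ht l
  · rw [Set.indicator_of_notMem h]; exact Submodule.zero_mem _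

/-- The potentials of a tensor are two derivatives smoother than the tensor. -/
lemma energy_potential_le {m : ℕ} {Y Z : ℕ → Tn 0} (hY : ∀ l, Y l ∈ harmA l)
    (hZ : ∀ l, Z l ∈ harmA l) :
    energy (m + 2) ({l | 2 ≤ l}.indicator Y) ≤ (6 : ℝ≥0) * energy m fun l => D2A (D1A (Y l, Z l)) := by
  refine energy_le_mul _ fun l => ?_
  have h1 : 0 ≤ (1 + ev l) ^ m := zero_le_one.trans (one_le_pow_ev l m)
  by_cases hl : 2 ≤ l
  · rw [Set.indicator_of_mem (show l ∈ {l | 2 ≤ l} from hl)]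
    have h2 := mul_le_mul_of_nonneg_left
      (sq_mul_nsq_le hl (harmA_le_E l (hY l)) (harmA_le_E l (hZ l))) h1
    have h3 := mul_nonneg (mul_nonneg h1 (sq_nonneg (1 + ev l))) (nsq_nonneg (Z l))
    rw [pow_add, NNReal.coe_ofNat]
    linarith
  · rw [Set.indicator_of_notMem (show l ∉ {l | 2 ≤ l} from hl), nsq_zero, mul_zero]
    exact mul_nonneg (NNReal.coe_nonneg _) (mul_nonneg h1 (nsq_nonneg _))

lemma energy_swap {m : ℕ} {Y Z : ℕ → Tn 0} (hY : ∀ l, Y l ∈ harmA l) (hZ : ∀ l, Z l ∈ harmA l) :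
    energy m (fun l => D2A (D1A (Z l, Y l))) = energy m fun l => D2A (D1A (Y l, Z l)) := by
  simp only [energy]
  refine tsum_congr fun l => ?_
  rw [nsq_D2A_D1A (harmA_le_E l (hY l)) (harmA_le_E l (hZ l)),
    nsq_D2A_D1A (harmA_le_E l (hZ l)) (harmA_le_E l (hY l)), add_comm (nsq (Y l))]

lemma energy_D1A_le {m : ℕ} {a b : ℕ → Tn 0} (ha : ∀ l, a l ∈ harmA l) (hb : ∀ l, b l ∈ harmA l) :
    energy m (fun l => D1A (a l, b l)) ≤ energy (m + 1) a + energy (m + 1) b := by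
  rw [energy, energy, energy, ← ENNReal.tsum_add]
  refine ENNReal.tsum_le_tsum fun l => ?_
  have h1 : 0 ≤ (1 + ev l) ^ (m + 1) := zero_le_one.trans (one_le_pow_ev l _)
  have h2 : 0 ≤ (1 + ev l) ^ m := zero_le_one.trans (one_le_pow_ev l _)
  rw [← ENNReal.ofReal_add (mul_nonneg h1 (nsq_nonneg _)) (mul_nonneg h1 (nsq_nonneg _))]
  refine ENNReal.ofReal_le_ofReal ?_
  rw [nsq, pair_D1A _ _ (harmA_le_E l (ha l)) (harmA_le_E l (hb l)), ← nsq, ← nsq, pow_succ]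
  have h3 := mul_nonneg h2 (add_nonneg (nsq_nonneg (a l)) (nsq_nonneg (b l)))
  linarith

/-! ### Inverting the charges degree by degree -/

/-- The inverse of multiplication by `-2 λ (λ - 2)`. -/
def coefFour (l : ℕ) : ℝ := if 2 ≤ l then -(2 * (ev l * (ev l - 2)))⁻¹ else 0

/-- The inverse of multiplication by `λ / 2`. -/
def coefTwo (l : ℕ) : ℝ := if 2 ≤ l then 2 / ev l else 0

lemma coefFour_bound (l : ℕ) : |coefFour l| * (1 + ev l) ^ 2 ≤ (2 : ℝ≥0) := by
  rw [coefFour]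
  split_ifs with hl
  · have := six_le_ev hl
    have h : 0 < 2 * (ev l * (ev l - 2)) := by
      have : 0 < ev l * (ev l - 2) := mul_pos (by linarith) (by linarith)
      linarith
    rw [abs_neg, abs_of_pos (inv_pos.mpr h), inv_mul_le_iff₀ h, NNReal.coe_ofNat]
    nlinarith
  · simp

lemma coefTwo_bound (l : ℕ) : |coefTwo l| * (1 + ev l) ^ 1 ≤ (3 : ℝ≥0) := by
  rw [coefTwo]
  split_ifs with hl
  · have := six_le_ev hl
    have h : 0 < ev l := by linarith
    rw [abs_of_pos (div_pos two_pos h), div_mul_eq_mul_div, div_le_iff₀ h, NNReal.coe_ofNat]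
    linarith
  · simp

namespace ChargeModes

/-- The total energy of the charges. -/
def size (c : ChargeModes) : ℝ≥0∞ :=
  energy 6 c.p₁ + energy 4 c.p₂ + energy 4 (fun l => D2A (D1A (c.Y l, c.Z l)))
    + energy 2 (fun l => D2A (D1A (c.P l, 0))) + energy 4 c.p₅ + energy 2 c.p₆ + energy 2 c.p₇

variable (c : ChargeModes)

lemma size_lt_top : c.size < ⊤ := by
  simp only [size, ENNReal.add_lt_top]
  exact ⟨⟨⟨⟨⟨⟨c.h₁.fin, c.h₂.fin⟩, c.h₃.fin⟩, c.h₄.fin⟩, c.h₅.fin⟩, c.h₆.fin⟩, c.h₇.fin⟩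

/-- Potentials of the third charge, without irrelevant modes. -/
def y : ℕ → Tn 0 := {l | 2 ≤ l}.indicator c.Y

def z : ℕ → Tn 0 := {l | 2 ≤ l}.indicator c.Z

/-- Solves the second charge for f; in degrees 0 and 1 both the prescribed mode and the multiplier
vanish. -/
def φ (l : ℕ) : Tn 0 := coefFour l • c.p₂ l

/-- In degrees at least 2, the first charge and the electric part of the third read (λ/2)(a-φ) - u =
p₁ and (λ/2)(a-φ) - 2u = y. Eliminating u gives (λ/2)(a-φ) = 2p₁ - y; in lower degrees a = φ = 0. -/
def a (l : ℕ) : Tn 0 := c.φ l + coefTwo l • ((2 : ℝ) • c.p₁ l - c.y l)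

def b (l : ℕ) : Tn 0 := coefTwo l • c.z l

/-- The difference of the same two equations is u = p₁ - y. In degrees 0 and 1 the third charge is
void and the first reduces to -u = p₁, whence the indicator switching the sign of p₁. -/
def u (l : ℕ) : Tn 0 := {l | 2 ≤ l}.indicator (fun l => (2 : ℝ) • c.p₁ l) l - c.p₁ l - c.y l

/-- The fourth and fifth charges do not compete: the fourth sees degrees at least 2 and the fifth
only degrees 0 and 1. -/
def v (l : ℕ) : Tn 0 := {l | 2 ≤ l}.indicator c.P l + (2 : ℝ) • c.p₅ l

/-- The second mode of the third transversal derivative. -/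
def wTwo (l : ℕ) : Tn 0 :=
  (2 : ℝ) • (c.p₇ l - (3 / 16 : ℝ) • c.p₂ l - (3 / 2 : ℝ) • c.y l + (3 : ℝ) • c.p₁ l
    - (9 / 2 : ℝ) • (c.φ l + c.a l))

/-- The sixth charge uses degrees 0 and 1 and the seventh only degree 2. Higher degrees are free and
vanish, since p₆ does. -/
def w (l : ℕ) : Tn 0 := (2 : ℝ) • c.p₆ l + ({2} : Set ℕ).indicator c.wTwo l

lemma energyBound_of_le {k m : ℕ} {t : ChargeModes → ℕ → Tn k}
    (h : ∀ c, energy m (t c) ≤ c.size) : EnergyBound size m t :=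
  ⟨1, fun c => by rw [ENNReal.coe_one, one_mul]; exact h c⟩

lemma bound_p₁ : EnergyBound size 6 p₁ := energyBound_of_le fun c => by
  simp only [size, add_assoc]; exact le_self_add

lemma bound_p₂ : EnergyBound size 4 p₂ := energyBound_of_le fun c => by
  simp only [size, add_assoc]; exact le_add_left le_self_add

lemma bound_YZ : EnergyBound size 4 fun c l => D2A (D1A (c.Y l, c.Z l)) :=
  energyBound_of_le fun c => by
    simp only [size, add_assoc]; exact le_add_left (le_add_left le_self_add)

lemma bound_P : EnergyBound size 2 fun c l => D2A (D1A (c.P l, 0)) :=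
  energyBound_of_le fun c => by
    simp only [size, add_assoc]; exact le_add_left (le_add_left (le_add_left le_self_add))

lemma bound_p₅ : EnergyBound size 4 p₅ := energyBound_of_le fun c => by
  simp only [size]; exact le_add_right (le_add_right le_add_self)

lemma bound_p₆ : EnergyBound size 2 p₆ := energyBound_of_le fun c => by
  simp only [size]; exact le_add_right le_add_self

lemma bound_p₇ : EnergyBound size 2 p₇ := energyBound_of_le fun c => by
  simp only [size]; exact le_add_self

lemma bound_y : EnergyBound size 6 y :=
  bound_YZ.trans 6 fun c => energy_potential_le c.hY c.hZ

lemma bound_z : EnergyBound size 6 z :=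
  bound_YZ.trans 6 fun c => by
    rw [← energy_swap c.hY c.hZ]
    exact energy_potential_le c.hZ c.hY

lemma bound_φ : EnergyBound size 8 φ := bound_p₂.mul 2 coefFour 2 coefFour_bound

lemma bound_a : EnergyBound size 8 a :=
  bound_φ.add (((bound_p₁.smul 2).sub bound_y).mul 1 coefTwo 3 coefTwo_bound)

lemma bound_b : EnergyBound size 8 b := bound_z.mul 1 coefTwo 3 coefTwo_bound

lemma bound_u : EnergyBound size 6 u :=
  (((bound_p₁.smul 2).indicator {l | 2 ≤ l}).sub bound_p₁).sub bound_y

lemma bound_v : EnergyBound size 4 v := by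
  have h1 : EnergyBound size 4 fun c => {l | 2 ≤ l}.indicator c.P :=
    bound_P.trans 6 fun c =>
      energy_potential_le (m := 2) (Z := fun _ => 0) c.hP fun l => Submodule.zero_mem _
  exact h1.add (bound_p₅.smul 2)

lemma bound_w : EnergyBound size 2 w := by
  have h1 : EnergyBound size 2 p₁ := bound_p₁.mono (by norm_num)
  have h2 : EnergyBound size 2 p₂ := bound_p₂.mono (by norm_num)
  have h3 : EnergyBound size 2 y := bound_y.mono (by norm_num)
  have h4 : EnergyBound size 2 fun c l => c.φ l + c.a l := (bound_φ.add bound_a).mono (by norm_num)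
  have h5 : EnergyBound size 2 wTwo :=
    ((((bound_p₇.sub (h2.smul (3 / 16))).sub (h3.smul (3 / 2))).add (h1.smul 3)).sub
      (h4.smul (9 / 2))).smul 2
  have h6 : EnergyBound size 2 fun c => ({2} : Set ℕ).indicator c.wTwo := h5.indicator {2}
  exact (bound_p₆.smul 2).add h6

lemma p₁_mem (l : ℕ) : c.p₁ l ∈ harmA l := c.h₁.toHasModes.mem_harmA l

lemma p₂_mem (l : ℕ) : c.p₂ l ∈ harmA l := c.h₂.toHasModes.mem_harmA l

lemma y_mem (l : ℕ) : c.y l ∈ harmA l := mem_indicator_harmA c.hY l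

lemma z_mem (l : ℕ) : c.z l ∈ harmA l := mem_indicator_harmA c.hZ l

lemma φ_mem (l : ℕ) : c.φ l ∈ harmA l := (harmA l).smul_mem _ (c.p₂_mem l)

lemma a_mem (l : ℕ) : c.a l ∈ harmA l :=
  (harmA l).add_mem (c.φ_mem l) ((harmA l).smul_mem _ ((harmA l).sub_mem
    ((harmA l).smul_mem _ (c.p₁_mem l)) (c.y_mem l)))

lemma b_mem (l : ℕ) : c.b l ∈ harmA l := (harmA l).smul_mem _ (c.z_mem l)

lemma u_mem (l : ℕ) : c.u l ∈ harmA l :=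
  (harmA l).sub_mem ((harmA l).sub_mem
    (mem_indicator_harmA (fun l => (harmA l).smul_mem _ (c.p₁_mem l)) l) (c.p₁_mem l)) (c.y_mem l)

lemma v_mem (l : ℕ) : c.v l ∈ harmA l :=
  (harmA l).add_mem (mem_indicator_harmA c.hP l)
    ((harmA l).smul_mem _ (c.h₅.toHasModes.mem_harmA l))

lemma w_mem (l : ℕ) : c.w l ∈ harmA l := by
  refine (harmA l).add_mem ((harmA l).smul_mem _ (c.h₆.toHasModes.mem_harmA l))
    (mem_indicator_harmA (fun l => (harmA l).smul_mem _ ?_) l)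
  exact (harmA l).sub_mem ((harmA l).add_mem ((harmA l).sub_mem ((harmA l).sub_mem
    (c.h₇.toHasModes.mem_harmA l) ((harmA l).smul_mem _ (c.p₂_mem l)))
    ((harmA l).smul_mem _ (c.y_mem l))) ((harmA l).smul_mem _ (c.p₁_mem l)))
    ((harmA l).smul_mem _ ((harmA l).add_mem (c.φ_mem l) (c.a_mem l)))

lemma bound_D1A : EnergyBound size 7 fun c l => D1A (c.a l, c.b l) := by
  obtain ⟨C, hC⟩ := bound_a
  obtain ⟨C', hC'⟩ := bound_b
  refine ⟨C + C', fun c => (energy_D1A_le c.a_mem c.b_mem).trans ?_⟩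
  rw [ENNReal.coe_add, add_mul]
  exact add_le_add (hC c) (hC' c)

lemma _root_.CharGluing.EnergyBound.exists_HM {k m : ℕ} {t : ChargeModes → ℕ → Tn k}
    (h : EnergyBound size m t) (ht : ∀ l, t c l ∈ E k l) : ∃ T, HM m T (t c) := by
  obtain ⟨C, hC⟩ := h
  exact CharGluing.exists_HM ht
    ((hC c).trans_lt (ENNReal.mul_lt_top ENNReal.coe_lt_top c.size_lt_top))

/-- The perturbation with the prescribed charges. -/
lemma exists_pertModes : ∃ C : ℝ≥0, ∀ c : ChargeModes, ∃ x : PertModes, x.size ≤ C * c.size ∧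
    x.φ = c.φ ∧ x.u = c.u ∧ x.v = c.v ∧ x.w = c.w ∧ x.a = c.a ∧ x.b = c.b := by
  obtain ⟨C₁, h₁⟩ := bound_φ
  obtain ⟨C₂, h₂⟩ := bound_u
  obtain ⟨C₃, h₃⟩ := bound_v
  obtain ⟨C₄, h₄⟩ := bound_w
  obtain ⟨C₅, h₅⟩ := bound_D1A
  refine ⟨C₁ + C₂ + C₃ + C₄ + C₅, fun c => ?_⟩
  obtain ⟨f, hf⟩ := bound_φ.exists_HM c fun l => harmA_le_E l (c.φ_mem l)
  obtain ⟨fu, hu⟩ := bound_u.exists_HM c fun l => harmA_le_E l (c.u_mem l)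
  obtain ⟨fuu, hv⟩ := bound_v.exists_HM c fun l => harmA_le_E l (c.v_mem l)
  obtain ⟨fuuu, hw⟩ := bound_w.exists_HM c fun l => harmA_le_E l (c.w_mem l)
  obtain ⟨j, hj⟩ := bound_D1A.exists_HM c fun l =>
    D1A_mem_E (harmA_le_E l (c.a_mem l)) (harmA_le_E l (c.b_mem l))
  refine ⟨⟨⟨f, fu, fuu, fuuu⟩, j, c.φ, c.u, c.v, c.w, c.a, c.b, hf, hu, hv, hw, c.a_mem, c.b_mem,
    hj⟩, ?_, rfl, rfl, rfl, rfl, rfl, rfl⟩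
  simp only [ENNReal.coe_add, add_mul]
  exact add_le_add (add_le_add (add_le_add (add_le_add (h₁ c) (h₂ c)) (h₃ c)) (h₄ c)) (h₅ c)

lemma eq_one (l : ℕ) : (ev l / 2) • (c.a l - c.φ l) - c.u l = c.p₁ l := by
  rw [a, u, y]
  by_cases hl : 2 ≤ l
  · have h := six_le_ev hl
    have h' : ev l ≠ 0 := by linarith
    simp only [Set.indicator_of_mem (show l ∈ {l | 2 ≤ l} from hl), coefTwo, if_pos hl]
    rw [add_sub_cancel_left, smul_smul, div_mul_div_comm, mul_comm (ev l) 2,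
      div_self (mul_ne_zero two_ne_zero h')]
    module
  · simp [Set.indicator_of_notMem (show l ∉ {l | 2 ≤ l} from hl), coefTwo, if_neg hl]

lemma eq_two (l : ℕ) : (-2 * (ev l * (ev l - 2))) • c.φ l = c.p₂ l := by
  rw [φ, smul_smul, coefFour]
  split_ifs with hl
  · have h := six_le_ev hl
    have h' : ev l * (ev l - 2) ≠ 0 := mul_ne_zero (by linarith) (by linarith)
    rw [mul_inv, neg_mul, neg_mul_neg, mul_mul_mul_comm, mul_inv_cancel₀ two_ne_zero,
      mul_inv_cancel₀ h', one_mul, one_smul]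
  · rw [mul_zero, zero_smul, c.hp₂ l (by lia)]

lemma eq_potential (l : ℕ) : (ev l / 2) • (c.a l - c.φ l) - (2 : ℝ) • c.u l
    = c.p₁ l - c.u l := by
  rw [← c.eq_one l]
  module

lemma eq_three (l : ℕ) :
    D2A (D1A ((ev l / 2) • (c.a l - c.φ l) - (2 : ℝ) • c.u l, (ev l / 2) • c.b l))
      = D2A (D1A (c.Y l, c.Z l)) := by
  by_cases hl : 2 ≤ l
  · have h := six_le_ev hl
    have h' : ev l ≠ 0 := by linarith
    rw [eq_potential, u, b, y, z]
    simp only [Set.indicator_of_mem (show l ∈ {l | 2 ≤ l} from hl), coefTwo, if_pos hl]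
    rw [smul_smul, div_mul_div_comm, mul_comm (ev l) 2, div_self (mul_ne_zero two_ne_zero h')]
    congr 3 <;> module
  · rw [D2A_D1A_eq_zero (not_le.mp hl) (harmA_le_E l (c.hY l)) (harmA_le_E l (c.hZ l))]
    refine D2A_D1A_eq_zero (not_le.mp hl) ?_ ((E 0 l).smul_mem _ (harmA_le_E l (c.b_mem l)))
    rw [eq_potential]
    exact (E 0 l).sub_mem (harmA_le_E l (c.p₁_mem l)) (harmA_le_E l (c.u_mem l))

lemma eq_four (l : ℕ) : D2A (D1A (c.v l, 0)) = D2A (D1A (c.P l, 0)) := by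
  by_cases hl : 2 ≤ l
  · rw [v, Set.indicator_of_mem (show l ∈ {l | 2 ≤ l} from hl), c.hp₅ l hl, smul_zero, add_zero]
  · rw [D2A_D1A_eq_zero (not_le.mp hl) (harmA_le_E l (c.v_mem l)) (Submodule.zero_mem _),
      D2A_D1A_eq_zero (not_le.mp hl) (harmA_le_E l (c.hP l)) (Submodule.zero_mem _)]

lemma eq_five : ({l | l ≤ 1}.indicator fun l => (1 / 2 : ℝ) • c.v l) = c.p₅ := by
  funext l
  by_cases hl : 2 ≤ l
  · rw [Set.indicator_of_notMem (show l ∉ {l | l ≤ 1} from (by lia : ¬ l ≤ 1)), c.hp₅ l hl]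
  · rw [Set.indicator_of_mem (show l ∈ {l | l ≤ 1} from Nat.lt_succ_iff.mp (not_le.mp hl)), v,
      Set.indicator_of_notMem (show l ∉ {l | 2 ≤ l} from hl)]
    module

lemma eq_six : ({l | l ≤ 1}.indicator fun l => (1 / 2 : ℝ) • c.w l) = c.p₆ := by
  funext l
  by_cases hl : 2 ≤ l
  · rw [Set.indicator_of_notMem (show l ∉ {l | l ≤ 1} from (by lia : ¬ l ≤ 1)), c.hp₆ l hl]
  · rw [Set.indicator_of_mem (show l ∈ {l | l ≤ 1} from Nat.lt_succ_iff.mp (not_le.mp hl)), w,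
      Set.indicator_of_notMem (show l ∉ ({2} : Set ℕ) from by rintro rfl; exact hl le_rfl)]
    module

lemma eq_seven : (({2} : Set ℕ).indicator fun l => (1 / 2 : ℝ) • c.w l
    + (3 / 16 * (-2 * (ev l * (ev l - 2)))) • c.φ l
    + (3 / 2 : ℝ) • ((ev l / 2) • (c.a l - c.φ l) - (2 : ℝ) • c.u l)
    - (3 : ℝ) • ((ev l / 2) • (c.a l - c.φ l) - c.u l)
    + (9 / 2 : ℝ) • (c.φ l + c.a l)) = c.p₇ := by
  funext l
  by_cases hl : l = 2
  · subst hl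
    -- In degree 2, p₆ = 0, so w is `wTwo`, and p₁ - u = y. Then `wTwo` is exactly the solution of
    -- the remaining equation for w.
    rw [Set.indicator_of_mem (Set.mem_singleton _), mul_smul, c.eq_two, c.eq_potential, c.eq_one, w,
      Set.indicator_of_mem (Set.mem_singleton _), c.hp₆ 2 le_rfl, u,
      Set.indicator_of_mem (show (2 : ℕ) ∈ {l | 2 ≤ l} from le_refl 2), wTwo]
    module
  · rw [Set.indicator_of_notMem (show l ∉ ({2} : Set ℕ) from hl), c.hp₇ l hl]

end ChargeModes

end

/-! ## Prescribing the charges -/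

lemma exists_chargeModes {q₁ q₂ q₅ q₆ q₇ : TField 0} {q₃ q₄ : TField 2} (hs₃ : IsSTF q₃)
    (hs₄ : IsSTF q₄) (hq₂ : modes {l | l ≤ 1} q₂ =ᵐ[σ] 0) (hq₅ : modes {l | 2 ≤ l} q₅ =ᵐ[σ] 0)
    (hq₆ : modes {l | 2 ≤ l} q₆ =ᵐ[σ] 0) (hq₇ : q₇ =ᵐ[σ] modes {2} q₇) (hq₄ : q₄ =ᵐ[σ] elec q₄)
    (hN : sobNorm 2 6 q₁ + sobNorm 2 4 q₂ + sobNorm 2 4 q₃ + sobNorm 2 2 q₄ < ⊤)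
    (hN' : sobNorm 2 4 q₅ + sobNorm 2 2 q₆ + sobNorm 2 2 q₇ < ⊤) :
    ∃ c : ChargeModes, c.q₁ = q₁ ∧ c.q₂ = q₂ ∧ c.q₃ = q₃ ∧ c.q₄ = q₄ ∧ c.q₅ = q₅ ∧ c.q₆ = q₆ ∧
      c.q₇ = q₇ := by
  simp only [ENNReal.add_lt_top] at hN hN'
  obtain ⟨p₁, h₁, -⟩ := exists_HM_of_sobNorm two_pos hN.1.1.1
  obtain ⟨p₂, h₂, -⟩ := exists_HM_of_sobNorm two_pos hN.1.1.2
  obtain ⟨Y, Z, h₃, hY, hZ⟩ := exists_HM_of_sobNorm_two two_pos hN.1.2 hs₃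
  obtain ⟨P, W, h₄, hP, -⟩ := exists_HM_of_sobNorm_two two_pos hN.2 hs₄
  obtain ⟨p₅, h₅, -⟩ := exists_HM_of_sobNorm two_pos hN'.1.1
  obtain ⟨p₆, h₆, -⟩ := exists_HM_of_sobNorm two_pos hN'.1.2
  obtain ⟨p₇, h₇, -⟩ := exists_HM_of_sobNorm two_pos hN'.2
  have hzero : ∀ {q : TField 0} {p : ℕ → Tn 0} {m : ℕ} {s : Set ℕ}, HM m q p →
      modes s q =ᵐ[σ] 0 → ∀ l ∈ s, p l = 0 := by
    intro q p m s hq hs l hl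
    have := congrFun (((hq.modes s).toHasModes.congr hs).unique hasModes_zero) l
    rwa [Set.indicator_of_mem hl] at this
  -- Uniqueness of expansions removes the magnetic potentials W, because q₄ equals its electric
  -- part.
  have h₄' : (fun l => D2A (D1A (P l, W l))) = fun l => D2A (D1A (P l, 0)) :=
    h₄.toHasModes.unique ((h₄.toHasModes.elec hP).congr hq₄.symm)
  rw [h₄'] at h₄
  have hp₇ : p₇ = ({2} : Set ℕ).indicator p₇ :=
    h₇.toHasModes.unique ((h₇.toHasModes.modes {2}).congr hq₇.symm)
  exact ⟨{
    q₁ := q₁, q₂ := q₂, q₃ := q₃, q₄ := q₄, q₅ := q₅, q₆ := q₆, q₇ := q₇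
    p₁ := p₁, p₂ := p₂, Y := Y, Z := Z, P := P, p₅ := p₅, p₆ := p₆, p₇ := p₇
    h₁ := h₁, h₂ := h₂, h₃ := h₃, h₄ := h₄, h₅ := h₅, h₆ := h₆, h₇ := h₇
    hY := hY, hZ := hZ, hP := hP
    hp₂ := hzero h₂ hq₂
    hp₅ := hzero h₅ hq₅
    hp₆ := hzero h₆ hq₆
    hp₇ := fun l hl => by
      rw [hp₇, Set.indicator_of_notMem (show l ∉ ({2} : Set ℕ) from hl)] },
    rfl, rfl, rfl, rfl, rfl, rfl, rfl⟩

namespace ChargeModes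

/-- The norm of the charges. -/
def norm (c : ChargeModes) : ℝ≥0∞ :=
  sobNorm 2 6 c.q₁ + sobNorm 2 4 c.q₂ + sobNorm 2 4 c.q₃ + sobNorm 2 2 c.q₄
    + sobNorm 2 4 c.q₅ + sobNorm 2 2 c.q₆ + sobNorm 2 2 c.q₇

lemma exists_size_le : ∃ C : ℝ≥0, ∀ c : ChargeModes, c.size ≤ C * c.norm ^ 2 := by
  obtain ⟨C₁, h₁⟩ := exists_energy_le 0 two_pos 6
  obtain ⟨C₂, h₂⟩ := exists_energy_le 0 two_pos 4
  obtain ⟨C₃, h₃⟩ := exists_energy_le 2 two_pos 4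
  obtain ⟨C₄, h₄⟩ := exists_energy_le 2 two_pos 2
  obtain ⟨C₆, h₆⟩ := exists_energy_le 0 two_pos 2
  refine ⟨C₁ + C₂ + C₃ + C₄ + C₂ + C₆ + C₆, fun c => ?_⟩
  have key : ∀ {e s : ℝ≥0∞} {C : ℝ≥0}, e ≤ C * s ^ 2 → s ≤ c.norm → e ≤ C * c.norm ^ 2 :=
    fun h hs => h.trans (mul_le_mul_right (pow_le_pow_left₀ zero_le hs 2) _)
  simp only [size, ENNReal.coe_add, add_mul]
  refine add_le_add (add_le_add (add_le_add (add_le_add (add_le_add (add_le_add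
    (key (h₁ _ _ c.h₁.toHasModes) ?_) (key (h₂ _ _ c.h₂.toHasModes) ?_))
    (key (h₃ _ _ c.h₃.toHasModes) ?_)) (key (h₄ _ _ c.h₄.toHasModes) ?_))
    (key (h₂ _ _ c.h₅.toHasModes) ?_)) (key (h₆ _ _ c.h₆.toHasModes) ?_))
    (key (h₆ _ _ c.h₇.toHasModes) ?_)
  · simp only [norm, add_assoc]; exact le_self_add
  · simp only [norm, add_assoc]; exact le_add_left le_self_add
  · simp only [norm, add_assoc]; exact le_add_left (le_add_left le_self_add)
  · simp only [norm, add_assoc]; exact le_add_left (le_add_left (le_add_left le_self_add))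
  · simp only [norm]; exact le_add_right (le_add_right le_add_self)
  · simp only [norm]; exact le_add_right le_add_self
  · simp only [norm]; exact le_add_self

end ChargeModes

lemma exists_perturbation : ∃ C : ℝ≥0, ∀ c : ChargeModes, ∃ x : PertModes,
    x.data.Q1 2 =ᵐ[σ] c.q₁ ∧ x.data.Q2 2 =ᵐ[σ] c.q₂ ∧ x.data.Q3 2 =ᵐ[σ] c.q₃ ∧
    x.data.Q4 2 =ᵐ[σ] c.q₄ ∧ x.data.Q5 2 =ᵐ[σ] c.q₅ ∧ x.data.Q6 2 =ᵐ[σ] c.q₆ ∧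
    x.data.Q7 2 =ᵐ[σ] c.q₇ ∧
    x.f.norm + angNorm x.j + (x.f.pert 2).norm 2 + (angPert 2 x.j).norm 2 ≤ C * c.norm := by
  obtain ⟨C₁, h₁⟩ := PertModes.norm_bound
  obtain ⟨C₂, h₂⟩ := ChargeModes.exists_pertModes
  obtain ⟨C₃, h₃⟩ := ChargeModes.exists_size_le
  refine ⟨C₁ * (C₂ * C₃) ^ (1 / 2 : ℝ), fun c => ?_⟩
  obtain ⟨x, hx, hφ, hu, hv, hw, ha, hb⟩ := h₂ c
  refine ⟨x, x.hm_Q1.toHasModes.ae_eq ?_, x.hm_Q2.toHasModes.ae_eq ?_,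
    x.hm_Q3.toHasModes.ae_eq ?_, x.hm_Q4.toHasModes.ae_eq ?_, x.hm_Q5.toHasModes.ae_eq ?_,
    x.hm_Q6.toHasModes.ae_eq ?_, x.hm_Q7.toHasModes.ae_eq ?_, ?_⟩
  · rw [hφ, hu, ha]; simp only [c.eq_one]; exact c.h₁.toHasModes
  · rw [hφ]; simp only [c.eq_two]; exact c.h₂.toHasModes
  · rw [hφ, hu, ha, hb]; simp only [c.eq_three]; exact c.h₃.toHasModes
  · rw [hv]; simp only [c.eq_four]; exact c.h₄.toHasModes
  · rw [hv, c.eq_five]; exact c.h₅.toHasModes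
  · rw [hw, c.eq_six]; exact c.h₆.toHasModes
  · rw [hφ, hu, hw, ha, c.eq_seven]; exact c.h₇.toHasModes
  · refine (h₁ x).trans ?_
    rw [ENNReal.coe_mul, mul_assoc]
    refine mul_le_mul_right ?_ _
    -- The energies are quadratic in the norms, so the square root of the energy bound is linear in
    -- the norm of the charges.
    have h4 : (x.size ^ (1 / 2 : ℝ)) ^ 2 ≤ (C₂ * C₃ : ℝ≥0) * c.norm ^ 2 := by
      rw [← ENNReal.rpow_natCast, ← ENNReal.rpow_mul,
        show (1 / 2 : ℝ) * ((2 : ℕ) : ℝ) = 1 by norm_num, ENNReal.rpow_one, ENNReal.coe_mul,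
        mul_assoc]
      exact hx.trans (mul_le_mul_right (h₃ c) _)
    refine (le_rpow_half h4).trans_eq ?_
    rw [← ENNReal.rpow_natCast, ← ENNReal.rpow_mul,
      show ((2 : ℕ) : ℝ) * (1 / 2 : ℝ) = 1 by norm_num, ENNReal.rpow_one]

end CharGluing

end

open CharGluing
theorem proposition4p2 :
    -- The two families of gauge-invariant charges take values in spaces of dimension 6 and 4 ...
    (Module.finrank ℝ (modeSpace (formHarm {1})) = 6 ∧
      Module.finrank ℝ (modeSpace (scalarHarm {l | l ≤ 1})) = 4) ∧
    -- ... and are invariant under linearized perturbations.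
    (∀ (f : TransFun) (j : TField 1), f.norm < ⊤ → angNorm j < ⊤ →
      (f.pert 2 + angPert 2 j).Q0 2 =ᵐ[σ] 0 ∧
      modes {l | l ≤ 1} ((f.pert 2 + angPert 2 j).Q2 2) =ᵐ[σ] 0) ∧
    -- The gauge-dependent charges can be prescribed.
    (∃ C : ℝ≥0, ∀ (q₁ q₂ q₅ q₆ q₇ : TField 0) (q₃ q₄ : TField 2),
      IsSTF q₃ → IsSTF q₄ →
      modes {l | l ≤ 1} q₂ =ᵐ[σ] 0 →
      modes {l | 2 ≤ l} q₅ =ᵐ[σ] 0 →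
      modes {l | 2 ≤ l} q₆ =ᵐ[σ] 0 →
      q₇ =ᵐ[σ] modes {2} q₇ →
      q₄ =ᵐ[σ] elec q₄ →
      sobNorm 2 6 q₁ + sobNorm 2 4 q₂ + sobNorm 2 4 q₃ + sobNorm 2 2 q₄ < ⊤ →
      sobNorm 2 4 q₅ + sobNorm 2 2 q₆ + sobNorm 2 2 q₇ < ⊤ →
      ∃ (f : TransFun) (j : TField 1),
        (f.pert 2 + angPert 2 j).Q1 2 =ᵐ[σ] q₁ ∧
        (f.pert 2 + angPert 2 j).Q2 2 =ᵐ[σ] q₂ ∧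
        (f.pert 2 + angPert 2 j).Q3 2 =ᵐ[σ] q₃ ∧
        (f.pert 2 + angPert 2 j).Q4 2 =ᵐ[σ] q₄ ∧
        (f.pert 2 + angPert 2 j).Q5 2 =ᵐ[σ] q₅ ∧
        (f.pert 2 + angPert 2 j).Q6 2 =ᵐ[σ] q₆ ∧
        (f.pert 2 + angPert 2 j).Q7 2 =ᵐ[σ] q₇ ∧
        f.norm + angNorm j + (f.pert 2).norm 2 + (angPert 2 j).norm 2 ≤
          C * (sobNorm 2 6 q₁ + sobNorm 2 4 q₂ + sobNorm 2 4 q₃ + sobNorm 2 2 q₄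
            + sobNorm 2 4 q₅ + sobNorm 2 2 q₆ + sobNorm 2 2 q₇)) := by
  refine ⟨⟨finrank_formHarm, finrank_scalarHarm⟩, fun f j hf hj => invariant_charges hf hj, ?_⟩
  obtain ⟨C, hC⟩ := exists_perturbation
  refine ⟨C, fun q₁ q₂ q₅ q₆ q₇ q₃ q₄ hs₃ hs₄ hq₂ hq₅ hq₆ hq₇ hq₄ hN hN' => ?_⟩
  obtain ⟨c, rfl, rfl, rfl, rfl, rfl, rfl, rfl⟩ :=
    exists_chargeModes hs₃ hs₄ hq₂ hq₅ hq₆ hq₇ hq₄ hN hN'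
  obtain ⟨x, h⟩ := hC c
  exact ⟨x.f, x.j, h⟩
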